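/- Let $a>0$, let $\Omega=\{x+iy:\ |x|,|y|<\tfrac a2\}$, $|\Omega|=a^2$ and $\Lambda=a\mathbb Z+ia\mathbb Z$. Put $n=2$, $(n_1,n_2)\in\{(2,0),(0,2)\}$, $n_3=2$, and $\tilde p_1=\tfrac a2$, $\tilde p_2=\tfrac{ia}2$, $\tilde p_3=\tfrac{a+ia}2$. Let $\tau\in\Omega$ be such that for every $j$ with $n_j\neq0$ the set $\tilde p_j+\tau+\Lambda$ does not meet $\partial\Omega$, and let $p_j$ be the unique point of $(\tilde p_j+\tau+\Lambda)\cap\Omega$ (points with $n_j=0$ are absent). Then the vortex configuration consisting of the concentration point $\tau$ with multiplicity $n$ and the points $p_j$ with multiplicities $n_j$ satisfies the nondegeneracy condition $$|\Gamma|\neq\Big|\Upsilon+\frac{n(2n+3)}{n+1}D_0\Big| ,$$ where the quantities are defined as follows (all of them exist, and the condition holds for every admissible choice made below). * $G$ is the Green function with pole $0$ of the torus $\mathbb C/\Lambda$: it is doubly periodic, $-\Delta G=\delta_0-\frac1{|\Omega|}$ and $\int_\Omega G=0$; and $G(z,p)=G(z-p)$. $H^*$ is a holomorphic function on $2\Omega$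 with $\operatorname{Re}H^*(z)=G(z)+\frac1{2\pi}\log|z|-\frac{|z|^2}{4|\Omega|}$. With $N=n+\sum_jn_j=2(n+1)$ and $u_0(z)=-4\pi nG(z,\tau)-4\pi\sum_jn_jG(z,p_j)$, $$\mathcal H(z)=\prod_j(z-p_j)^{n_j}\exp\Big(4\pi(n+1)H^*(z-\tau)+\tfrac{\pi(n+1)}{|\Omega|}|\tau|^2-\tfrac{2\pi(n+1)}{|\Omega|}z\bar\tau\Big)\exp\Big(-2\pi\Sigma(z)-\tfrac{\pi}{2|\Omega|}S+\tfrac{\pi}{|\Omega|}z\,\bar s\Big),$$ where $\Sigma(z)=nH^*(z-\tau)+\sum_jn_jH^*(z-p_j)$, $S=n|\tau|^2+\sum_jn_j|p_j|^2$, $s=n\tau+\sum_jn_jp_j$. Then $\mathcal H_0(z)=\mathcal H(z)/(z-\tau)^{n+2}$ satisfies $|\mathcal H_0|^2=e^{u_0+8\pi(n+1)G(z,\tau)}$. * $\sigma_0=-\big(\int^z\mathcal H_0\big)^{-1}$, with any anti-derivative of $\mathcal H_0$ on $\Omega\setminus\{\tau\}$. $q_0$ is holomorphic near $\tau$ with $q_0^{\,n+1}=\sigma_0$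 (any choice of the root), and $q_0^{-1}$ is its local inverse, with $q_0^{-1}(0)=\tau$. * $D_0=\frac1\pi\Big[\int_{\Omega\setminus\sigma_0^{-1}(B_\rho(0))}e^{u_0+8\pi(n+1)G(z,\tau)}\,dz-\int_{\mathbb R^2\setminus B_\rho(0)}\frac{n+1}{|y|^4}\,dy\Big]$, which has the same value for all sufficiently small $\rho>0$. * $b_{n+1}=\frac1{(n+1)!}\frac{d^{n+1}q_0^{-1}}{dw^{n+1}}(0)$ and $f_{n+1}(z)=\frac1{(n+1)!}\frac{d^{n+1}}{dw^{n+1}}\Big[2\log\frac{w-q_0(z)}{q_0^{-1}(w)-z}+4\pi H^*(z-q_0^{-1}(w))\Big](0)$, with any local branch of the logarithm and the removable singularities filled in. * $\Gamma=\frac1{n!}\frac{d^{n+1}}{dz^{n+1}}\big[\mathcal H f_{n+1}\big](\tau)$ and $\Upsilon=-\frac{2\pi(n+1)}{|\Omega|\,n!}\,\overline{b_{n+1}}\,\frac{d^n\mathcal H}{dz^n}(\tau)$. -/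

import Mathlib

open MeasureTheory Filter Topology Set

noncomputable section

/-- The lattice `ω₁ ℤ + ω₂ ℤ`. -/
def periodLattice (ω₁ ω₂ : ℂ) : Set ℂ :=
  {z | ∃ k l : ℤ, z = k * ω₁ + l * ω₂}

/-- The open period parallelogram `{t ω₁ + s ω₂ : t, s ∈ (-1/2, 1/2)}`. Its dilation by the
factor `2` is `periodDomain (2 * ω₁) (2 * ω₂)`. -/
def periodDomain (ω₁ ω₂ : ℂ) : Set ℂ :=
  {z | ∃ t ∈ Ioo (-(1 / 2) : ℝ) (1 / 2), ∃ s ∈ Ioo (-(1 / 2) : ℝ) (1 / 2), z = t * ω₁ + s * ω₂}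

/-- The area `|Ω|`. -/
def torusArea (ω₁ ω₂ : ℂ) : ℝ := volume.real (periodDomain ω₁ ω₂)

/-- `G` is the Green function `G(·, 0)` of `-Δ` on the flat torus `ℂ / (ω₁ ℤ + ω₂ ℤ)`, i.e.
the doubly periodic solution of `-ΔG = δ₀ - 1/|Ω|` with `∫_Ω G = 0`. The Dirac mass at `0`
is expressed by the logarithmic singularity: `G + (1/2π) log|z|` stays bounded at `0`
(hence extends smoothly). One has `G(z, p) = G(z - p, 0)`. -/
structure IsTorusGreen (ω₁ ω₂ : ℂ) (G : ℂ → ℝ) : Prop where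
  periodic₁ : ∀ z, G (z + ω₁) = G z
  periodic₂ : ∀ z, G (z + ω₂) = G z
  contDiffAt : ∀ z, z ∉ periodLattice ω₁ ω₂ → ContDiffAt ℝ 2 G z
  laplacian_eq : ∀ z, z ∉ periodLattice ω₁ ω₂ →
    Laplacian.laplacian G z = 1 / torusArea ω₁ ω₂
  singularity : ∃ C : ℝ, ∀ᶠ z in 𝓝[≠] (0 : ℂ), |G z + 1 / (2 * Real.pi) * Real.log ‖z‖| ≤ C
  integrableOn : IntegrableOn G (periodDomain ω₁ ω₂)
  mean_zero : ∫ z in periodDomain ω₁ ω₂, G z = 0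

/-- `Hs` is a function `H*`: holomorphic in `2Ω`, with real part `H - |z|²/(4|Ω|)`, where
`H = G + (1/2π) log|z|` is the regular part of the Green function. -/
structure IsHStar (ω₁ ω₂ : ℂ) (G : ℂ → ℝ) (Hs : ℂ → ℂ) : Prop where
  holomorphic : DifferentiableOn ℂ Hs (periodDomain (2 * ω₁) (2 * ω₂))
  re_eq : ∀ z ∈ periodDomain (2 * ω₁) (2 * ω₂), z ≠ 0 →
    (Hs z).re = G z + 1 / (2 * Real.pi) * Real.log ‖z‖ - ‖z‖ ^ 2 / (4 * torusArea ω₁ ω₂)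

/-- A vortex configuration on the torus with periods `ω₁`, `ω₂`: a concentration point `p` of
multiplicity `n`, and remaining points `pt j` with multiplicities `mult j`.
A point of multiplicity zero is absent. -/
structure VortexConfig where
  ω₁ : ℂ
  ω₂ : ℂ
  p : ℂ
  n : ℕ
  k : ℕ
  pt : Fin k → ℂ
  mult : Fin k → ℕ

namespace VortexConfig

variable (V : VortexConfig)

/-- The period parallelogram `Ω`. -/
def Ω : Set ℂ := periodDomain V.ω₁ V.ω₂

/-- The area `|Ω|`. -/
def area : ℝ := torusArea V.ω₁ V.ω₂

/-- `u₀ = -4π ∑ G(z, p_j)`, the sum over all vortex points with multiplicity. -/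
def u₀ (G : ℂ → ℝ) (z : ℂ) : ℝ :=
  -4 * Real.pi * (V.n * G (z - V.p) + ∑ j, V.mult j * G (z - V.pt j))

/-- The function `𝓗^p`; the product is over the points different from `p`, the sums are over all
vortex points (including `p`, counted `n` times). -/
def curlyH (Hs : ℂ → ℂ) (z : ℂ) : ℂ :=
  (∏ j, (z - V.pt j) ^ V.mult j)
  * Complex.exp (4 * Real.pi * (V.n + 1) * Hs (z - V.p)
      + Real.pi * (V.n + 1) / V.area * (‖V.p‖ ^ 2 : ℝ)
      - 2 * Real.pi * (V.n + 1) / V.area * z * (starRingEnd ℂ) V.p)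
  * Complex.exp (-2 * Real.pi * (V.n * Hs (z - V.p) + ∑ j, V.mult j * Hs (z - V.pt j))
      - Real.pi / (2 * V.area) * ((V.n * ‖V.p‖ ^ 2 + ∑ j, V.mult j * ‖V.pt j‖ ^ 2 : ℝ) : ℂ)
      + Real.pi / V.area * z * (starRingEnd ℂ) (V.n * V.p + ∑ j, V.mult j * V.pt j))

/-- The meromorphic function `𝓗₀^p = 𝓗^p / (z - p)^(n+2)`, with
`|𝓗₀^p|² = exp (u₀ + 8π(n+1) G(z, p))`. -/
def curlyH₀ (Hs : ℂ → ℂ) (z : ℂ) : ℂ := V.curlyH Hs z / (z - V.p) ^ (V.n + 2)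

/-- The (local and global) functions entering the non-degeneracy condition:
* the Green function `G` and a function `H*`;
* an anti-derivative `F` of `𝓗₀^p` in `Ω \ {p}`, so that `σ₀ = -1 / F`;
* a holomorphic function `q₀` near `p` with `q₀^(n+1) = σ₀`, i.e.
  `q₀ = (z - p) [σ₀ / (z - p)^(n+1)]^(1/(n+1))` for some choice of the root;
* its local inverse `q₀⁻¹` near `0`, with `q₀⁻¹(0) = p`.
They are determined up to: an additive imaginary constant in `H*`, an additive constant in `F`,
the choice of the root, and values at irrelevant points. -/
structure Profile where
  G : ℂ → ℝ
  Hs : ℂ → ℂ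
  F : ℂ → ℂ
  q : ℂ → ℂ
  qinv : ℂ → ℂ
  isGreen : IsTorusGreen V.ω₁ V.ω₂ G
  isHStar : IsHStar V.ω₁ V.ω₂ G Hs
  hasDerivAt_F : ∀ z ∈ V.Ω, z ≠ V.p → HasDerivAt F (V.curlyH₀ Hs z) z
  analyticAt_q : AnalyticAt ℂ q V.p
  q_pow : ∀ᶠ z in 𝓝[≠] V.p, q z ^ (V.n + 1) = -1 / F z
  analyticAt_qinv : AnalyticAt ℂ qinv 0
  qinv_zero : qinv 0 = V.p
  q_qinv : ∀ᶠ w in 𝓝 (0 : ℂ), q (qinv w) = w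

namespace Profile

variable {V} (P : V.Profile)

/-- `σ₀⁻¹(B_ρ(0))`. As `σ₀ = -1/F` vanishes at `p`, this set contains `p`; elsewhere
`|σ₀| < ρ` means `|F| > 1/ρ` (zeros of `F` are poles of `σ₀`). -/
def sigmaBall (ρ : ℝ) : Set ℂ := {z | z = V.p ∨ 1 / ρ < ‖P.F z‖}

/-- `exp (u₀ + 8π(n+1) G(z, p))`. -/
def weight (z : ℂ) : ℝ :=
  Real.exp (V.u₀ P.G z + 8 * Real.pi * (V.n + 1) * P.G (z - V.p))

/-- `D` is the number `D₀`: for all small `ρ > 0` it equals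
`(1/π) [∫_{Ω \ σ₀⁻¹(B_ρ(0))} exp (u₀ + 8π(n+1) G(z,p)) - ∫_{ℝ² \ B_ρ(0)} (n+1)/|y|⁴]`,
both integrals being convergent. -/
def IsD₀ (D : ℝ) : Prop :=
  ∀ᶠ ρ in 𝓝[>] (0 : ℝ),
    IntegrableOn P.weight (V.Ω \ P.sigmaBall ρ) ∧
    IntegrableOn (fun y : ℂ => ((V.n : ℝ) + 1) / ‖y‖ ^ 4) {y | ρ ≤ ‖y‖} ∧
    D = 1 / Real.pi * ((∫ z in V.Ω \ P.sigmaBall ρ, P.weight z)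
      - ∫ y in {y : ℂ | ρ ≤ ‖y‖}, ((V.n : ℝ) + 1) / ‖y‖ ^ 4)

open Classical in
/-- The quotient `(w - q₀(z)) / (q₀⁻¹(w) - z)`, with its removable singularity at
`q₀⁻¹(w) = z` filled in. -/
def quot (z w : ℂ) : ℂ :=
  if P.qinv w = z then deriv P.q z else (w - P.q z) / (P.qinv w - z)

/-- `f_{n+1}(z) = 1/(n+1)! (d/dw)^{n+1} [2 log ((w - q₀(z))/(q₀⁻¹(w) - z)) + 4π H*(z - q₀⁻¹(w))](0)`.
The branch of the logarithm is the one near `w = 0`, normalised to vanish there; another branch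
differs by a constant, which is killed by the `w`-derivative of order `n + 1 ≥ 1`. -/
def f (z : ℂ) : ℂ :=
  1 / ((V.n + 1).factorial : ℂ) * iteratedDeriv (V.n + 1)
    (fun w => 2 * Complex.log (P.quot z w / P.quot z 0)
      + 4 * Real.pi * P.Hs (z - P.qinv w)) 0

/-- `b_{n+1} = 1/(n+1)! (d/dw)^{n+1} q₀⁻¹ (0)`. -/
def b : ℂ := 1 / ((V.n + 1).factorial : ℂ) * iteratedDeriv (V.n + 1) P.qinv 0

/-- `Γ = 1/n! (d/dz)^{n+1} [𝓗 f_{n+1}] (p)`. -/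
def Γ : ℂ :=
  1 / (V.n.factorial : ℂ) *
    iteratedDeriv (V.n + 1) (fun z => V.curlyH P.Hs z * P.f z) V.p

/-- `Υ = - 2π(n+1)/(|Ω| n!) * conj b_{n+1} * (d/dz)^n 𝓗 (p)`. -/
def Υ : ℂ :=
  -(2 * Real.pi * (V.n + 1) / (V.area * (V.n.factorial : ℂ))) * (starRingEnd ℂ) P.b *
    iteratedDeriv V.n (V.curlyH P.Hs) V.p

end Profile

/-- The non-degeneracy condition `|Γ| ≠ |Υ + n(2n+3)/(n+1) D₀|`. The functions that enter it
exist, the number `D₀` is well defined, and the condition holds for every admissible choice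
of these functions. -/
def NondegeneracyCondition : Prop :=
  Nonempty V.Profile ∧ ∀ P : V.Profile, ∃ D₀ : ℝ, P.IsD₀ D₀ ∧
    ‖P.Γ‖ ≠ ‖P.Υ + (((V.n : ℝ) * (2 * V.n + 3) / (V.n + 1) * D₀ : ℝ) : ℂ)‖

end VortexConfig

/-- The half-periods `a/2`, `ia/2`, `(a+ia)/2` of the square torus of side `a`. -/
def squareHalfPeriod (a : ℝ) : Fin 3 → ℂ :=
  ![(a : ℂ) / 2, Complex.I * a / 2, (a + Complex.I * a) / 2]

/-- The configuration on the square torus of side `a` with concentration point `τ` of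
multiplicity `2` and remaining points `pt j` of multiplicities `n₁, n₂, 2`. -/
def squareConfig (a : ℝ) (n₁ n₂ : ℕ) (τ : ℂ) (pt : Fin 3 → ℂ) : VortexConfig where
  ω₁ := a
  ω₂ := Complex.I * a
  p := τ
  n := 2
  k := 3
  pt := pt
  mult := ![n₁, n₂, 2]

end

/-! Everything becomes explicit in terms of the Weierstrass functions of the square lattice. Put `u
= z - τ` and `e = ℘(a/2)`. Multiplication by `i` preserves the lattice, so `℘(iu) = -℘(u)`. Hence
`℘` takes the values `e, -e, 0` at the three half-periods, `g₃ = 0` and `g₂ = 4e²`. Let `ε = ±e` be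
the value at the half-period of the first vortex.

For a half-period `ω`, `log |℘ - ℘(ω)|` and `4πG - 4πG(· - ω)` have the same singularities, so by
Liouville they differ by a constant (`exists_log_weierstrassP_eq`). Consequently `𝓗₀ = c (℘(u) - ε)
℘(u)` with `c ≠ 0` (`exists_vortexH_eq`). Since `℘'' = 6℘² - 2e²`, the anti-derivatives of `𝓗₀` are
`F = cW + K` with `W = ℘'/6 + ε²u/3 + εζ` (`sqPrimitive`).

The three ingredients of the condition follow. * The relation `F(q₀⁻¹(w)) = -1/w³` determines the
Taylor expansion of `q₀⁻¹` and gives `b₃ = -cε/3` (`exists_taylor`). With `𝓗 = c(1 - εu² + O(u⁴))`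
this yields `Υ = -2πε²|c|²/a²`. * Up to terms independent of `w`, the function inside `f₃` is `2
log(1 - w/q₀(z)) - 2 log σ(z - q₀⁻¹(w))`. In its third coefficient the terms in `℘'` and `ζ` cancel
and `f₃ = (2/3)(K + cε²u/3)` is affine (`eventually_coefficient_eq`). Hence `Γ = -(2/3)c²ε³`; the
unknown `K` drops out because `𝓗` has no cubic term. * The integral of `|F'|²` is computed from the
periods of `F` by Riemann's bilinear relations, and the pole contributes exactly the subtracted
integral (`eventually_integral_eq`). Legendre's relation `2ζ(a/2) = π/a` gives the periods `c(ε²a/3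
+ επ/a)` and `ic(ε²a/3 - επ/a)`, so `πD₀ = |c|²(ε⁴a²/9 - ε²π²/a²)`.

The condition is then decided by the single estimate `0 < ea² < 3π` (`halfValue_bound`), obtained by
integrating `℘(℘ + e) < 0` over half of the top edge of the period square. It gives `D₀ ≤ 0`; as
also `Υ < 0`, `|Υ + (14/3)D₀| ≥ |Υ| = 2πe²|c|²/a²`, and the same estimate says that this exceeds
`|Γ| = (2/3)|c|²e³`. -/

noncomputable section

/-! ### Third order Taylor expansions -/

/-- `f` has the Taylor expansion `a₀ + a₁ w + a₂ w² + a₃ w³ + O(w⁴)` at `0`, with analytic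
remainder. -/
def HasTaylorThree (f : ℂ → ℂ) (a₀ a₁ a₂ a₃ : ℂ) : Prop :=
  ∃ r : ℂ → ℂ, AnalyticAt ℂ r 0 ∧
    ∀ᶠ w in 𝓝 (0 : ℂ), f w = a₀ + a₁ * w + a₂ * w ^ 2 + a₃ * w ^ 3 + w ^ 4 * r w

theorem AnalyticAt.exists_eq_add_mul {f : ℂ → ℂ} (hf : AnalyticAt ℂ f 0) :
    ∃ g : ℂ → ℂ, AnalyticAt ℂ g 0 ∧ ∀ w, f w = f 0 + w * g w := by
  obtain ⟨p, hp⟩ := hf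
  refine ⟨dslope f 0, hp.has_fpower_series_dslope_fslope.analyticAt, fun w => ?_⟩
  have := sub_smul_dslope f 0 w
  simp only [sub_zero, smul_eq_mul] at this
  rw [this]; ring

namespace HasTaylorThree

variable {f g : ℂ → ℂ} {a₀ a₁ a₂ a₃ b₀ b₁ b₂ b₃ : ℂ}

theorem of_analyticAt (hf : AnalyticAt ℂ f 0) : ∃ a₁ a₂ a₃, HasTaylorThree f (f 0) a₁ a₂ a₃ := by
  obtain ⟨g, hg, h₁⟩ := hf.exists_eq_add_mul
  obtain ⟨h, hh, h₂⟩ := hg.exists_eq_add_mul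
  obtain ⟨k, hk, h₃⟩ := hh.exists_eq_add_mul
  obtain ⟨r, hr, h₄⟩ := hk.exists_eq_add_mul
  refine ⟨g 0, h 0, k 0, r, hr, Eventually.of_forall fun w => ?_⟩
  rw [h₁, h₂, h₃, h₄]; ring

theorem analyticAt (h : HasTaylorThree f a₀ a₁ a₂ a₃) : AnalyticAt ℂ f 0 := by
  obtain ⟨r, hr, hf⟩ := h
  refine AnalyticAt.congr ?_ (EventuallyEq.symm hf)
  fun_prop

theorem congr (h : HasTaylorThree f a₀ a₁ a₂ a₃) (hg : g =ᶠ[𝓝 0] f) :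
    HasTaylorThree g a₀ a₁ a₂ a₃ := by
  obtain ⟨r, hr, hf⟩ := h
  exact ⟨r, hr, by filter_upwards [hf, hg] with w h₁ h₂; rw [h₂, h₁]⟩

theorem congr_all (h : HasTaylorThree f a₀ a₁ a₂ a₃) (h₀ : a₀ = b₀) (h₁ : a₁ = b₁) (h₂ : a₂ = b₂)
    (h₃ : a₃ = b₃) : HasTaylorThree f b₀ b₁ b₂ b₃ := h₀ ▸ h₁ ▸ h₂ ▸ h₃ ▸ h

theorem apply_zero (h : HasTaylorThree f a₀ a₁ a₂ a₃) : f 0 = a₀ := by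
  obtain ⟨r, hr, hf⟩ := h
  simpa using hf.self_of_nhds

theorem iteratedDeriv_eq (h : HasTaylorThree f a₀ a₁ a₂ a₃) :
    iteratedDeriv 1 f 0 = a₁ ∧ iteratedDeriv 2 f 0 = 2 * a₂ ∧ iteratedDeriv 3 f 0 = 6 * a₃ := by
  obtain ⟨r, hr, hf⟩ := h
  have hr' : ∀ n : ℕ, ContDiffAt ℂ n r 0 := fun n => hr.contDiffAt
  replace hf : f =ᶠ[𝓝 0] fun w => a₀ + a₁ * w ^ 1 + a₂ * w ^ 2 + a₃ * w ^ 3 + w ^ 4 * r w := by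
    filter_upwards [hf] with w hw
    rw [hw, pow_one]
  have e (n : ℕ) := EventuallyEq.iteratedDeriv_eq n hf
  refine ⟨?_, ?_, ?_⟩ <;> rw [e]
  all_goals
    simp (discharger := fun_prop) only [iteratedDeriv_fun_add, iteratedDeriv_fun_mul,
      iteratedDeriv_const, iteratedDeriv_fun_pow_zero]
    simp [Finset.sum_range_succ, Nat.factorial, Nat.choose]
  all_goals ring

theorem unique (hf : HasTaylorThree f a₀ a₁ a₂ a₃) (hg : HasTaylorThree f b₀ b₁ b₂ b₃) :
    a₀ = b₀ ∧ a₁ = b₁ ∧ a₂ = b₂ ∧ a₃ = b₃ := by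
  obtain ⟨h₁, h₂, h₃⟩ := hf.iteratedDeriv_eq
  obtain ⟨k₁, k₂, k₃⟩ := hg.iteratedDeriv_eq
  refine ⟨hf.apply_zero.symm.trans hg.apply_zero, h₁.symm.trans k₁, ?_, ?_⟩
  · simpa using h₂.symm.trans k₂
  · simpa using h₃.symm.trans k₃

theorem const (c : ℂ) : HasTaylorThree (fun _ => c) c 0 0 0 :=
  ⟨fun _ => 0, analyticAt_const, by simp⟩

theorem id : HasTaylorThree (fun w => w) 0 1 0 0 :=
  ⟨fun _ => 0, analyticAt_const, by simp⟩

theorem add (hf : HasTaylorThree f a₀ a₁ a₂ a₃) (hg : HasTaylorThree g b₀ b₁ b₂ b₃) :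
    HasTaylorThree (fun w => f w + g w) (a₀ + b₀) (a₁ + b₁) (a₂ + b₂) (a₃ + b₃) := by
  obtain ⟨r, hr, hf⟩ := hf
  obtain ⟨s, hs, hg⟩ := hg
  refine ⟨fun w => r w + s w, by fun_prop, ?_⟩
  filter_upwards [hf, hg] with w h₁ h₂
  rw [h₁, h₂]; ring

theorem mul (hf : HasTaylorThree f a₀ a₁ a₂ a₃) (hg : HasTaylorThree g b₀ b₁ b₂ b₃) :
    HasTaylorThree (fun w => f w * g w) (a₀ * b₀) (a₀ * b₁ + a₁ * b₀)
      (a₀ * b₂ + a₁ * b₁ + a₂ * b₀) (a₀ * b₃ + a₁ * b₂ + a₂ * b₁ + a₃ * b₀) := by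
  obtain ⟨r, hr, hf⟩ := hf
  obtain ⟨s, hs, hg⟩ := hg
  refine ⟨fun w => (a₁ * b₃ + a₂ * b₂ + a₃ * b₁) + (a₂ * b₃ + a₃ * b₂) * w + a₃ * b₃ * w ^ 2
    + r w * (b₀ + b₁ * w + b₂ * w ^ 2 + b₃ * w ^ 3)
    + s w * (a₀ + a₁ * w + a₂ * w ^ 2 + a₃ * w ^ 3) + w ^ 4 * r w * s w, by fun_prop, ?_⟩
  filter_upwards [hf, hg] with w h₁ h₂
  rw [h₁, h₂]; ring

theorem const_mul (c : ℂ) (hf : HasTaylorThree f a₀ a₁ a₂ a₃) :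
    HasTaylorThree (fun w => c * f w) (c * a₀) (c * a₁) (c * a₂) (c * a₃) := by
  simpa using (const c).mul hf

theorem sub (hf : HasTaylorThree f a₀ a₁ a₂ a₃) (hg : HasTaylorThree g b₀ b₁ b₂ b₃) :
    HasTaylorThree (fun w => f w - g w) (a₀ - b₀) (a₁ - b₁) (a₂ - b₂) (a₃ - b₃) := by
  simpa [sub_eq_add_neg] using hf.add (hg.const_mul (-1))

/-- Composition of Taylor expansions, the inner function vanishing at `0`. -/
theorem comp (hg : HasTaylorThree g b₀ b₁ b₂ b₃) (hf : HasTaylorThree f 0 a₁ a₂ a₃) :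
    HasTaylorThree (fun w => g (f w)) b₀ (b₁ * a₁) (b₁ * a₂ + b₂ * a₁ ^ 2)
      (b₁ * a₃ + 2 * b₂ * a₁ * a₂ + b₃ * a₁ ^ 3) := by
  have h2 := hf.mul hf
  have h3 := h2.mul hf
  have hf0 := hf.apply_zero
  have hfa := hf.analyticAt
  have hpoly := (((const b₀).add (hf.const_mul b₁)).add (h2.const_mul b₂)).add (h3.const_mul b₃)
  obtain ⟨s, hs, hg⟩ := hg
  obtain ⟨y, hy, hfy⟩ := hfa.exists_eq_add_mul
  have hsf : AnalyticAt ℂ (fun w => s (f w)) 0 := by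
    have : AnalyticAt ℂ s (f 0) := by rwa [hf0]
    exact this.comp hfa
  have hrem : HasTaylorThree (fun w => f w ^ 4 * s (f w)) 0 0 0 0 := by
    refine ⟨fun w => y w ^ 4 * s (f w), (hy.pow 4).mul hsf, Eventually.of_forall fun w => ?_⟩
    have := hfy w
    rw [hf0, zero_add] at this
    beta_reduce
    nth_rw 1 [this]; ring
  have htend : Tendsto f (𝓝 0) (𝓝 0) := by
    have := hfa.continuousAt.tendsto; rwa [hf0] at this
  convert (hpoly.add hrem).congr (g := fun w => g (f w)) ?_ using 1
  · ring
  · ring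
  · ring
  · ring
  · filter_upwards [htend.eventually hg] with w hw
    rw [hw]; ring

end HasTaylorThree

theorem AnalyticAt.hasTaylorThree {f : ℂ → ℂ} (hf : AnalyticAt ℂ f 0) :
    HasTaylorThree f (f 0) (iteratedDeriv 1 f 0) (iteratedDeriv 2 f 0 / 2)
      (iteratedDeriv 3 f 0 / 6) := by
  obtain ⟨a₁, a₂, a₃, h⟩ := HasTaylorThree.of_analyticAt hf
  obtain ⟨h₁, h₂, h₃⟩ := h.iteratedDeriv_eq
  convert h using 1
  · rw [h₂]; ring
  · rw [h₃]; ring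

/-- The coefficients are read off from the derivative `1/(1 + x)`, whose expansion is geometric. -/
theorem hasTaylorThree_log_one_add :
    HasTaylorThree (fun x => Complex.log (1 + x)) 0 1 (-1 / 2) (1 / 3) := by
  have ha : AnalyticAt ℂ (fun x : ℂ => Complex.log (1 + x)) 0 := by
    apply AnalyticAt.clog (by fun_prop); simp
  obtain ⟨a₁, a₂, a₃, h⟩ := HasTaylorThree.of_analyticAt ha
  have hd : ∀ᶠ x in 𝓝 (0 : ℂ), HasDerivAt (fun x => Complex.log (1 + x)) (1 / (1 + x)) x := by
    have : ∀ᶠ x in 𝓝 (0 : ℂ), (1 + x) ∈ Complex.slitPlane := by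
      have : ContinuousAt (fun x : ℂ => 1 + x) 0 := by fun_prop
      exact this.eventually_mem (Complex.isOpen_slitPlane.mem_nhds (by simp))
    filter_upwards [this] with x hx
    exact ((hasDerivAt_id x).const_add 1).clog hx
  have hd' : deriv (fun x : ℂ => Complex.log (1 + x)) =ᶠ[𝓝 0] fun x => 1 / (1 + x) := by
    filter_upwards [hd] with x hx using hx.deriv
  have hq : HasTaylorThree (fun x : ℂ => 1 / (1 + x)) 1 (-1) 1 (-1) := by
    refine ⟨fun x => 1 / (1 + x), by
      refine AnalyticAt.div (by fun_prop) (by fun_prop) (by simp), ?_⟩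
    have : ∀ᶠ x in 𝓝 (0 : ℂ), 1 + x ≠ 0 := by
      have : ContinuousAt (fun x : ℂ => 1 + x) 0 := by fun_prop
      exact this.eventually_ne (by simp)
    filter_upwards [this] with x hx
    field_simp; ring
  obtain ⟨h₁, h₂, h₃⟩ := h.iteratedDeriv_eq
  obtain ⟨k₁, k₂, k₃⟩ := (hq.congr hd').iteratedDeriv_eq
  have k₀ := (hq.congr hd').apply_zero
  rw [← iteratedDeriv_succ'] at k₁ k₂
  rw [iteratedDeriv_one] at h₁
  convert h using 1
  · simp
  · rw [← h₁, k₀]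
  · rw [k₁] at h₂; linear_combination h₂ / 2
  · rw [k₂] at h₃; linear_combination h₃ / 6

/-! ### Removable singularities and Liouville type theorems for periodic functions -/

/-- The function obtained by filling in removable singularities. -/
def regularization {E : Type*} [TopologicalSpace E] [Nonempty E] (Φ : ℂ → E) (z : ℂ) : E :=
  limUnder (𝓝[≠] z) Φ

/-- Agreement on a punctured neighbourhood of `z` implies agreement on a punctured neighbourhood of
every nearby point, so all punctured limits near `z` are the values of the continuous `k`. -/
theorem regularization_eventuallyEq {E : Type*} [TopologicalSpace E] [T2Space E] [Nonempty E]
    {Φ k : ℂ → E} {z : ℂ} (hk : ∀ᶠ w in 𝓝 z, ContinuousAt k w) (h : Φ =ᶠ[𝓝[≠] z] k) :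
    regularization Φ =ᶠ[𝓝 z] k := by
  have h' : ∀ᶠ w in 𝓝 z, ∀ᶠ v in 𝓝[≠] w, Φ v = k v := by
    rw [EventuallyEq, eventually_nhdsWithin_iff] at h
    obtain ⟨U, hU, hUo, hz⟩ := eventually_nhds_iff.1 h
    filter_upwards [hUo.mem_nhds hz] with w hw
    by_cases hwz : w = z
    · subst hwz
      filter_upwards [self_mem_nhdsWithin, mem_nhdsWithin_of_mem_nhds (hUo.mem_nhds hw)] with v h₁ h₂
      exact hU v h₂ h₁
    · filter_upwards [mem_nhdsWithin_of_mem_nhds (hUo.mem_nhds hw),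
        mem_nhdsWithin_of_mem_nhds (isOpen_ne.mem_nhds hwz)] with v h₁ h₂
      exact hU v h₁ h₂
  filter_upwards [hk, h'] with w h₁ h₂
  apply Tendsto.limUnder_eq
  exact (h₁.tendsto.mono_left nhdsWithin_le_nhds).congr' (EventuallyEq.symm h₂)

theorem regularization_add {E : Type*} [TopologicalSpace E] [Nonempty E] {Φ : ℂ → E} {l : ℂ}
    (h : ∀ z, Φ (z + l) = Φ z) (z : ℂ) : regularization Φ (z + l) = regularization Φ z := by
  have e : 𝓝[≠] (z + l) = map (fun w => w + l) (𝓝[≠] z) := by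
    have := (Homeomorph.addRight l).isEmbedding.map_nhdsWithin_eq {z}ᶜ z
    simp only [Homeomorph.coe_addRight] at this
    rw [this]
    congr 1
    ext w; simp
  rw [regularization, limUnder, e, Filter.map_map, regularization, limUnder]
  congr 2
  funext w; exact h w

theorem isBounded_range_regularization {E : Type*} [NormedAddCommGroup E] (L : PeriodPair)
    {Φ : ℂ → E} (hper : ∀ z, ∀ l ∈ L.lattice, Φ (z + l) = Φ z)
    (hc : Continuous (regularization Φ)) : Bornology.IsBounded (range (regularization Φ)) :=
  (IsZLattice.isCompact_range_of_periodic L.lattice _ hc fun z w hw =>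
    regularization_add (fun z => hper z w hw) z).isBounded

/-- **Liouville's theorem** for doubly periodic functions with removable singularities. -/
theorem PeriodPair.exists_eq_const_of_analytic (L : PeriodPair) {Φ : ℂ → ℂ}
    (hper : ∀ z, ∀ l ∈ L.lattice, Φ (z + l) = Φ z)
    (hloc : ∀ z, ∃ k : ℂ → ℂ, AnalyticAt ℂ k z ∧ Φ =ᶠ[𝓝[≠] z] k) :
    ∃ C, ∀ z, Φ =ᶠ[𝓝[≠] z] fun _ => C := by
  have key : ∀ z k, AnalyticAt ℂ k z → Φ =ᶠ[𝓝[≠] z] k → regularization Φ =ᶠ[𝓝 z] k :=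
    fun z k hk h => regularization_eventuallyEq
      (hk.eventually_analyticAt.mono fun w hw => hw.continuousAt) h
  have hd : Differentiable ℂ (regularization Φ) := fun z => by
    obtain ⟨k, hk, h⟩ := hloc z
    exact (hk.congr (key z k hk h).symm).differentiableAt
  refine ⟨regularization Φ 0, fun z => ?_⟩
  obtain ⟨k, hk, h⟩ := hloc z
  filter_upwards [h, mem_nhdsWithin_of_mem_nhds (key z k hk h)] with w h₁ h₂
  rw [h₁, ← h₂]
  exact hd.apply_eq_apply_of_bounded
    (isBounded_range_regularization L hper hd.continuous) w 0

/-- A doubly periodic function which is locally the logarithm of the modulus of a nonvanishing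
analytic function, up to removable singularities, is constant. -/
theorem PeriodPair.exists_eq_const_of_log_norm (L : PeriodPair) {Φ : ℂ → ℝ}
    (hper : ∀ z, ∀ l ∈ L.lattice, Φ (z + l) = Φ z)
    (hloc : ∀ z, ∃ k : ℂ → ℂ, AnalyticAt ℂ k z ∧ k z ≠ 0 ∧
      ∀ᶠ w in 𝓝[≠] z, Φ w = Real.log ‖k w‖) :
    ∃ C, ∀ z, Φ =ᶠ[𝓝[≠] z] fun _ => C := by
  have key : ∀ (z : ℂ) (k : ℂ → ℂ), AnalyticAt ℂ k z → k z ≠ 0 → (∀ᶠ w in 𝓝[≠] z, Φ w = Real.log ‖k w‖) →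
      regularization Φ =ᶠ[𝓝 z] fun w => Real.log ‖k w‖ := fun z k hk hz h => by
    refine regularization_eventuallyEq ?_ h
    filter_upwards [hk.eventually_analyticAt, hk.continuousAt.eventually_ne hz] with w h₁ h₂
    exact (h₁.continuousAt.norm).log (norm_ne_zero_iff.2 h₂)
  have hh : InnerProductSpace.HarmonicOnNhd (regularization Φ) univ := fun z _ => by
    obtain ⟨k, hk, hz, h⟩ := hloc z
    exact (InnerProductSpace.harmonicAt_congr_nhds (key z k hk hz h)).2
      (hk.harmonicAt_log_norm hz)
  have hc : Continuous (regularization Φ) := continuousOn_univ.1 hh.continuousOn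
  refine ⟨regularization Φ 0, fun z => ?_⟩
  obtain ⟨k, hk, hz, h⟩ := hloc z
  filter_upwards [h, mem_nhdsWithin_of_mem_nhds (key z k hk hz h)] with w h₁ h₂
  rw [h₁, ← h₂]
  exact InnerProductSpace.bounded_harmonic_on_complex_plane_is_constant _ hh
    (isBounded_range_regularization L hper hc) w 0

end

/-! ### The differential equation of `℘` and its behaviour at half-periods -/

noncomputable section


theorem AnalyticAt.exists_eventuallyEq_sq_mul {f : ℂ → ℂ} {z : ℂ} (hf : AnalyticAt ℂ f z)
    (h₀ : f z = 0) (h₁ : deriv f z = 0) :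
    ∃ g : ℂ → ℂ, AnalyticAt ℂ g z ∧ ∀ᶠ w in 𝓝 z, f w = (w - z) ^ 2 * g w := by
  have : ((2 : ℕ) : ℕ∞) ≤ analyticOrderAt f z := by
    rw [natCast_le_analyticOrderAt_iff_iteratedDeriv_eq_zero hf]
    intro i hi
    interval_cases i
    · simpa using h₀
    · simpa using h₁
  obtain ⟨g, hg, h⟩ := (natCast_le_analyticOrderAt hf).1 this
  exact ⟨g, hg, by simpa using h⟩

namespace PeriodPair

variable (L : PeriodPair)

theorem isPreconnected_compl_lattice : IsPreconnected ((L.lattice : Set ℂ)ᶜ) := by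
  have hc : (L.lattice : Set ℂ).Countable := by
    have : Countable L.lattice := TopologicalSpace.separableSpace_iff_countable.1 inferInstance
    exact this
  exact (hc.isConnected_compl_of_one_lt_rank (by simp)).isPreconnected

theorem weierstrassP_eq_add {l z : ℂ} (hl : l ∈ L.lattice) :
    ℘[L] z = ℘[L - l] z + (1 / (z - l) ^ 2 - 1 / l ^ 2) :=
  (L.weierstrassPExcept_add ⟨l, hl⟩ z).symm

theorem weierstrassP_eq_zero_add (z : ℂ) : ℘[L] z = L.weierstrassPExcept 0 z + 1 / z ^ 2 := by
  simpa using L.weierstrassP_eq_add (z := z) (zero_mem L.lattice)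

theorem derivWeierstrassP_eq_zero_sub (z : ℂ) : ℘'[L] z = L.derivWeierstrassPExcept 0 z - 2 / z ^ 3 := by
  simpa using (L.derivWeierstrassPExcept_sub 0 z).symm

theorem eventually_notMem_lattice (z : ℂ) : ∀ᶠ w in 𝓝[≠] z, w ∉ L.lattice := by
  filter_upwards [mem_nhdsWithin_of_mem_nhds (L.compl_lattice_sdiff_singleton_mem_nhds z),
    self_mem_nhdsWithin] with w h₁ h₂ h₃
  exact h₁ ⟨h₃, h₂⟩

/-- At the double pole `w²(℘(w) - c)` tends to `1`. -/
theorem eventually_weierstrassP_ne_zero (c : ℂ) : ∀ᶠ w in 𝓝[≠] (0 : ℂ), ℘[L] w ≠ c := by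
  have hp : ContinuousAt (L.weierstrassPExcept 0) 0 := (L.analyticAt_weierstrassPExcept 0).continuousAt
  have h : ContinuousAt (fun w : ℂ => w ^ 2 * (L.weierstrassPExcept 0 w - c) + 1) 0 := by fun_prop
  filter_upwards [mem_nhdsWithin_of_mem_nhds (h.eventually_ne (y := 0) (by simp)),
    self_mem_nhdsWithin] with w h₁ h₂ h₃
  have hw : w ≠ 0 := h₂
  apply h₁
  rw [← h₃, L.weierstrassP_eq_zero_add]
  field_simp; ring

theorem eventually_derivWeierstrassP_ne_zero : ∀ᶠ w in 𝓝[≠] (0 : ℂ), ℘'[L] w ≠ 0 := by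
  have hp : ContinuousAt (L.derivWeierstrassPExcept 0) 0 := (L.analyticAt_derivWeierstrassPExcept 0).continuousAt
  have h : ContinuousAt (fun w : ℂ => w ^ 3 * L.derivWeierstrassPExcept 0 w - 2) 0 := by fun_prop
  filter_upwards [mem_nhdsWithin_of_mem_nhds (h.eventually_ne (y := 0) (by simp)),
    self_mem_nhdsWithin] with w h₁ h₂ h₃
  have hw : w ≠ 0 := h₂
  apply h₁
  rw [L.derivWeierstrassP_eq_zero_sub] at h₃
  field_simp at h₃
  linear_combination h₃

/-- The complement of the countable lattice is connected, so by the identity theorem `℘` would be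
constant there, contradicting the pole at `0`. -/
theorem not_eventually_weierstrassP_eq {z c : ℂ} (hz : z ∉ L.lattice) :
    ¬ ∀ᶠ w in 𝓝[≠] z, ℘[L] w = c := fun h => by
  have h' := L.analyticOnNhd_weierstrassP.eqOn_of_preconnected_of_frequently_eq
    (analyticOnNhd_const (v := c)) L.isPreconnected_compl_lattice (z₀ := z) hz h.frequently
  obtain ⟨w, h₁, h₂⟩ := ((L.eventually_weierstrassP_ne_zero c).and
    (L.eventually_notMem_lattice 0)).exists
  exact h₁ (h' h₂)

theorem eventually_derivWeierstrassP_ne {z : ℂ} (hz : z ∉ L.lattice) :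
    ∀ᶠ w in 𝓝[≠] z, ℘'[L] w ≠ 0 := by
  by_contra h
  have h' := L.analyticOnNhd_derivWeierstrassP.eqOn_of_preconnected_of_frequently_eq
    (analyticOnNhd_const (v := 0)) L.isPreconnected_compl_lattice (z₀ := z) hz h
  obtain ⟨w, h₁, h₂⟩ := (L.eventually_derivWeierstrassP_ne_zero.and
    (L.eventually_notMem_lattice 0)).exists
  exact h₁ (h' h₂)

theorem hasDerivAt_weierstrassP {z : ℂ} (hz : z ∉ L.lattice) :
    HasDerivAt ℘[L] (℘'[L] z) z := by
  have := (L.analyticOnNhd_weierstrassP z hz).differentiableAt.hasDerivAt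
  rwa [L.deriv_weierstrassP] at this

/-- Differentiate `℘'² = 4℘³ - g₂℘ - g₃` and cancel `2℘'`; the isolated zeros of `℘'` are reached by
continuity. -/
theorem hasDerivAt_derivWeierstrassP {z : ℂ} (hz : z ∉ L.lattice) :
    HasDerivAt ℘'[L] (6 * ℘[L] z ^ 2 - L.g₂ / 2) z := by
  have ha := L.analyticOnNhd_derivWeierstrassP
  have hP := L.analyticOnNhd_weierstrassP
  have hopen : IsOpen (L.lattice : Set ℂ)ᶜ := L.isClosed_lattice.isOpen_compl
  have key : ∀ w ∉ L.lattice, ℘'[L] w ≠ 0 → deriv ℘'[L] w = 6 * ℘[L] w ^ 2 - L.g₂ / 2 := by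
    intro w hw h0
    have d₁ := (ha w hw).differentiableAt.hasDerivAt.pow 2
    have d₂ := ((((L.hasDerivAt_weierstrassP hw).pow 3).const_mul 4).sub
      ((L.hasDerivAt_weierstrassP hw).const_mul L.g₂)).sub_const L.g₃
    have e : (℘'[L] ^ 2) =ᶠ[𝓝 w] fun z => 4 * ℘[L] z ^ 3 - L.g₂ * ℘[L] z - L.g₃ := by
      filter_upwards [hopen.mem_nhds hw] with v hv using L.derivWeierstrassP_sq v hv
    have := d₁.unique (d₂.congr_of_eventuallyEq e)
    apply mul_left_cancel₀ (mul_ne_zero two_ne_zero h0)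
    simp at this
    linear_combination this
  have e : deriv ℘'[L] z = 6 * ℘[L] z ^ 2 - L.g₂ / 2 := by
    have c₁ : ContinuousAt (deriv ℘'[L]) z := (ha z hz).deriv.continuousAt
    have c₂ : ContinuousAt (fun w => 6 * ℘[L] w ^ 2 - L.g₂ / 2) z := by
      have := (hP z hz).continuousAt; fun_prop
    refine tendsto_nhds_unique_of_eventuallyEq (c₁.tendsto.mono_left nhdsWithin_le_nhds)
      (c₂.tendsto.mono_left nhdsWithin_le_nhds) (l := 𝓝[≠] z) ?_
    filter_upwards [L.eventually_derivWeierstrassP_ne hz, L.eventually_notMem_lattice z]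
      with w h₁ h₂ using key w h₂ h₁
  rw [← e]
  exact (ha z hz).differentiableAt.hasDerivAt

variable {L}

/-- `℘'` is odd, and `ω` is congruent to `-ω`. -/
theorem derivWeierstrassP_half {ω : ℂ} (h2 : 2 * ω ∈ L.lattice) : ℘'[L] ω = 0 := by
  rw [← CharZero.eq_neg_self_iff, ← L.derivWeierstrassP_neg,
    ← L.derivWeierstrassP_add_coe (-ω) ⟨_, h2⟩]
  congr 1; simp; ring

theorem weierstrassP_add_of_mem {l : ℂ} (hl : l ∈ L.lattice) (z : ℂ) :
    ℘[L] (z + l) = ℘[L] z := L.weierstrassP_add_coe z ⟨l, hl⟩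

theorem derivWeierstrassP_add_of_mem {l : ℂ} (hl : l ∈ L.lattice) (z : ℂ) :
    ℘'[L] (z + l) = ℘'[L] z := L.derivWeierstrassP_add_coe z ⟨l, hl⟩

theorem exists_weierstrassP_sub_half {ω z : ℂ} (h2 : 2 * ω ∈ L.lattice) (hω : ω ∉ L.lattice)
    (hz : z - ω ∈ L.lattice) : ∃ h : ℂ → ℂ, AnalyticAt ℂ h z ∧
      ∀ᶠ w in 𝓝 z, ℘[L] w - ℘[L] ω = (w - z) ^ 2 * h w := by
  have hz' : z ∉ L.lattice := fun h => hω (by simpa using sub_mem h hz)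
  have ha := L.analyticOnNhd_weierstrassP z hz'
  have ez : z = ω + (z - ω) := by ring
  refine (ha.sub analyticAt_const).exists_eventuallyEq_sq_mul ?_ ?_
  · change ℘[L] z - ℘[L] ω = 0
    rw [ez, weierstrassP_add_of_mem hz, sub_self]
  · have := ((L.hasDerivAt_weierstrassP hz').sub_const (℘[L] ω)).deriv
    refine this.trans ?_
    rw [ez,
      derivWeierstrassP_add_of_mem hz, derivWeierstrassP_half h2]

/-- `(℘(z) - ℘(ω)) (℘(z + ω) - ℘(ω))` is a nonzero constant for a half-period `ω`. -/
theorem exists_weierstrassP_mul_eq_const {ω : ℂ} (h2 : 2 * ω ∈ L.lattice) (hω : ω ∉ L.lattice) :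
    ∃ C ≠ 0, ∀ z, ∀ᶠ w in 𝓝[≠] z, (℘[L] w - ℘[L] ω) * (℘[L] (w + ω) - ℘[L] ω) = C := by
  set Φ : ℂ → ℂ := fun w => (℘[L] w - ℘[L] ω) * (℘[L] (w + ω) - ℘[L] ω) with hΦ
  have hper : ∀ z, ∀ l ∈ L.lattice, Φ (z + l) = Φ z := fun z l hl => by
    simp only [hΦ]
    rw [weierstrassP_add_of_mem hl, add_right_comm, weierstrassP_add_of_mem hl]
  -- Translation by `ω` swaps the two factors; this reduces the points congruent to `ω` to lattice
  -- points.
  have hhalf : ∀ z, Φ (z + ω) = Φ z := fun z => by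
    simp only [hΦ]
    rw [add_assoc, ← two_mul, weierstrassP_add_of_mem h2, mul_comm]
  -- At a lattice point the double pole of the first factor is cancelled by the double zero of the
  -- second.
  have hlat : ∀ z ∈ L.lattice, ∃ k : ℂ → ℂ, AnalyticAt ℂ k z ∧ Φ =ᶠ[𝓝[≠] z] k := by
    intro z hz
    obtain ⟨h, hh, he⟩ := exists_weierstrassP_sub_half (z := z + ω) h2 hω (by simpa using hz)
    have hsh : ContinuousAt (fun w : ℂ => w + ω) z := by fun_prop
    have hk : AnalyticAt ℂ (fun w => h (w + ω)) z :=
      hh.comp_of_eq (f := fun w => w + ω) (by fun_prop) rfl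
    have hp : AnalyticAt ℂ ℘[L - z] z := L.analyticAt_weierstrassPExcept z
    refine ⟨fun w => (℘[L - z] w - 1 / z ^ 2 - ℘[L] ω) * ((w - z) ^ 2 * h (w + ω)) + h (w + ω),
      by fun_prop, ?_⟩
    filter_upwards [self_mem_nhdsWithin, mem_nhdsWithin_of_mem_nhds (hsh.eventually he)]
      with w hw hw'
    have : w - z ≠ 0 := sub_ne_zero.2 hw
    simp only [hΦ]
    rw [hw', L.weierstrassP_eq_add hz]
    field_simp; ring
  obtain ⟨C, hC⟩ := L.exists_eq_const_of_analytic hper fun z => by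
    by_cases hz : z ∈ L.lattice
    · exact hlat z hz
    by_cases hz' : z + ω ∈ L.lattice
    · obtain ⟨k, hk, he⟩ := hlat _ hz'
      refine ⟨fun w => k (w + ω), hk.comp_of_eq (f := fun w => w + ω) (by fun_prop) rfl, ?_⟩
      rw [EventuallyEq, eventually_nhdsWithin_iff] at he ⊢
      have hsh : ContinuousAt (fun w : ℂ => w + ω) z := by fun_prop
      filter_upwards [hsh.eventually he] with w hw hwz
      rw [← hhalf, hw (by simpa using hwz)]
    · have h₁ := L.analyticOnNhd_weierstrassP z hz
      have h₂ : AnalyticAt ℂ (fun w => ℘[L] (w + ω)) z :=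
        (L.analyticOnNhd_weierstrassP _ hz').comp_of_eq (f := fun w => w + ω) (by fun_prop) rfl
      exact ⟨Φ, by fun_prop, EventuallyEq.rfl⟩
  refine ⟨C, ?_, hC⟩
  -- If the constant were `0`, then near `ω` the factor `℘(w - ω) - ℘(ω)` is nonzero because of the
  -- pole, so `℘` would be constant near `ω`.
  rintro rfl
  apply L.not_eventually_weierstrassP_eq (c := ℘[L] ω) hω
  have h := (hC 0).and (L.eventually_weierstrassP_ne_zero (℘[L] ω))
  rw [eventually_nhdsWithin_iff] at h ⊢
  have hsh : ContinuousAt (fun w : ℂ => w - ω) ω := by fun_prop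
  have h' : ∀ᶠ y in 𝓝 (ω - ω), y ∈ ({0} : Set ℂ)ᶜ → Φ y = 0 ∧ ℘[L] y ≠ ℘[L] ω := by
    rwa [sub_self]
  filter_upwards [hsh.eventually h'] with w hw hwz
  obtain ⟨h₁, h₂⟩ := hw (by simpa [sub_eq_zero] using hwz)
  simp only [hΦ, sub_add_cancel] at h₁
  exact sub_eq_zero.1 ((mul_eq_zero.1 h₁).resolve_left (sub_ne_zero.2 h₂))

/-- At such a `z` both factors of the constant product are finite and their product is not zero.
This replaces counting the zeros of an elliptic function. -/
theorem weierstrassP_ne_half {ω z : ℂ} (h2 : 2 * ω ∈ L.lattice) (hω : ω ∉ L.lattice)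
    (hz : z ∉ L.lattice) (hz' : z - ω ∉ L.lattice) : ℘[L] z ≠ ℘[L] ω := by
  obtain ⟨C, hC, h⟩ := exists_weierstrassP_mul_eq_const h2 hω
  have hz'' : z + ω ∉ L.lattice := fun h => hz' (by
    convert sub_mem h h2 using 1; ring)
  have h₁ := (L.analyticOnNhd_weierstrassP z hz).continuousAt
  have h₂ : AnalyticAt ℂ (fun w => ℘[L] (w + ω)) z :=
    (L.analyticOnNhd_weierstrassP _ hz'').comp_of_eq (f := fun w => w + ω) (by fun_prop) rfl
  have h₂ := h₂.continuousAt
  have hc : ContinuousAt (fun w => (℘[L] w - ℘[L] ω) * (℘[L] (w + ω) - ℘[L] ω)) z := by fun_prop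
  have := tendsto_nhds_unique_of_eventuallyEq (hc.tendsto.mono_left nhdsWithin_le_nhds)
    tendsto_const_nhds (l := 𝓝[≠] z) (h z)
  intro e
  apply hC
  rw [← this, e]; simp

/-- Near a zero `z` of `℘ - ℘(ω)`, `ω` a half-period, the quotient by `(w - z)²` does not
vanish. -/
theorem exists_weierstrassP_sub_half_ne {ω z : ℂ} (h2 : 2 * ω ∈ L.lattice) (hω : ω ∉ L.lattice)
    (hz : z - ω ∈ L.lattice) : ∃ h : ℂ → ℂ, AnalyticAt ℂ h z ∧ h z ≠ 0 ∧
      ∀ᶠ w in 𝓝 z, ℘[L] w - ℘[L] ω = (w - z) ^ 2 * h w := by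
  obtain ⟨h, hh, he⟩ := exists_weierstrassP_sub_half h2 hω hz
  refine ⟨h, hh, fun h0 => ?_, he⟩
  obtain ⟨C, hC, hm⟩ := exists_weierstrassP_mul_eq_const h2 hω
  have hl : z + ω ∈ L.lattice := by convert add_mem hz h2 using 1; ring
  have hp : AnalyticAt ℂ (fun w => ℘[L - (z + ω)] (w + ω)) z :=
    (L.analyticAt_weierstrassPExcept (z + ω)).comp_of_eq (f := fun w => w + ω) (by fun_prop) rfl
  -- The constant product equals this function near `z`. The double pole of `℘(w + ω)` absorbs `(w -
  -- z)²` with leading coefficient `1`, so its limit is `h z`.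
  have hc : ContinuousAt (fun w => h w * ((w - z) ^ 2 *
      (℘[L - (z + ω)] (w + ω) - 1 / (z + ω) ^ 2 - ℘[L] ω) + 1)) z := by
    have := hp.continuousAt
    have := hh.continuousAt
    fun_prop
  have := tendsto_nhds_unique_of_eventuallyEq (hc.tendsto.mono_left nhdsWithin_le_nhds)
    (tendsto_const_nhds (x := C)) (l := 𝓝[≠] z) (by
      filter_upwards [hm z, mem_nhdsWithin_of_mem_nhds he, self_mem_nhdsWithin] with w h₁ h₂ h₃
      have : w - z ≠ 0 := sub_ne_zero.2 h₃
      rw [← h₁, h₂, L.weierstrassP_eq_add (z := w + ω) hl, show w + ω - (z + ω) = w - z by ring]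
      field_simp; ring)
  apply hC
  rw [← this, h0]; simp

end PeriodPair
end

/-! ### The square lattice: symmetries of `℘` and `ζ`, Legendre's relation -/

noncomputable section

open ComplexConjugate

/-- The open square of side `2 r` centred at the origin. -/
def openSquare (r : ℝ) : Set ℂ := {z | |z.re| < r ∧ |z.im| < r}

theorem isOpen_openSquare (r : ℝ) : IsOpen (openSquare r) :=
  (isOpen_lt Complex.continuous_re.abs continuous_const).inter
    (isOpen_lt Complex.continuous_im.abs continuous_const)

theorem openSquare_eq_reProdIm (r : ℝ) : openSquare r = Ioo (-r) r ×ℂ Ioo (-r) r := by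
  ext z; simp [openSquare, Complex.mem_reProdIm, abs_lt]

theorem convex_Ioo_reProdIm (r s t u : ℝ) : Convex ℝ (Ioo r s ×ℂ Ioo t u) :=
  ((convex_Ioo r s).linear_preimage Complex.reLm).inter
    ((convex_Ioo t u).linear_preimage Complex.imLm)

theorem convex_openSquare (r : ℝ) : Convex ℝ (openSquare r) := by
  rw [openSquare_eq_reProdIm]
  exact convex_Ioo_reProdIm _ _ _ _

theorem zero_mem_openSquare {r : ℝ} (hr : 0 < r) : (0 : ℂ) ∈ openSquare r := by
  simp [openSquare, hr]

theorem neg_mem_openSquare {r : ℝ} {z : ℂ} (hz : z ∈ openSquare r) : -z ∈ openSquare r := by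
  simpa [openSquare] using hz

theorem I_mul_mem_openSquare {r : ℝ} {z : ℂ} (hz : z ∈ openSquare r) :
    Complex.I * z ∈ openSquare r := by
  simpa [openSquare, and_comm] using hz

/-- Two functions on a square with the same derivative which agree at the origin. -/
theorem eqOn_openSquare_of_hasDerivAt {r : ℝ} (hr : 0 < r) {f g f' : ℂ → ℂ}
    (hf : ∀ z ∈ openSquare r, HasDerivAt f (f' z) z)
    (hg : ∀ z ∈ openSquare r, HasDerivAt g (f' z) z) (h0 : f 0 = g 0) :
    EqOn f g (openSquare r) :=
  (isOpen_openSquare r).eqOn_of_deriv_eq (convex_openSquare r).isPreconnected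
    (fun z hz => (hf z hz).differentiableAt.differentiableWithinAt)
    (fun z hz => (hg z hz).differentiableAt.differentiableWithinAt)
    (fun z hz => (hf z hz).deriv.trans (hg z hz).deriv.symm) (zero_mem_openSquare hr) h0

theorem exists_primitive_openSquare {r : ℝ} {f : ℂ → ℂ}
    (hf : DifferentiableOn ℂ f (openSquare r)) :
    ∃ g : ℂ → ℂ, g 0 = 0 ∧ ∀ z ∈ openSquare r, HasDerivAt g (f z) z := by
  obtain ⟨g, hg⟩ := (convex_openSquare r).exists_forall_hasDerivWithinAt hf
  exact ⟨fun z => g z - g 0, by simp, fun z hz =>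
    ((hg z hz).hasDerivAt ((isOpen_openSquare r).mem_nhds hz)).sub_const _⟩

/-- The periods `a`, `i a` of the square torus of side `a`. -/
def squarePair (a : ℝ) (ha : 0 < a) : PeriodPair where
  ω₁ := a
  ω₂ := Complex.I * a
  indep := by
    rw [LinearIndependent.pair_iff]
    intro s t h
    have h₁ := congrArg Complex.re h
    have h₂ := congrArg Complex.im h
    simp at h₁ h₂
    exact ⟨h₁.resolve_right ha.ne', h₂.resolve_right ha.ne'⟩

variable {a : ℝ} (ha : 0 < a)

theorem mem_squarePair_lattice {z : ℂ} :
    z ∈ (squarePair a ha).lattice ↔ ∃ m n : ℤ, z = m * a + n * (Complex.I * a) := by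
  rw [PeriodPair.mem_lattice]
  simp only [squarePair, eq_comm]

theorem mem_periodLattice_iff {z : ℂ} :
    z ∈ periodLattice a (Complex.I * a) ↔ z ∈ (squarePair a ha).lattice := by
  rw [mem_squarePair_lattice]; rfl

theorem periodDomain_eq_openSquare (ha : 0 < a) : periodDomain a (Complex.I * a) = openSquare (a / 2) := by
  ext z
  constructor
  · rintro ⟨t, ht, s, hs, rfl⟩
    simp only [openSquare, mem_ofPred_eq, abs_lt]
    simp
    refine ⟨⟨?_, ?_⟩, ?_, ?_⟩ <;> nlinarith [ht.1, ht.2, hs.1, hs.2]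
  · rintro ⟨h₁, h₂⟩
    rw [abs_lt] at h₁ h₂
    refine ⟨z.re / a, ⟨?_, ?_⟩, z.im / a, ⟨?_, ?_⟩, ?_⟩
    · rw [lt_div_iff₀ ha]; linarith
    · rw [div_lt_iff₀ ha]; linarith
    · rw [lt_div_iff₀ ha]; linarith
    · rw [div_lt_iff₀ ha]; linarith
    · have : (a : ℂ) ≠ 0 := by exact_mod_cast ha.ne'
      apply Complex.ext <;> simp <;> field_simp

theorem periodDomain_two_eq_openSquare (ha : 0 < a) :
    periodDomain (2 * a) (2 * (Complex.I * a)) = openSquare a := by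
  have := periodDomain_eq_openSquare (a := 2 * a) (by positivity)
  rw [show 2 * a / 2 = a by ring] at this
  rw [← this]; congr 1 <;> push_cast <;> ring

theorem eq_zero_of_mem_lattice {z : ℂ} (h : z ∈ (squarePair a ha).lattice)
    (hz : z ∈ openSquare a) : z = 0 := by
  obtain ⟨m, n, rfl⟩ := (mem_squarePair_lattice ha).1 h
  obtain ⟨h₁, h₂⟩ := hz
  simp [abs_mul, abs_of_pos ha] at h₁ h₂
  have h₁' : |(m : ℝ)| < 1 := by nlinarith
  have h₂' : |(n : ℝ)| < 1 := by nlinarith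
  have h₁'' : |m| < 1 := by exact_mod_cast h₁'
  have h₂'' : |n| < 1 := by exact_mod_cast h₂'
  rw [Int.abs_lt_one_iff] at h₁'' h₂''
  simp [h₁'', h₂'']

theorem notMem_lattice_of_mem_openSquare {z : ℂ} (hz : z ∈ openSquare a) (h0 : z ≠ 0) :
    z ∉ (squarePair a ha).lattice := fun h => h0 (eq_zero_of_mem_lattice ha h hz)

theorem ofReal_mem_lattice : (a : ℂ) ∈ (squarePair a ha).lattice :=
  (squarePair a ha).ω₁_mem_lattice

theorem I_mul_ofReal_mem_lattice : Complex.I * (a : ℂ) ∈ (squarePair a ha).lattice :=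
  (squarePair a ha).ω₂_mem_lattice

theorem I_mul_mem_lattice {l : ℂ} (hl : l ∈ (squarePair a ha).lattice) :
    Complex.I * l ∈ (squarePair a ha).lattice := by
  obtain ⟨m, n, rfl⟩ := (mem_squarePair_lattice ha).1 hl
  refine (mem_squarePair_lattice ha).2 ⟨-n, m, ?_⟩
  push_cast
  linear_combination (n : ℂ) * a * Complex.I_sq

theorem conj_mem_lattice {l : ℂ} (hl : l ∈ (squarePair a ha).lattice) :
    conj l ∈ (squarePair a ha).lattice := by
  obtain ⟨m, n, rfl⟩ := (mem_squarePair_lattice ha).1 hl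
  refine (mem_squarePair_lattice ha).2 ⟨m, -n, ?_⟩
  simp

/-- Multiplication by `i` on the square lattice. -/
def latticeMulI : (squarePair a ha).lattice ≃ (squarePair a ha).lattice where
  toFun l := ⟨Complex.I * l, I_mul_mem_lattice ha l.2⟩
  invFun l := ⟨-(Complex.I * l), neg_mem (I_mul_mem_lattice ha l.2)⟩
  left_inv l := by ext; simp [← mul_assoc]
  right_inv l := by ext; simp [← mul_assoc]

/-- Complex conjugation on the square lattice. -/
def latticeConj : (squarePair a ha).lattice ≃ (squarePair a ha).lattice where
  toFun l := ⟨conj l.1, conj_mem_lattice ha l.2⟩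
  invFun l := ⟨conj l.1, conj_mem_lattice ha l.2⟩
  left_inv l := by ext; simp
  right_inv l := by ext; simp

open PeriodPair

/-- Reindexing the lattice sum by `l ↦ il` multiplies each term by `i⁻² = -1`. -/
theorem weierstrassP_I_mul (z : ℂ) : ℘[squarePair a ha] (Complex.I * z) = -℘[squarePair a ha] z := by
  simp only [weierstrassP]
  rw [← (latticeMulI ha).tsum_eq, ← tsum_neg]
  congr with l
  simp only [latticeMulI, Equiv.coe_fn_mk]
  rw [← mul_sub, mul_pow, mul_pow, Complex.I_sq]
  simp; ring

theorem weierstrassP_conj (z : ℂ) : ℘[squarePair a ha] (conj z) = conj (℘[squarePair a ha] z) := by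
  simp only [weierstrassP]
  rw [← (latticeConj ha).tsum_eq, Complex.conj_tsum]
  congr with l
  simp [latticeConj]

theorem weierstrassPExcept_I_mul (z : ℂ) :
    (squarePair a ha).weierstrassPExcept 0 (Complex.I * z)
      = -(squarePair a ha).weierstrassPExcept 0 z := by
  have h₁ := (squarePair a ha).weierstrassP_eq_zero_add z
  have h₂ := (squarePair a ha).weierstrassP_eq_zero_add (Complex.I * z)
  rw [weierstrassP_I_mul, mul_pow, Complex.I_sq, h₁] at h₂
  rw [neg_one_mul, div_neg] at h₂
  linear_combination -h₂

/-! ### The values at the half-periods -/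

theorem two_mul_half_mem : 2 * ((a : ℂ) / 2) ∈ (squarePair a ha).lattice := by
  convert ofReal_mem_lattice ha using 1; ring

theorem two_mul_I_half_mem : 2 * (Complex.I * a / 2) ∈ (squarePair a ha).lattice := by
  convert I_mul_ofReal_mem_lattice ha using 1; ring

theorem two_mul_sum_half_mem : 2 * ((a + Complex.I * a) / 2) ∈ (squarePair a ha).lattice := by
  convert add_mem (ofReal_mem_lattice ha) (I_mul_ofReal_mem_lattice ha) using 1; ring

theorem half_mem_openSquare (ha : 0 < a) : (a : ℂ) / 2 ∈ openSquare a ∧ (a : ℂ) / 2 ≠ 0 := by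
  refine ⟨?_, by simp [ha.ne']⟩
  simp only [openSquare, mem_ofPred_eq]
  simp [abs_of_pos (half_pos ha), ha]

theorem I_half_mem_openSquare (ha : 0 < a) :
    Complex.I * a / 2 ∈ openSquare a ∧ Complex.I * (a : ℂ) / 2 ≠ 0 := by
  refine ⟨?_, by simp [ha.ne']⟩
  simp only [openSquare, mem_ofPred_eq]
  simp [abs_of_pos (half_pos ha), ha]

theorem sum_half_mem_openSquare (ha : 0 < a) :
    (a + Complex.I * a) / 2 ∈ openSquare a ∧ ((a : ℂ) + Complex.I * a) / 2 ≠ 0 := by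
  refine ⟨?_, fun h => ?_⟩
  · simp only [openSquare, mem_ofPred_eq]
    simp [abs_of_pos (half_pos ha), ha]
  · have := congrArg Complex.re h
    simp [ha.ne'] at this

theorem half_notMem : (a : ℂ) / 2 ∉ (squarePair a ha).lattice :=
  notMem_lattice_of_mem_openSquare ha (half_mem_openSquare ha).1 (half_mem_openSquare ha).2

theorem I_half_notMem : Complex.I * (a : ℂ) / 2 ∉ (squarePair a ha).lattice :=
  notMem_lattice_of_mem_openSquare ha (I_half_mem_openSquare ha).1 (I_half_mem_openSquare ha).2

theorem sum_half_notMem : ((a : ℂ) + Complex.I * a) / 2 ∉ (squarePair a ha).lattice :=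
  notMem_lattice_of_mem_openSquare ha (sum_half_mem_openSquare ha).1 (sum_half_mem_openSquare ha).2

/-- Multiplication by `i` fixes this half-period modulo the lattice but changes the sign of `℘`. -/
theorem weierstrassP_sum_half : ℘[squarePair a ha] ((a + Complex.I * a) / 2) = 0 := by
  rw [← CharZero.eq_neg_self_iff, ← weierstrassP_I_mul,
    ← weierstrassP_add_of_mem (ofReal_mem_lattice ha) (Complex.I * _)]
  congr 1
  linear_combination (-(a : ℂ) / 2) * Complex.I_sq

/-- The value `e` of `℘` at the half-period `a / 2`. -/
def halfValue : ℝ := (℘[squarePair a ha] ((a : ℂ) / 2)).re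

theorem weierstrassP_half : ℘[squarePair a ha] ((a : ℂ) / 2) = halfValue ha := by
  have h := weierstrassP_conj ha ((a : ℂ) / 2)
  have h2 : conj ((a : ℂ) / 2) = (a : ℂ) / 2 := by
    rw [show (a : ℂ) / 2 = ((a / 2 : ℝ) : ℂ) by push_cast; rfl, Complex.conj_ofReal]
  rw [h2] at h
  exact (Complex.conj_eq_iff_re.1 h.symm).symm

theorem weierstrassP_I_half : ℘[squarePair a ha] (Complex.I * a / 2) = -halfValue ha := by
  rw [mul_div_assoc, weierstrassP_I_mul, weierstrassP_half]

/-- `℘` takes different values at incongruent half-periods, and it vanishes at `(a + ia)/2`. -/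
theorem halfValue_ne_zero : halfValue ha ≠ 0 := by
  have h := weierstrassP_ne_half (two_mul_sum_half_mem ha) (sum_half_notMem ha)
    (half_notMem ha) (fun h => I_half_notMem ha (by
      convert neg_mem h using 1; ring))
  rw [weierstrassP_half, weierstrassP_sum_half] at h
  exact_mod_cast h

/-- Both `℘` and `℘'` vanish at `(a + ia)/2`. -/
theorem g₃_squarePair : (squarePair a ha).g₃ = 0 := by
  have := (squarePair a ha).derivWeierstrassP_sq _ (sum_half_notMem ha)
  rw [derivWeierstrassP_half (two_mul_sum_half_mem ha), weierstrassP_sum_half] at this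
  simpa using this

theorem g₂_squarePair : (squarePair a ha).g₂ = 4 * (halfValue ha : ℂ) ^ 2 := by
  have := (squarePair a ha).derivWeierstrassP_sq _ (half_notMem ha)
  rw [derivWeierstrassP_half (two_mul_half_mem ha), weierstrassP_half, g₃_squarePair] at this
  have he : (halfValue ha : ℂ) ≠ 0 := by exact_mod_cast halfValue_ne_zero ha
  apply mul_left_cancel₀ he
  linear_combination this

theorem hasDerivAt_derivWeierstrassP_square {z : ℂ} (hz : z ∉ (squarePair a ha).lattice) :
    HasDerivAt ℘'[squarePair a ha]
      (6 * ℘[squarePair a ha] z ^ 2 - 2 * (halfValue ha : ℂ) ^ 2) z := by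
  convert (squarePair a ha).hasDerivAt_derivWeierstrassP hz using 1
  rw [g₂_squarePair]; ring

/-! ### The Weierstrass zeta function and the logarithm of the sigma function -/

theorem differentiableOn_weierstrassPExcept_openSquare :
    DifferentiableOn ℂ ((squarePair a ha).weierstrassPExcept 0) (openSquare a) :=
  ((squarePair a ha).differentiableOn_weierstrassPExcept 0).mono fun _ hz h =>
    h.2 (eq_zero_of_mem_lattice ha h.1 hz)

theorem exists_zetaReg : ∃ Z : ℂ → ℂ, Z 0 = 0 ∧ ∀ z ∈ openSquare a,
    HasDerivAt Z (-(squarePair a ha).weierstrassPExcept 0 z) z :=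
  exists_primitive_openSquare (differentiableOn_weierstrassPExcept_openSquare ha).neg

/-- The regular part `ζ(z) - 1/z` of the Weierstrass zeta function, for `|Re z|, |Im z| < a`. -/
def zetaReg : ℂ → ℂ := (exists_zetaReg ha).choose

theorem zetaReg_zero : zetaReg ha 0 = 0 := (exists_zetaReg ha).choose_spec.1

theorem hasDerivAt_zetaReg {z : ℂ} (hz : z ∈ openSquare a) :
    HasDerivAt (zetaReg ha) (-(squarePair a ha).weierstrassPExcept 0 z) z :=
  (exists_zetaReg ha).choose_spec.2 z hz

theorem exists_logSigma : ∃ Z : ℂ → ℂ, Z 0 = 0 ∧ ∀ z ∈ openSquare a,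
    HasDerivAt Z (zetaReg ha z) z :=
  exists_primitive_openSquare fun _ hz =>
    (hasDerivAt_zetaReg ha hz).differentiableAt.differentiableWithinAt

/-- The logarithm of `σ(z) / z`, for `|Re z|, |Im z| < a`. -/
def logSigma : ℂ → ℂ := (exists_logSigma ha).choose

theorem hasDerivAt_logSigma {z : ℂ} (hz : z ∈ openSquare a) :
    HasDerivAt (logSigma ha) (zetaReg ha z) z :=
  (exists_logSigma ha).choose_spec.2 z hz

/-- As for the other symmetries of `zetaReg` and `logSigma`, two primitives of the same function
that agree at the origin coincide on the square. -/
theorem zetaReg_neg {z : ℂ} (hz : z ∈ openSquare a) : zetaReg ha (-z) = -zetaReg ha z := by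
  have := eqOn_openSquare_of_hasDerivAt ha (f := fun z => -zetaReg ha (-z)) (g := zetaReg ha)
    (f' := fun z => -(squarePair a ha).weierstrassPExcept 0 z) (fun z hz => ?_)
    (fun z hz => hasDerivAt_zetaReg ha hz) (by simp [zetaReg_zero]) hz
  · rw [← this]; simp
  · have := ((hasDerivAt_zetaReg ha (neg_mem_openSquare hz)).scomp z (hasDerivAt_neg z)).neg
    refine this.congr_deriv ?_
    rw [weierstrassPExcept_neg]; simp

theorem zetaReg_I_mul {z : ℂ} (hz : z ∈ openSquare a) :
    zetaReg ha (Complex.I * z) = -Complex.I * zetaReg ha z := by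
  have := eqOn_openSquare_of_hasDerivAt ha (f := fun z => Complex.I * zetaReg ha (Complex.I * z))
    (g := zetaReg ha)
    (f' := fun z => -(squarePair a ha).weierstrassPExcept 0 z) (fun z hz => ?_)
    (fun z hz => hasDerivAt_zetaReg ha hz) (by simp [zetaReg_zero]) hz
  · rw [← this]
    linear_combination zetaReg ha (Complex.I * z) * Complex.I_sq
  · have := ((hasDerivAt_zetaReg ha (I_mul_mem_openSquare hz)).scomp z
      ((hasDerivAt_id z).const_mul Complex.I)).const_mul Complex.I
    refine this.congr_deriv ?_
    rw [weierstrassPExcept_I_mul]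
    simp only [smul_eq_mul]
    linear_combination (squarePair a ha).weierstrassPExcept 0 z * Complex.I_sq

theorem logSigma_neg {z : ℂ} (hz : z ∈ openSquare a) : logSigma ha (-z) = logSigma ha z := by
  refine eqOn_openSquare_of_hasDerivAt ha (f := fun z => logSigma ha (-z)) (g := logSigma ha)
    (f' := zetaReg ha) (fun z hz => ?_)
    (fun z hz => hasDerivAt_logSigma ha hz) (by simp) hz
  refine ((hasDerivAt_logSigma ha (neg_mem_openSquare hz)).scomp z
    (hasDerivAt_neg z)).congr_deriv ?_
  rw [zetaReg_neg ha hz]; simp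

theorem logSigma_I_mul {z : ℂ} (hz : z ∈ openSquare a) :
    logSigma ha (Complex.I * z) = logSigma ha z := by
  refine eqOn_openSquare_of_hasDerivAt ha (f := fun z => logSigma ha (Complex.I * z))
    (g := logSigma ha) (f' := zetaReg ha) (fun z hz => ?_)
    (fun z hz => hasDerivAt_logSigma ha hz) (by simp) hz
  refine ((hasDerivAt_logSigma ha (I_mul_mem_openSquare hz)).scomp z
    ((hasDerivAt_id z).const_mul Complex.I)).congr_deriv ?_
  rw [zetaReg_I_mul ha hz]
  simp only [smul_eq_mul]
  linear_combination (-zetaReg ha z) * Complex.I_sq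

/-- The Weierstrass zeta function of the square lattice, for `|Re z|, |Im z| < a`. -/
def sqZeta (z : ℂ) : ℂ := 1 / z + zetaReg ha z

theorem hasDerivAt_sqZeta {z : ℂ} (hz : z ∈ openSquare a) (h0 : z ≠ 0) :
    HasDerivAt (sqZeta ha) (-℘[squarePair a ha] z) z := by
  have := ((hasDerivAt_id z).fun_inv h0).add (hasDerivAt_zetaReg ha hz)
  have e : sqZeta ha = (fun i => (_root_.id i)⁻¹) + zetaReg ha := by
    ext w; simp [sqZeta]
  rw [e]
  refine this.congr_deriv ?_
  · rw [(squarePair a ha).weierstrassP_eq_zero_add]; simp; ring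

theorem sqZeta_neg {z : ℂ} (hz : z ∈ openSquare a) : sqZeta ha (-z) = -sqZeta ha z := by
  simp only [sqZeta, zetaReg_neg ha hz]
  rw [div_neg]; ring

theorem sqZeta_I_mul {z : ℂ} (hz : z ∈ openSquare a) :
    sqZeta ha (Complex.I * z) = -Complex.I * sqZeta ha z := by
  simp only [sqZeta, zetaReg_I_mul ha hz]
  rw [one_div, mul_inv, Complex.inv_I]; ring

/-- This rectangle is the overlap of the double square with its translate by `-a`. It is convex and
contains no lattice point, so functions with zero derivative are constant on it. -/
theorem add_period_aux {z : ℂ} (hz : z ∈ openSquare a) (hz' : z + a ∈ openSquare a) :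
    z ∈ Ioo (-a) 0 ×ℂ Ioo (-a) a := by
  simp only [openSquare, mem_ofPred_eq, abs_lt] at hz hz'
  simp at hz'
  rw [Complex.mem_reProdIm]
  exact ⟨⟨by linarith, by linarith⟩, by linarith, by linarith⟩

theorem add_period_aux' {z : ℂ} (hz : z ∈ Ioo (-a) 0 ×ℂ Ioo (-a) a) :
    (z ∈ openSquare a ∧ z ≠ 0) ∧ z + a ∈ openSquare a ∧ z + a ≠ 0 := by
  rw [Complex.mem_reProdIm] at hz
  obtain ⟨⟨h₁, h₂⟩, h₃, h₄⟩ := hz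
  simp only [openSquare, mem_ofPred_eq, abs_lt]
  refine ⟨⟨⟨⟨by linarith, by linarith⟩, by linarith, by linarith⟩, fun h => ?_⟩,
    ⟨⟨?_, ?_⟩, ?_, ?_⟩, fun h => ?_⟩
  · rw [h] at h₂; simp at h₂
  · simp; linarith
  · simp; linarith
  · simp; linarith
  · simp; linarith
  · have := congrArg Complex.re h
    simp at this
    linarith

theorem isOpen_preconnected_add_period (ha : 0 < a) :
    IsOpen (Ioo (-a) 0 ×ℂ Ioo (-a) a) ∧ IsPreconnected (Ioo (-a) 0 ×ℂ Ioo (-a) a) ∧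
      -((a : ℂ) / 2) ∈ Ioo (-a) 0 ×ℂ Ioo (-a) a := by
  refine ⟨isOpen_Ioo.reProdIm isOpen_Ioo,
    (convex_Ioo_reProdIm _ _ _ _).isPreconnected, ?_⟩
  rw [Complex.mem_reProdIm]
  simp [ha]

/-- The difference has derivative `-℘(z + a) + ℘(z) = 0`; its value is found at `z = -a/2` from the
oddness of `ζ`. -/
theorem sqZeta_add_period {z : ℂ} (hz : z ∈ openSquare a) (hz' : z + a ∈ openSquare a) :
    sqZeta ha (z + a) = sqZeta ha z + 2 * sqZeta ha (a / 2) := by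
  obtain ⟨ho, hp, hm⟩ := isOpen_preconnected_add_period ha
  have hd : ∀ w ∈ Ioo (-a) 0 ×ℂ Ioo (-a) a,
      HasDerivAt (fun w => sqZeta ha (w + a) - sqZeta ha w) 0 w := by
    intro w hw
    obtain ⟨h₁, h₂⟩ := add_period_aux' hw
    refine (((hasDerivAt_sqZeta ha h₂.1 h₂.2).comp_add_const w (a : ℂ)).sub
      (hasDerivAt_sqZeta ha h₁.1 h₁.2)).congr_deriv ?_
    rw [weierstrassP_add_of_mem (ofReal_mem_lattice ha), sub_self]
  have := ho.eqOn_of_deriv_eq hp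
    (f := fun w => sqZeta ha (w + a) - sqZeta ha w) (g := fun _ => 2 * sqZeta ha (a / 2))
    (fun w hw => (hd w hw).differentiableAt.differentiableWithinAt) (by fun_prop)
    (fun w hw => by rw [(hd w hw).deriv]; simp) hm (by
      rw [sqZeta_neg ha (half_mem_openSquare ha).1]
      ring_nf) (add_period_aux hz hz')
  linear_combination this

/-- A rotation by `i` turns the imaginary period into the real one, and `ζ(iz) = -iζ(z)`. -/
theorem sqZeta_add_I_period {z : ℂ} (hz : z ∈ openSquare a)
    (hz' : z + Complex.I * a ∈ openSquare a) :
    sqZeta ha (z + Complex.I * a) = sqZeta ha z - Complex.I * (2 * sqZeta ha (a / 2)) := by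
  have h₁ : -(Complex.I * z) ∈ openSquare a := neg_mem_openSquare (I_mul_mem_openSquare hz)
  have h₂ : -(Complex.I * z) + a ∈ openSquare a := by
    convert neg_mem_openSquare (I_mul_mem_openSquare hz') using 1
    linear_combination (a : ℂ) * Complex.I_sq
  have e₁ : z + Complex.I * a = Complex.I * (-(Complex.I * z) + a) := by
    linear_combination z * Complex.I_sq
  rw [e₁, sqZeta_I_mul ha h₂, sqZeta_add_period ha h₁ h₂, sqZeta_neg ha (I_mul_mem_openSquare hz),
    sqZeta_I_mul ha hz]
  linear_combination (-sqZeta ha z) * Complex.I_sq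

theorem bottom_mem_openSquare (ha : 0 < a) {x : ℝ} (hx : x ∈ Icc (-(a / 2)) (a / 2)) :
    (x : ℂ) - Complex.I * a / 2 ∈ openSquare a ∧ (x : ℂ) + Complex.I * a / 2 ∈ openSquare a := by
  simp only [openSquare, mem_ofPred_eq, abs_lt]
  simp
  have := hx.1; have := hx.2
  refine ⟨⟨⟨?_, ?_⟩, ?_, ?_⟩, ⟨?_, ?_⟩, ?_, ?_⟩ <;> linarith

/-- By oddness the second term is `-ζ(x + ia/2)`, so the sum is minus the increment of `ζ` over the
period `ia`. -/
theorem sqZeta_bottom {x : ℝ} (hx : x ∈ Icc (-(a / 2)) (a / 2)) :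
    sqZeta ha (x - Complex.I * a / 2) + sqZeta ha (-x - Complex.I * a / 2)
      = Complex.I * (2 * sqZeta ha (a / 2)) := by
  obtain ⟨h₁, h₂⟩ := bottom_mem_openSquare ha hx
  have e : (-x - Complex.I * a / 2 : ℂ) = -(x + Complex.I * a / 2) := by ring
  have e' : (x : ℂ) + Complex.I * a / 2 = (x - Complex.I * a / 2) + Complex.I * a := by ring
  rw [e, sqZeta_neg ha h₂, e', sqZeta_add_I_period ha h₁ (by rwa [← e'])]
  ring

/-- **Legendre's relation** for the square lattice. -/
theorem two_mul_sqZeta_half : 2 * sqZeta ha (a / 2) = (Real.pi / a : ℝ) := by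
  set h := 2 * sqZeta ha (a / 2) with hh
  -- The derivative of `Ψ` vanishes by `sqZeta_bottom`: the arctangent accounts for the polar parts
  -- `1/z` of `ζ` along the bottom edge.
  set Ψ : ℝ → ℂ := fun x => logSigma ha (x - Complex.I * a / 2)
    - logSigma ha (-x - Complex.I * a / 2) - Complex.I * h * x
    + 2 * Complex.I * (Real.arctan (x / (a / 2)) : ℂ) with hΨ
  have hd : ∀ x ∈ Icc (-(a / 2)) (a / 2), HasDerivAt Ψ 0 x := by
    intro x hx
    have hx' : -x ∈ Icc (-(a / 2)) (a / 2) := ⟨by linarith [hx.2], by linarith [hx.1]⟩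
    have m₁ := (bottom_mem_openSquare ha hx).1
    have m₂ := (bottom_mem_openSquare ha hx').1
    push_cast at m₂
    have d₁ := (HasDerivAt.scomp (x : ℂ) (h := fun w => w - Complex.I * a / 2)
      (hasDerivAt_logSigma ha m₁) ((hasDerivAt_id (x : ℂ)).sub_const _)).comp_ofReal
    have d₂ := (HasDerivAt.scomp (x : ℂ) (h := fun w => -w - Complex.I * a / 2)
      (hasDerivAt_logSigma ha m₂) ((hasDerivAt_neg (x : ℂ)).sub_const _)).comp_ofReal
    have d₃ := ((hasDerivAt_id (x : ℂ)).const_mul (Complex.I * h)).comp_ofReal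
    have d₄ := ((((hasDerivAt_id x).div_const (a / 2)).arctan).ofReal_comp).const_mul
      (2 * Complex.I)
    refine (((d₁.sub d₂).sub d₃).add d₄).congr_deriv ?_
    have hz := sqZeta_bottom ha hx
    rw [← hh] at hz
    have n₁ : (x : ℂ) - Complex.I * a / 2 ≠ 0 := fun h => by
      have := congrArg Complex.im h
      simp [ha.ne'] at this
    have n₂ : -(x : ℂ) - Complex.I * a / 2 ≠ 0 := fun h => by
      have := congrArg Complex.im h
      simp [ha.ne'] at this
    have ha' : (a : ℂ) ≠ 0 := by exact_mod_cast ha.ne'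
    have hx2 : (a : ℂ) ^ 2 + 4 * x ^ 2 ≠ 0 := by
      have : a ^ 2 + 4 * x ^ 2 ≠ 0 := by positivity
      exact_mod_cast this
    have hq : 1 / ((x : ℂ) - Complex.I * a / 2) + 1 / (-(x : ℂ) - Complex.I * a / 2)
        = 2 * Complex.I * (2 * a / (a ^ 2 + 4 * x ^ 2)) := by
      rw [div_add_div _ _ n₁ n₂, mul_div_assoc', div_eq_div_iff (mul_ne_zero n₁ n₂) hx2]
      linear_combination (-(a : ℂ) ^ 3 * Complex.I) * Complex.I_sq
    simp only [sqZeta] at hz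
    simp only [smul_eq_mul, id]
    push_cast
    have e₄ : 1 / (1 + ((x : ℂ) / (a / 2)) ^ 2) * (1 / (a / 2)) = 2 * a / (a ^ 2 + 4 * x ^ 2) := by
      have h4 : (1 + ((x : ℂ) / (a / 2)) ^ 2) ≠ 0 := by
        have : (1 + ((x : ℝ) / (a / 2)) ^ 2) ≠ 0 := by positivity
        exact_mod_cast this
      rw [div_mul_div_comm, div_eq_div_iff (mul_ne_zero h4 (by simp [ha'])) hx2]
      field_simp
      ring
    rw [e₄]
    linear_combination hz - hq
  have hb : -(a / 2) ≤ a / 2 := by linarith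
  have hc := constant_of_has_deriv_right_zero (f := Ψ) (a := -(a / 2)) (b := a / 2)
    (fun x hx => (hd x hx).continuousAt.continuousWithinAt)
    (fun x hx => (hd x (Ico_subset_Icc_self hx)).hasDerivWithinAt) (a / 2) (right_mem_Icc.2 hb)
  have ha2 : a / 2 ≠ 0 := by positivity
  have ha' : (a : ℂ) ≠ 0 := by exact_mod_cast ha.ne'
  -- Rotation by `i` carries the lower left corner to the lower right one, so the values of
  -- `logSigma` cancel in `Ψ(±a/2)`. Only `ha/2` and `arctan 1 = π/4` remain.
  have hs := logSigma_I_mul ha (bottom_mem_openSquare ha (left_mem_Icc.2 hb)).1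
  simp only [hΨ, neg_div, div_self ha2, Real.arctan_neg, Real.arctan_one] at hc
  push_cast at hc hs ⊢
  rw [show Complex.I * (-((a : ℂ) / 2) - Complex.I * a / 2) = a / 2 - Complex.I * a / 2 by
    linear_combination (-(a : ℂ) / 2) * Complex.I_sq] at hs
  rw [neg_neg, hs] at hc
  rw [eq_div_iff ha']
  apply mul_left_cancel₀ Complex.I_ne_zero
  linear_combination -hc

end

/-! ### The bound `0 < ℘(a/2) < 3π/a²` -/

noncomputable section
open ComplexConjugate PeriodPair

variable {a : ℝ} (ha : 0 < a)

theorem top_notMem_lattice {x : ℝ} (hx : x ∈ Icc 0 (a / 2)) :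
    (x : ℂ) + Complex.I * a / 2 ∉ (squarePair a ha).lattice := by
  refine notMem_lattice_of_mem_openSquare ha
    (bottom_mem_openSquare ha ⟨by linarith [hx.1], hx.2⟩).2 fun h => ?_
  have := congrArg Complex.im h
  simp [ha.ne'] at this

/-- Conjugation moves `x + ia/2` by the lattice vector `-ia`. -/
theorem weierstrassP_top_real (x : ℝ) :
    ℘[squarePair a ha] (x + Complex.I * a / 2)
      = (℘[squarePair a ha] (x + Complex.I * a / 2)).re := by
  have h := weierstrassP_conj ha (x + Complex.I * a / 2)
  have e : conj ((x : ℂ) + Complex.I * a / 2) + Complex.I * a = x + Complex.I * a / 2 := by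
    rw [show (x : ℂ) + Complex.I * a / 2 = x + Complex.I * ((a / 2 : ℝ) : ℂ) by push_cast; ring]
    apply Complex.ext <;> simp [-Complex.ofReal_div]
    ring
  rw [← weierstrassP_add_of_mem (I_mul_ofReal_mem_lattice ha), e] at h
  exact (Complex.conj_eq_iff_re.1 h.symm).symm

theorem weierstrassP_top_ne_zero {x : ℝ} (hx : x ∈ Ioo 0 (a / 2)) :
    ℘[squarePair a ha] (x + Complex.I * a / 2) ≠ 0 := by
  rw [← weierstrassP_sum_half ha]
  refine weierstrassP_ne_half (two_mul_sum_half_mem ha) (sum_half_notMem ha)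
    (top_notMem_lattice ha (Ioo_subset_Icc_self hx)) ?_
  have e : (x : ℂ) + Complex.I * a / 2 - (a + Complex.I * a) / 2 = ((x - a / 2 : ℝ) : ℂ) := by
    push_cast; ring
  rw [e]
  refine notMem_lattice_of_mem_openSquare ha ?_ ?_
  · simp only [openSquare, mem_ofPred_eq, Complex.ofReal_re, Complex.ofReal_im, abs_zero]
    exact ⟨by rw [abs_lt]; constructor <;> linarith [hx.1, hx.2], ha⟩
  · have := hx.2
    exact_mod_cast (by linarith : x - a / 2 < 0).ne

theorem weierstrassP_top_ne {x : ℝ} (hx : x ∈ Ioo 0 (a / 2)) :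
    ℘[squarePair a ha] (x + Complex.I * a / 2) ≠ -halfValue ha := by
  rw [← weierstrassP_I_half ha]
  refine weierstrassP_ne_half (two_mul_I_half_mem ha) (I_half_notMem ha)
    (top_notMem_lattice ha (Ioo_subset_Icc_self hx)) ?_
  rw [add_sub_cancel_right]
  refine notMem_lattice_of_mem_openSquare ha ?_ ?_
  · simp only [openSquare, mem_ofPred_eq, Complex.ofReal_re, Complex.ofReal_im, abs_zero]
    exact ⟨by rw [abs_lt]; constructor <;> linarith [hx.1, hx.2], ha⟩
  · exact_mod_cast hx.1.ne'

/-- On this half edge `℘` is real and runs from `-e` to `0`. It takes neither value in between, so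
by the intermediate value theorem it stays strictly between them. -/
theorem weierstrassP_top_mul_neg {x : ℝ} (hx : x ∈ Ioo 0 (a / 2)) :
    (℘[squarePair a ha] (x + Complex.I * a / 2)).re *
      ((℘[squarePair a ha] (x + Complex.I * a / 2)).re + halfValue ha) < 0 := by
  set y : ℝ → ℝ := fun x => (℘[squarePair a ha] (x + Complex.I * a / 2)).re with hy
  set e := halfValue ha with he
  have he0 : e ≠ 0 := halfValue_ne_zero ha
  have hcont : ContinuousOn y (Icc 0 (a / 2)) := fun t ht => by
    have h₁ := ((squarePair a ha).hasDerivAt_weierstrassP (top_notMem_lattice ha ht)).continuousAt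
    have h₂ : ContinuousAt (fun t : ℝ => (t : ℂ) + Complex.I * a / 2) t := by fun_prop
    exact (Complex.continuous_re.continuousAt.comp
      (ContinuousAt.comp (f := fun t : ℝ => (t : ℂ) + Complex.I * a / 2) h₁ h₂)).continuousWithinAt
  have n0 : ∀ t ∈ Ioo 0 (a / 2), y t ≠ 0 := fun t ht h => weierstrassP_top_ne_zero ha ht (by
    rw [weierstrassP_top_real]; exact_mod_cast h)
  have n1 : ∀ t ∈ Ioo 0 (a / 2), y t ≠ -e := fun t ht h => weierstrassP_top_ne ha ht (by
    rw [weierstrassP_top_real]; exact_mod_cast h)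
  have y0 : y 0 = -e := by
    simp only [hy, Complex.ofReal_zero, zero_add, weierstrassP_I_half]; simp [he]
  have y1 : y (a / 2) = 0 := by
    have := weierstrassP_sum_half ha
    simp only [hy]
    rw [show (((a / 2 : ℝ) : ℂ) + Complex.I * a / 2) = (a + Complex.I * a) / 2 by push_cast; ring,
      this]; rfl
  -- Normalising by `-e` makes the end values `1` and `0`, whatever the sign of `e`, which is not
  -- yet known.
  set r : ℝ → ℝ := fun t => y t / (-e) with hr
  have hrc : ContinuousOn r (Icc 0 (a / 2)) := hcont.div_const _
  have r0 : r 0 = 1 := by simp [hr, y0, he0]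
  have r1 : r (a / 2) = 0 := by simp [hr, y1]
  have m0 : ∀ t ∈ Ioo 0 (a / 2), r t ≠ 0 := fun t ht => div_ne_zero (n0 t ht) (neg_ne_zero.2 he0)
  have m1 : ∀ t ∈ Ioo 0 (a / 2), r t ≠ 1 := fun t ht h => n1 t ht (by
    rwa [hr, div_eq_one_iff_eq (neg_ne_zero.2 he0)] at h)
  have hpos : 0 < r x := by
    by_contra! h
    obtain ⟨t, ht, h'⟩ := intermediate_value_Icc' hx.1.le
      (hrc.mono (Icc_subset_Icc_right hx.2.le)) (show (0 : ℝ) ∈ Icc (r x) (r 0) by simp [r0, h])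
    have : t ≠ 0 := by rintro rfl; rw [r0] at h'; norm_num at h'
    exact m0 t ⟨lt_of_le_of_ne ht.1 this.symm, ht.2.trans_lt hx.2⟩ h'
  have hlt : r x < 1 := by
    by_contra! h
    obtain ⟨t, ht, h'⟩ := intermediate_value_Icc' hx.2.le
      (hrc.mono (Icc_subset_Icc_left hx.1.le))
      (show (1 : ℝ) ∈ Icc (r (a / 2)) (r x) by simp [r1, h])
    have : t ≠ a / 2 := by rintro rfl; rw [r1] at h'; norm_num at h'
    exact m1 t ⟨hx.1.trans_le ht.1, lt_of_le_of_ne ht.2 this⟩ h'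
  have hyx : y x = -e * r x := by simp only [hr]; field_simp
  change y x * (y x + e) < 0
  rw [hyx]
  have : 0 < e ^ 2 := by positivity
  nlinarith [mul_pos this (mul_pos hpos (sub_pos.2 hlt))]

/-- An anti-derivative of `℘² - ε ℘`, where `ε = ± e`. -/
def sqPrimitive (ε : ℝ) (z : ℂ) : ℂ :=
  ℘'[squarePair a ha] z / 6 + (ε : ℂ) ^ 2 / 3 * z + ε * sqZeta ha z

/-- By `℘'' = 6℘² - 2e²`, `℘²` is the derivative of `℘'/6 + e²z/3`, and `-℘` is the derivative of
`ζ`. -/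
theorem hasDerivAt_sqPrimitive {ε : ℝ} (hε : ε ^ 2 = halfValue ha ^ 2) {z : ℂ}
    (hz : z ∈ openSquare a) (h0 : z ≠ 0) :
    HasDerivAt (sqPrimitive ha ε)
      ((℘[squarePair a ha] z - ε) * ℘[squarePair a ha] z) z := by
  have hε' : (ε : ℂ) ^ 2 = (halfValue ha : ℂ) ^ 2 := by exact_mod_cast hε
  have hn := notMem_lattice_of_mem_openSquare ha hz h0
  refine ((((hasDerivAt_derivWeierstrassP_square ha hn).div_const 6).add
    ((hasDerivAt_id z).const_mul ((ε : ℂ) ^ 2 / 3))).add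
    ((hasDerivAt_sqZeta ha hz h0).const_mul (ε : ℂ))).congr_deriv ?_
  rw [hε']; ring

theorem sqZeta_sum_half :
    sqZeta ha ((a + Complex.I * a) / 2) - sqZeta ha (Complex.I * a / 2) = sqZeta ha (a / 2) := by
  have h₁ := sqZeta_bottom ha (x := 0) ⟨by linarith, by linarith⟩
  have h₂ := sqZeta_bottom ha (x := a / 2) ⟨by linarith, le_rfl⟩
  have e₁ : ((0 : ℝ) : ℂ) - Complex.I * a / 2 = -(Complex.I * a / 2) := by push_cast; ring
  have e₁' : -((0 : ℝ) : ℂ) - Complex.I * a / 2 = -(Complex.I * a / 2) := by push_cast; ring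
  rw [e₁, e₁', sqZeta_neg ha (I_half_mem_openSquare ha).1] at h₁
  set w : ℂ := (a + Complex.I * a) / 2
  have hw : w ∈ openSquare a := (sum_half_mem_openSquare ha).1
  have e₂ : ((a / 2 : ℝ) : ℂ) - Complex.I * a / 2 = -w + a := by
    simp only [w]; push_cast; ring
  have e₃ : -((a / 2 : ℝ) : ℂ) - Complex.I * a / 2 = -w := by
    simp only [w]; push_cast; ring
  have hw' : -w + a ∈ openSquare a := by
    rw [← e₂]; exact (bottom_mem_openSquare ha ⟨by linarith, le_rfl⟩).1
  rw [e₂, e₃, sqZeta_add_period ha (neg_mem_openSquare hw) hw', sqZeta_neg ha hw] at h₂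
  linear_combination (h₁ - h₂) / 2

/-- Integrate `℘(℘ + e) < 0` from `ia/2` to `(a + ia)/2`. As `℘'` vanishes at both ends and `ζ`
increases by `π/(2a)`, the result is `e(ea/6 - π/(2a)) < 0`, which gives both inequalities. -/
theorem halfValue_bound : 0 < halfValue ha ∧ halfValue ha * a ^ 2 < 3 * Real.pi := by
  set e := halfValue ha with he
  set T : ℝ → ℝ := fun x => (sqPrimitive ha (-e) (x + Complex.I * a / 2)).re with hT
  have hd : ∀ x ∈ Icc 0 (a / 2), HasDerivAt T
      ((℘[squarePair a ha] (x + Complex.I * a / 2)).re *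
      ((℘[squarePair a ha] (x + Complex.I * a / 2)).re + e)) x := by
    intro x hx
    have hm := (bottom_mem_openSquare ha (x := x) ⟨by linarith [hx.1], hx.2⟩).2
    have h0 : (x : ℂ) + Complex.I * a / 2 ≠ 0 := fun h => by
      have := congrArg Complex.im h
      simp [ha.ne'] at this
    have h := (HasDerivAt.scomp (x : ℂ) (h := fun w => w + Complex.I * a / 2)
      (hasDerivAt_sqPrimitive ha (ε := -e) (by rw [he]; ring) hm h0)
      ((hasDerivAt_id (x : ℂ)).add_const _)).real_of_complex
    refine h.congr_deriv ?_
    rw [weierstrassP_top_real]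
    simp
    ring
  have hanti : StrictAntiOn T (Icc 0 (a / 2)) := by
    refine strictAntiOn_of_deriv_neg (convex_Icc _ _)
      (fun x hx => (hd x hx).continuousAt.continuousWithinAt) fun x hx => ?_
    rw [interior_Icc] at hx
    rw [(hd x (Ioo_subset_Icc_self hx)).deriv]
    exact weierstrassP_top_mul_neg ha hx
  have hlt := hanti (left_mem_Icc.2 (by positivity)) (right_mem_Icc.2 (by positivity))
    (half_pos ha)
  have hdiff : sqPrimitive ha (-e) (((a / 2 : ℝ) : ℂ) + Complex.I * a / 2)
      - sqPrimitive ha (-e) (((0 : ℝ) : ℂ) + Complex.I * a / 2)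
      = (e * (e * a / 6 - Real.pi / (2 * a)) : ℝ) := by
    rw [show (((a / 2 : ℝ) : ℂ) + Complex.I * a / 2) = (a + Complex.I * a) / 2 by push_cast; ring]
    simp only [sqPrimitive, Complex.ofReal_zero, zero_add]
    rw [derivWeierstrassP_half (two_mul_sum_half_mem ha),
      derivWeierstrassP_half (two_mul_I_half_mem ha)]
    have h₁ := sqZeta_sum_half ha
    have h₂ := two_mul_sqZeta_half ha
    have ha' : (a : ℂ) ≠ 0 := by exact_mod_cast ha.ne'
    have e₁ : (e * (e * a / 6 - Real.pi / (2 * a)) : ℝ)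
      = (e ^ 2 * a / 6 - e * (Real.pi / a : ℝ) / 2 : ℂ) := by
      push_cast; field_simp
    rw [e₁, ← h₂]
    push_cast
    linear_combination (-e : ℂ) * h₁
  have hneg : e * (e * a / 6 - Real.pi / (2 * a)) < 0 := by
    have := congrArg Complex.re hdiff
    rw [Complex.sub_re, Complex.ofReal_re] at this
    rw [← this]
    exact sub_neg.2 hlt
  have hneg' : e * (e * a ^ 2 - 3 * Real.pi) < 0 := by
    have : e * (e * a ^ 2 - 3 * Real.pi) = (6 * a) * (e * (e * a / 6 - Real.pi / (2 * a))) := by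
      field_simp; ring
    rw [this]
    exact mul_neg_of_pos_of_neg (by positivity) hneg
  have hpi := Real.pi_pos
  have hpos : 0 < e := by
    -- If `e ≤ 0`, both factors of `e(ea² - 3π)` are nonpositive, so the product cannot be negative.
    by_contra! h
    nlinarith [mul_nonneg_of_nonpos_of_nonpos h
      (by nlinarith [sq_nonneg a] : e * a ^ 2 - 3 * Real.pi ≤ 0)]
  refine ⟨hpos, ?_⟩
  by_contra! h
  nlinarith [mul_nonneg hpos.le (sub_nonneg.2 h)]

end

/-! ### The Weierstrass sigma function and its quasi-periodicity -/

noncomputable section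
open PeriodPair

variable {a : ℝ} (ha : 0 < a)

/-- The Weierstrass sigma function of the square lattice, for `|Re z|, |Im z| < a`. -/
def sqSigma (z : ℂ) : ℂ := z * Complex.exp (logSigma ha z)

theorem hasDerivAt_sqSigma {z : ℂ} (hz : z ∈ openSquare a) (h0 : z ≠ 0) :
    HasDerivAt (sqSigma ha) (sqZeta ha z * sqSigma ha z) z := by
  refine ((hasDerivAt_id z).mul (hasDerivAt_logSigma ha hz).cexp).congr_deriv ?_
  simp only [sqSigma, sqZeta, id]
  field_simp

theorem sqSigma_ne_zero {z : ℂ} (h0 : z ≠ 0) : sqSigma ha z ≠ 0 :=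
  mul_ne_zero h0 (Complex.exp_ne_zero _)

theorem sqSigma_neg {z : ℂ} (hz : z ∈ openSquare a) : sqSigma ha (-z) = -sqSigma ha z := by
  simp [sqSigma, logSigma_neg ha hz]

/-- The logarithmic derivatives agree, since `ζ` increases by `π/a` (Legendre). The constant `-1` is
found at `z = -a/2`, where `σ` is odd. -/
theorem sqSigma_add_period {z : ℂ} (hz : z ∈ openSquare a) (hz' : z + a ∈ openSquare a) :
    sqSigma ha (z + a)
      = -sqSigma ha z * Complex.exp ((Real.pi / a : ℝ) * (z + a / 2)) := by
  obtain ⟨ho, hp, hm⟩ := isOpen_preconnected_add_period ha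
  set h : ℂ := ((Real.pi / a : ℝ) : ℂ) with hh
  set k : ℂ → ℂ := fun w => sqSigma ha (w + a) * Complex.exp (-(h * (w + a / 2))) / sqSigma ha w
  have hd : ∀ w ∈ Ioo (-a) 0 ×ℂ Ioo (-a) a, HasDerivAt k 0 w := by
    intro w hw
    obtain ⟨h₁, h₂⟩ := add_period_aux' hw
    have hs := sqSigma_ne_zero ha h₁.2
    have d₁ := (hasDerivAt_sqSigma ha h₂.1 h₂.2).comp_add_const w (a : ℂ)
    have d₂ := ((((hasDerivAt_id w).add_const ((a : ℂ) / 2)).const_mul h).neg).cexp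
    refine ((d₁.mul d₂).div (hasDerivAt_sqSigma ha h₁.1 h₁.2) hs).congr_deriv ?_
    have := sqZeta_add_period ha h₁.1 h₂.1
    rw [two_mul_sqZeta_half, ← hh] at this
    rw [this]
    simp only [id, Pi.mul_apply, Pi.neg_apply]
    rw [div_eq_zero_iff]; left
    ring
  have hk := ho.eqOn_of_deriv_eq hp (f := k) (g := fun _ => -1)
    (fun w hw => (hd w hw).differentiableAt.differentiableWithinAt) (by fun_prop)
    (fun w hw => by rw [(hd w hw).deriv]; simp) hm (by
      simp only [k]
      rw [sqSigma_neg ha (half_mem_openSquare ha).1]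
      have := sqSigma_ne_zero ha (half_mem_openSquare ha).2
      rw [show -((a : ℂ) / 2) + a = a / 2 by ring]
      simp only [neg_add_cancel, mul_zero, neg_zero, Complex.exp_zero, mul_one]
      rw [div_neg, div_self this]) (add_period_aux hz hz')
  have hs := sqSigma_ne_zero ha (add_period_aux' (add_period_aux hz hz')).1.2
  simp only [k] at hk
  rw [div_eq_iff hs, Complex.exp_neg, ← div_eq_mul_inv, div_eq_iff (Complex.exp_ne_zero _)] at hk
  rw [hk]; ring

theorem norm_sqSigma_I_mul {z : ℂ} (hz : z ∈ openSquare a) :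
    ‖sqSigma ha (Complex.I * z)‖ = ‖sqSigma ha z‖ := by
  simp [sqSigma, logSigma_I_mul ha hz]

/-! ### Existence of the Green function -/

/-- The Green function up to a constant, for `|Re z|, |Im z| < a`. -/
def localGreen (z : ℂ) : ℝ :=
  -(1 / (2 * Real.pi)) * Real.log ‖sqSigma ha z‖ + ‖z‖ ^ 2 / (4 * a ^ 2)

theorem localGreen_I_mul {z : ℂ} (hz : z ∈ openSquare a) :
    localGreen ha (Complex.I * z) = localGreen ha z := by
  simp [localGreen, norm_sqSigma_I_mul ha hz]

theorem localGreen_neg {z : ℂ} (hz : z ∈ openSquare a) :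
    localGreen ha (-z) = localGreen ha z := by
  simp [localGreen, sqSigma_neg ha hz]

/-- The exponential factor of `σ` contributes `-(Re z + a/2)/(2a)`, and `|z|²/(4a²)` increases by
the opposite amount. -/
theorem localGreen_add {z : ℂ} (hz : z ∈ openSquare a) (hz' : z + a ∈ openSquare a) :
    localGreen ha (z + a) = localGreen ha z := by
  have h0 := (add_period_aux' (add_period_aux hz hz')).1.2
  have hs := norm_ne_zero_iff.2 (sqSigma_ne_zero ha h0)
  have e : ‖z + a‖ ^ 2 = ‖z‖ ^ 2 + 2 * a * z.re + a ^ 2 := by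
    simp only [Complex.sq_norm, Complex.normSq_apply]; simp; ring
  simp only [localGreen]
  rw [sqSigma_add_period ha hz hz', norm_mul, norm_neg, Complex.norm_exp,
    Real.log_mul hs (Real.exp_ne_zero _), Real.log_exp, e, Complex.re_ofReal_mul]
  have : (z + (a : ℂ) / 2).re = z.re + a / 2 := by simp
  rw [this]
  have := Real.pi_ne_zero
  field_simp
  ring

theorem localGreen_add_I {z : ℂ} (hz : z ∈ openSquare a)
    (hz' : z + Complex.I * a ∈ openSquare a) :
    localGreen ha (z + Complex.I * a) = localGreen ha z := by
  have h₁ : -(Complex.I * z) ∈ openSquare a := neg_mem_openSquare (I_mul_mem_openSquare hz)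
  have h₂ : -(Complex.I * z) + a ∈ openSquare a := by
    convert neg_mem_openSquare (I_mul_mem_openSquare hz') using 1
    linear_combination (a : ℂ) * Complex.I_sq
  have e₁ : z + Complex.I * a = Complex.I * (-(Complex.I * z) + a) := by
    linear_combination z * Complex.I_sq
  rw [e₁, localGreen_I_mul ha h₂, localGreen_add ha h₁ h₂,
    localGreen_neg ha (I_mul_mem_openSquare hz), localGreen_I_mul ha hz]

theorem abs_round_div_le {x : ℝ} (ha : 0 < a) (hx : |x| < a) :
    round (x / a) = 0 ∨ round (x / a) = 1 ∨ round (x / a) = -1 := by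
  have h := abs_sub_round (x / a)
  have hx' : |x / a| < 1 := by rwa [abs_div, abs_of_pos ha, div_lt_one ha]
  rw [abs_le] at h
  rw [abs_lt] at hx'
  have h₁ : (round (x / a) : ℝ) < 2 := by linarith
  have h₂ : (-2 : ℝ) < round (x / a) := by linarith
  have h₁' : round (x / a) < 2 := by exact_mod_cast h₁
  have h₂' : -2 < round (x / a) := by exact_mod_cast h₂
  omega

theorem abs_sub_round_mul_le (ha : 0 < a) (x : ℝ) : |x - round (x / a) * a| ≤ a / 2 := by
  have h := abs_sub_round (x / a)
  have e : x - round (x / a) * a = (x / a - round (x / a)) * a := by field_simp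
  rw [e, abs_mul, abs_of_pos ha]
  nlinarith

theorem localGreen_sub_re {z : ℂ} (hz : z ∈ openSquare a) :
    localGreen ha (z - round (z.re / a) * a) = localGreen ha z := by
  have hre := abs_sub_round_mul_le ha z.re
  have hm : z - round (z.re / a) * a ∈ openSquare a := by
    refine ⟨?_, ?_⟩
    · simp; linarith
    · simpa using hz.2
  rcases abs_round_div_le ha hz.1 with h | h | h <;> rw [h] at hm ⊢
  · simp
  · have := localGreen_add ha hm (by simpa using hz)
    rw [← this]; simp
  · have := localGreen_add ha hz (by simpa using hm)
    rw [← this]; simp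

theorem localGreen_sub_im {z : ℂ} (hz : z ∈ openSquare a) :
    localGreen ha (z - round (z.im / a) * (Complex.I * a)) = localGreen ha z := by
  have hre := abs_sub_round_mul_le ha z.im
  have hm : z - round (z.im / a) * (Complex.I * a) ∈ openSquare a := by
    refine ⟨?_, ?_⟩
    · simpa using hz.1
    · simp; linarith
  rcases abs_round_div_le ha hz.2 with h | h | h <;> rw [h] at hm ⊢
  · simp
  · have := localGreen_add_I ha hm (by simpa using hz)
    rw [← this]; simp
  · have := localGreen_add_I ha hz (by simpa using hm)
    rw [← this]; simp

/-- Translation into the closed period square. -/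
def latticeReduce (a : ℝ) (z : ℂ) : ℂ :=
  z - round (z.re / a) * a - round (z.im / a) * (Complex.I * a)

theorem latticeReduce_mem (ha : 0 < a) (z : ℂ) : latticeReduce a z ∈ openSquare a := by
  have h₁ := abs_sub_round_mul_le ha z.re
  have h₂ := abs_sub_round_mul_le ha z.im
  refine ⟨?_, ?_⟩
  · simp [latticeReduce]; linarith
  · simp [latticeReduce]; linarith

theorem latticeReduce_sub_mem (z : ℂ) : z - latticeReduce a z ∈ (squarePair a ha).lattice :=
  (mem_squarePair_lattice ha).2 ⟨round (z.re / a), round (z.im / a), by rw [latticeReduce]; ring⟩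

theorem latticeReduce_add (ha : 0 < a) (z : ℂ) : latticeReduce a (z + a) = latticeReduce a z := by
  have e : round ((z.re + a) / a) = round (z.re / a) + 1 := by
    rw [add_div, div_self ha.ne', round_add_one]
  simp only [latticeReduce, Complex.add_re, Complex.ofReal_re, e, Complex.add_im,
    Complex.ofReal_im, add_zero]
  push_cast; ring

theorem latticeReduce_add_I (ha : 0 < a) (z : ℂ) :
    latticeReduce a (z + Complex.I * a) = latticeReduce a z := by
  have e : round ((z.im + a) / a) = round (z.im / a) + 1 := by
    rw [add_div, div_self ha.ne', round_add_one]
  have e₁ : (z + Complex.I * a).re = z.re := by simp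
  have e₂ : (z + Complex.I * a).im = z.im + a := by simp
  simp only [latticeReduce, e₁, e₂, e]
  push_cast; ring

/-- In the double square each coordinate needs at most one period shift. Thus the periodic extension
agrees with `localGreen` on a whole neighbourhood of the closed cell, which gives regularity across
the cell's edges. -/
theorem localGreen_latticeReduce {z : ℂ} (hz : z ∈ openSquare a) :
    localGreen ha (latticeReduce a z) = localGreen ha z := by
  have hm : z - round (z.re / a) * a ∈ openSquare a := by
    have hre := abs_sub_round_mul_le ha z.re
    refine ⟨?_, ?_⟩
    · simp; linarith
    · simpa using hz.2
  have := localGreen_sub_im ha hm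
  rw [localGreen_sub_re ha hz] at this
  rw [← this]
  congr 1
  simp [latticeReduce]

theorem volume_openSquare {r : ℝ} (hr : 0 < r) : volume (openSquare r) = ENNReal.ofReal (4 * r ^ 2) := by
  have h := Complex.volume_preserving_equiv_real_prod.measure_preimage_equiv (Ioo (-r) r ×ˢ Ioo (-r) r)
  have e : Complex.measurableEquivRealProd ⁻¹' (Ioo (-r) r ×ˢ Ioo (-r) r) = openSquare r := by
    rw [openSquare_eq_reProdIm]
    ext z; simp [Complex.mem_reProdIm, Complex.measurableEquivRealProd]
  rw [e] at h
  rw [h, Measure.volume_eq_prod, Measure.prod_prod, Real.volume_Ioo, ← ENNReal.ofReal_mul (by linarith)]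
  congr 1; ring

theorem torusArea_square (ha : 0 < a) : torusArea a (Complex.I * a) = a ^ 2 := by
  rw [torusArea, periodDomain_eq_openSquare ha, Measure.real, volume_openSquare (half_pos ha),
    ENNReal.toReal_ofReal (by positivity)]
  ring

/-- The mean value of `localGreen` over the period square. -/
def localGreenMean : ℝ := (∫ z in openSquare (a / 2), localGreen ha z) / a ^ 2

/-- The Green function of the square torus. -/
def squareGreen (z : ℂ) : ℝ := localGreen ha (latticeReduce a z) - localGreenMean ha

theorem squareGreen_eq {z : ℂ} (hz : z ∈ openSquare a) :
    squareGreen ha z = localGreen ha z - localGreenMean ha := by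
  rw [squareGreen, localGreen_latticeReduce ha hz]

theorem log_norm_sqSigma {z : ℂ} (h0 : z ≠ 0) :
    Real.log ‖sqSigma ha z‖ = Real.log ‖z‖ + (logSigma ha z).re := by
  rw [sqSigma, norm_mul, Real.log_mul (norm_ne_zero_iff.2 h0) (by simp), Complex.norm_exp,
    Real.log_exp]

/-- In polar coordinates the integrand is `t log t`, which is continuous up to `0`. -/
theorem integrableOn_log_norm (r : ℝ) :
    IntegrableOn (fun z : ℂ => Real.log ‖z‖) (Metric.ball 0 r) := by
  rw [integrableOn_fun_norm_addHaar volume (f := Real.log)]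
  simp only [Complex.finrank_real_complex, Nat.add_one_sub_one, pow_one, smul_eq_mul]
  exact (Real.continuous_mul_log.integrableOn_Icc).mono_set Ioo_subset_Icc_self

theorem closedSquare_subset (ha : 0 < a) :
    Icc (-(a / 2)) (a / 2) ×ℂ Icc (-(a / 2)) (a / 2) ⊆ openSquare a := by
  rintro z ⟨h₁, h₂⟩
  simp only [mem_preimage, mem_Icc] at h₁ h₂
  constructor <;> rw [abs_lt] <;> constructor <;> linarith

theorem isCompact_closedSquare (r : ℝ) : IsCompact (Icc (-r) r ×ℂ Icc (-r) r) :=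
  isCompact_Icc.reProdIm isCompact_Icc

theorem openSquare_subset_closedSquare (r : ℝ) :
    openSquare r ⊆ Icc (-r) r ×ℂ Icc (-r) r := by
  rintro z ⟨h₁, h₂⟩
  rw [abs_lt] at h₁ h₂
  exact ⟨⟨h₁.1.le, h₁.2.le⟩, ⟨h₂.1.le, h₂.2.le⟩⟩

theorem continuousOn_logSigma : ContinuousOn (logSigma ha) (openSquare a) := fun _ hz =>
  (hasDerivAt_logSigma ha hz).continuousAt.continuousWithinAt

theorem integrableOn_localGreen : IntegrableOn (localGreen ha) (openSquare (a / 2)) := by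
  have hsub : openSquare (a / 2) ⊆ Metric.ball 0 (2 * a) := by
    rintro z ⟨h₁, h₂⟩
    rw [mem_ball_zero_iff]
    have := Complex.norm_le_abs_re_add_abs_im z
    linarith
  have h₁ : IntegrableOn (fun z : ℂ => Real.log ‖z‖) (openSquare (a / 2)) :=
    (integrableOn_log_norm _).mono_set hsub
  have hc : ContinuousOn (fun z => -(1 / (2 * Real.pi)) * (logSigma ha z).re
      + ‖z‖ ^ 2 / (4 * a ^ 2)) (Icc (-(a / 2)) (a / 2) ×ℂ Icc (-(a / 2)) (a / 2)) := by
    have := (continuousOn_logSigma ha).mono (closedSquare_subset ha)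
    fun_prop
  have h₂ := (hc.integrableOn_compact (μ := volume) (isCompact_closedSquare _)).mono_set
    (openSquare_subset_closedSquare _)
  refine ((h₁.const_mul (-(1 / (2 * Real.pi)))).add h₂).congr ?_
  have h0 : ∀ᵐ z : ℂ ∂(volume.restrict (openSquare (a / 2))), z ≠ 0 :=
    ae_restrict_of_ae (by simp [ae_iff, measure_singleton])
  filter_upwards [h0] with z hz
  simp only [Pi.add_apply, localGreen, log_norm_sqSigma ha hz]
  ring

theorem analyticAt_sqSigma {z : ℂ} (hz : z ∈ openSquare a) : AnalyticAt ℂ (sqSigma ha) z := by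
  have hd : DifferentiableOn ℂ (logSigma ha) (openSquare a) := fun w hw =>
    (hasDerivAt_logSigma ha hw).differentiableAt.differentiableWithinAt
  have := hd.analyticAt ((isOpen_openSquare a).mem_nhds hz)
  exact analyticAt_id.mul this.cexp

theorem laplacian_norm_sub_sq (l z : ℂ) :
    Laplacian.laplacian (fun w : ℂ => ‖w - l‖ ^ 2) z = 4 := by
  have h₁ : fderiv ℝ (fun w : ℂ => ‖w - l‖ ^ 2) = fun w => 2 • innerSL ℝ (w - l) := by
    ext1 w
    exact ((hasStrictFDerivAt_norm_sq (w - l)).hasFDerivAt.comp w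
      ((hasFDerivAt_id w).sub_const l)).fderiv
  have h₂ : fderiv ℝ (fun w : ℂ => (2 : ℕ) • innerSL ℝ (w - l)) z = (2 : ℕ) • innerSL ℝ := by
    have := (((innerSL ℝ (E := ℂ)).hasFDerivAt (x := z - l)).comp z
      ((hasFDerivAt_id z).sub_const l)).const_smul (2 : ℕ)
    exact this.fderiv
  rw [InnerProductSpace.laplacian_eq_iteratedFDeriv_complexPlane]
  simp only [iteratedFDeriv_two_apply, h₁, h₂]
  have e (v : ℂ) : innerSL ℝ v v = ‖v‖ ^ 2 := real_inner_self_eq_norm_sq v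
  simp [e]
  norm_num

theorem laplacian_smul_add_smul_sub_const {f g : ℂ → ℝ} {c d k : ℝ} {z : ℂ}
    (hf : ContDiffAt ℝ 2 f z) (hg : ContDiffAt ℝ 2 g z) :
    (Laplacian.laplacian (c • f + d • g - fun _ => k : ℂ → ℝ) : ℂ → ℝ) z
      = c * (Laplacian.laplacian f : ℂ → ℝ) z + d * (Laplacian.laplacian g : ℂ → ℝ) z := by
  have hf' : ContDiffAt ℝ 2 (c • f) z := hf.const_smul c
  have hg' : ContDiffAt ℝ 2 (d • g) z := hg.const_smul d
  have hfg : ContDiffAt ℝ 2 (c • f + d • g) z := hf'.add hg'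
  rw [hfg.laplacian_sub contDiffAt_const, hf'.laplacian_add hg',
    InnerProductSpace.laplacian_smul _ hf, InnerProductSpace.laplacian_smul _ hg,
    InnerProductSpace.laplacian_const]
  simp

theorem squareGreen_add_of_mem {l : ℂ} (hl : l ∈ (squarePair a ha).lattice) (z : ℂ) :
    squareGreen ha (z + l) = squareGreen ha z := by
  have p₁ : Function.Periodic (squareGreen ha) a := fun z => by
    rw [squareGreen, latticeReduce_add ha, squareGreen]
  have p₂ : Function.Periodic (squareGreen ha) (Complex.I * a) := fun z => by
    rw [squareGreen, latticeReduce_add_I ha, squareGreen]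
  obtain ⟨m, n, rfl⟩ := (mem_squarePair_lattice ha).1 hl
  rw [← add_assoc, p₂.int_mul n, p₁.int_mul m]

theorem IsTorusGreen.add_of_mem {G : ℂ → ℝ} (hG : IsTorusGreen a (Complex.I * a) G) {l : ℂ}
    (hl : l ∈ (squarePair a ha).lattice) (z : ℂ) : G (z + l) = G z := by
  have p₁ : Function.Periodic G a := hG.periodic₁
  have p₂ : Function.Periodic G (Complex.I * a) := hG.periodic₂
  obtain ⟨m, n, rfl⟩ := (mem_squarePair_lattice ha).1 hl
  rw [← add_assoc, p₂.int_mul n, p₁.int_mul m]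

/-- The translation chosen at `z` is kept fixed nearby, which avoids the jumps of the rounding in
`latticeReduce`. -/
theorem squareGreen_eventuallyEq (z : ℂ) : squareGreen ha =ᶠ[𝓝 z]
    (((-(1 / (2 * Real.pi))) • fun w => Real.log ‖sqSigma ha (w - (z - latticeReduce a z))‖)
      + (1 / (4 * a ^ 2)) • fun w : ℂ => ‖w - (z - latticeReduce a z)‖ ^ 2)
      - fun _ => localGreenMean ha := by
  have hl := latticeReduce_sub_mem ha z
  set l := z - latticeReduce a z
  have hc : ContinuousAt (fun w => w - l) z := by fun_prop
  have hm : z - l ∈ openSquare a := by simpa [l] using latticeReduce_mem ha z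
  filter_upwards [hc.eventually_mem ((isOpen_openSquare a).mem_nhds hm)] with w hw
  rw [← squareGreen_add_of_mem ha (neg_mem hl), ← sub_eq_add_neg, squareGreen_eq ha hw, localGreen]
  simp
  ring

theorem harmonicAt_log_sqSigma {z : ℂ} (hz : z ∉ periodLattice a (Complex.I * a)) :
    InnerProductSpace.HarmonicAt
      (fun w => Real.log ‖sqSigma ha (w - (z - latticeReduce a z))‖) z := by
  rw [mem_periodLattice_iff ha] at hz
  have h0 : latticeReduce a z ≠ 0 := fun h => hz (by
    simpa [h] using latticeReduce_sub_mem ha z)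
  have hσ := analyticAt_sqSigma ha (latticeReduce_mem ha z)
  refine AnalyticAt.harmonicAt_log_norm
    (f := fun w => sqSigma ha (w - (z - latticeReduce a z))) ?_ ?_
  · exact hσ.comp_of_eq (f := fun w => w - (z - latticeReduce a z)) (by fun_prop) (by simp)
  · simpa using sqSigma_ne_zero ha h0

/-- `log |σ|` is harmonic off the lattice, and the quadratic term has Laplacian `4/(4a²)`, the
reciprocal of the area. -/
theorem isTorusGreen_squareGreen : IsTorusGreen a (Complex.I * a) (squareGreen ha) where
  periodic₁ := squareGreen_add_of_mem ha (ofReal_mem_lattice ha)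
  periodic₂ := squareGreen_add_of_mem ha (I_mul_ofReal_mem_lattice ha)
  contDiffAt z hz := by
    have hh := harmonicAt_log_sqSigma ha hz
    refine ContDiffAt.congr_of_eventuallyEq ?_ (squareGreen_eventuallyEq ha z)
    have h₁ := hh.1
    have h₂ : ContDiffAt ℝ 2 (fun w : ℂ => ‖w - (z - latticeReduce a z)‖ ^ 2) z :=
      (contDiffAt_id.sub contDiffAt_const).norm_sq ℝ
    exact ((h₁.const_smul (-(1 / (2 * Real.pi)))).add (h₂.const_smul (1 / (4 * a ^ 2)))).sub
      contDiffAt_const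
  laplacian_eq z hz := by
    have hh := harmonicAt_log_sqSigma ha hz
    rw [InnerProductSpace.laplacian_congr_nhds (squareGreen_eventuallyEq ha z) |>.self_of_nhds,
      torusArea_square ha]
    have h₁ := hh.1
    have h₂ : ContDiffAt ℝ 2 (fun w : ℂ => ‖w - (z - latticeReduce a z)‖ ^ 2) z :=
      (contDiffAt_id.sub contDiffAt_const).norm_sq ℝ
    rw [laplacian_smul_add_smul_sub_const h₁ h₂, hh.2.self_of_nhds, laplacian_norm_sub_sq]
    rw [Pi.zero_apply, mul_zero, zero_add]
    field_simp
  singularity := by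
    have hc : ContinuousAt (fun z => -(1 / (2 * Real.pi)) * (logSigma ha z).re
      + ‖z‖ ^ 2 / (4 * a ^ 2) - localGreenMean ha) 0 := by
      have := (hasDerivAt_logSigma ha (zero_mem_openSquare ha)).continuousAt
      fun_prop
    obtain ⟨B, hb⟩ : ∃ B, ∀ᶠ z in 𝓝 (0 : ℂ), ‖-(1 / (2 * Real.pi)) * (logSigma ha z).re
      + ‖z‖ ^ 2 / (4 * a ^ 2) - localGreenMean ha‖ ≤ B :=
      ⟨_, hc.norm.tendsto.eventually_le_const (u := ‖-(1 / (2 * Real.pi)) * (logSigma ha 0).re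
      + ‖(0 : ℂ)‖ ^ 2 / (4 * a ^ 2) - localGreenMean ha‖ + 1) (lt_add_one _)⟩
    refine ⟨B, ?_⟩
    · filter_upwards [mem_nhdsWithin_of_mem_nhds hb, self_mem_nhdsWithin,
        mem_nhdsWithin_of_mem_nhds ((isOpen_openSquare a).mem_nhds (zero_mem_openSquare ha))]
        with z h₁ h₂ h₃
      rw [squareGreen_eq ha h₃, localGreen, log_norm_sqSigma ha h₂]
      refine le_trans (le_of_eq ?_) h₁
      rw [Real.norm_eq_abs]
      congr 1
      ring
  integrableOn := by
    rw [periodDomain_eq_openSquare ha]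
    have h := (integrableOn_localGreen ha).sub (integrableOn_const (C := localGreenMean ha)
      (s := openSquare (a / 2)) (μ := volume) (by rw [volume_openSquare (half_pos ha)]; exact ENNReal.ofReal_ne_top))
    refine h.congr_fun (fun z hz => ?_) (isOpen_openSquare _).measurableSet
    rw [squareGreen_eq ha (closedSquare_subset ha (openSquare_subset_closedSquare _ hz))]
    rfl
  mean_zero := by
    rw [periodDomain_eq_openSquare ha]
    have e : ∫ z in openSquare (a / 2), squareGreen ha z
        = ∫ z in openSquare (a / 2), (localGreen ha z - localGreenMean ha) :=
      setIntegral_congr_fun (isOpen_openSquare _).measurableSet fun z hz =>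
        squareGreen_eq ha (closedSquare_subset ha (openSquare_subset_closedSquare _ hz))
    rw [e, integral_sub (integrableOn_localGreen ha)
      (integrableOn_const (by rw [volume_openSquare (half_pos ha)]; exact ENNReal.ofReal_ne_top)), setIntegral_const,
      Measure.real, volume_openSquare (half_pos ha), ENNReal.toReal_ofReal (by positivity),
      localGreenMean]
    simp only [smul_eq_mul]
    field_simp
    ring

theorem isHStar_logSigma : IsHStar a (Complex.I * a) (squareGreen ha)
    (fun z => -(1 / (2 * Real.pi) : ℝ) * logSigma ha z - localGreenMean ha) where
  holomorphic := by
    rw [periodDomain_two_eq_openSquare ha]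
    have hd : DifferentiableOn ℂ (logSigma ha) (openSquare a) := fun w hw =>
      (hasDerivAt_logSigma ha hw).differentiableAt.differentiableWithinAt
    fun_prop
  re_eq z hz h0 := by
    rw [periodDomain_two_eq_openSquare ha] at hz
    rw [squareGreen_eq ha hz, localGreen, log_norm_sqSigma ha h0, torusArea_square ha,
      Complex.sub_re, ← Complex.ofReal_neg, Complex.re_ofReal_mul, Complex.ofReal_re]
    ring

end

noncomputable section
open PeriodPair ComplexConjugate

/-! ### Logarithmic singularities -/

/-- Near `z`, the function `f` is `n log |w - z|` plus the logarithm of the modulus of a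
nonvanishing analytic function. -/
def HasLogOrder (f : ℂ → ℝ) (z : ℂ) (n : ℝ) : Prop :=
  ∃ k : ℂ → ℂ, AnalyticAt ℂ k z ∧ k z ≠ 0 ∧
    ∀ᶠ w in 𝓝[≠] z, f w = Real.log ‖k w‖ + n * Real.log ‖w - z‖

namespace HasLogOrder

variable {f g : ℂ → ℝ} {z : ℂ} {m n : ℝ}

theorem congr (hf : HasLogOrder f z n) (h : ∀ᶠ w in 𝓝[≠] z, g w = f w) : HasLogOrder g z n := by
  obtain ⟨k, hk, h0, hf⟩ := hf
  exact ⟨k, hk, h0, by filter_upwards [hf, h] with w h₁ h₂; rw [h₂, h₁]⟩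

theorem eventually_ne {k : ℂ → ℂ} (hk : AnalyticAt ℂ k z) (h0 : k z ≠ 0) :
    ∀ᶠ w in 𝓝[≠] z, ‖k w‖ ≠ 0 :=
  mem_nhdsWithin_of_mem_nhds
    ((hk.continuousAt.eventually_ne h0).mono fun _ h => norm_ne_zero_iff.2 h)

theorem add (hf : HasLogOrder f z m) (hg : HasLogOrder g z n) :
    HasLogOrder (fun w => f w + g w) z (m + n) := by
  obtain ⟨k, hk, hk0, hf⟩ := hf
  obtain ⟨l, hl, hl0, hg⟩ := hg
  refine ⟨fun w => k w * l w, hk.mul hl, mul_ne_zero hk0 hl0, ?_⟩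
  filter_upwards [hf, hg, eventually_ne hk hk0, eventually_ne hl hl0] with w h₁ h₂ h₃ h₄
  rw [h₁, h₂, norm_mul, Real.log_mul h₃ h₄]
  ring

theorem neg (hf : HasLogOrder f z m) : HasLogOrder (fun w => -f w) z (-m) := by
  obtain ⟨k, hk, hk0, hf⟩ := hf
  refine ⟨fun w => (k w)⁻¹, hk.inv hk0, inv_ne_zero hk0, ?_⟩
  filter_upwards [hf] with w h₁
  rw [h₁, norm_inv, Real.log_inv]
  ring

theorem sub (hf : HasLogOrder f z m) (hg : HasLogOrder g z n) :
    HasLogOrder (fun w => f w - g w) z (m - n) := by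
  simpa [sub_eq_add_neg] using hf.add hg.neg

theorem re {d : ℂ → ℂ} (hd : AnalyticAt ℂ d z) : HasLogOrder (fun w => (d w).re) z 0 :=
  ⟨fun w => Complex.exp (d w), hd.cexp, Complex.exp_ne_zero _,
    Eventually.of_forall fun w => by simp [Complex.norm_exp]⟩

theorem log_norm {k : ℂ → ℂ} (hk : AnalyticAt ℂ k z) (h0 : k z ≠ 0) :
    HasLogOrder (fun w => Real.log ‖k w‖) z 0 :=
  ⟨k, hk, h0, by simp⟩

theorem log_norm_sub : HasLogOrder (fun w => Real.log ‖w - z‖) z 1 :=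
  ⟨fun _ => 1, analyticAt_const, one_ne_zero, by simp⟩

theorem comp_sub {s : ℂ} (hf : HasLogOrder f (z - s) n) :
    HasLogOrder (fun w => f (w - s)) z n := by
  obtain ⟨k, hk, h0, hf⟩ := hf
  refine ⟨fun w => k (w - s), hk.comp_of_eq (f := fun w => w - s) (by fun_prop) rfl, h0, ?_⟩
  rw [eventually_nhdsWithin_iff] at hf ⊢
  have hc : ContinuousAt (fun w => w - s) z := by fun_prop
  filter_upwards [hc.eventually hf] with w hw hwz
  rw [hw (by simpa using hwz)]
  simp

end HasLogOrder

theorem PeriodPair.exists_eq_const_of_hasLogOrder (L : PeriodPair) {Φ : ℂ → ℝ}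
    (hper : ∀ z, ∀ l ∈ L.lattice, Φ (z + l) = Φ z) (hloc : ∀ z, HasLogOrder Φ z 0) :
    ∃ C, ∀ z, Φ =ᶠ[𝓝[≠] z] fun _ => C :=
  L.exists_eq_const_of_log_norm hper fun z => by
    obtain ⟨k, hk, h0, h⟩ := hloc z
    exact ⟨k, hk, h0, by simpa using h⟩

variable {a : ℝ} (ha : 0 < a) {G : ℂ → ℝ} {Hs : ℂ → ℂ}

theorem IsHStar.re_eq_square (ha : 0 < a) (hH : IsHStar a (Complex.I * a) G Hs) {z : ℂ}
    (hz : z ∈ openSquare a) (h0 : z ≠ 0) :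
    (Hs z).re = G z + 1 / (2 * Real.pi) * Real.log ‖z‖ - ‖z‖ ^ 2 / (4 * a ^ 2) := by
  rw [hH.re_eq z (by rwa [periodDomain_two_eq_openSquare ha]) h0, torusArea_square ha]

theorem IsHStar.differentiableOn_openSquare (ha : 0 < a) (hH : IsHStar a (Complex.I * a) G Hs) :
    DifferentiableOn ℂ Hs (openSquare a) := by
  have := hH.holomorphic
  rwa [periodDomain_two_eq_openSquare ha] at this

theorem IsHStar.analyticAt (ha : 0 < a) (hH : IsHStar a (Complex.I * a) G Hs) {z : ℂ}
    (hz : z ∈ openSquare a) : AnalyticAt ℂ Hs z :=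
  (hH.differentiableOn_openSquare ha).analyticAt ((isOpen_openSquare a).mem_nhds hz)

/-- Near `z`, the point `w - (z - latticeReduce a z)` lies in the double period square. -/
theorem eventually_sub_mem_openSquare (ha : 0 < a) (z : ℂ) :
    ∀ᶠ w in 𝓝[≠] z, w - (z - latticeReduce a z) ∈ openSquare a ∧
      w - (z - latticeReduce a z) ≠ 0 := by
  have hm : z - (z - latticeReduce a z) ∈ openSquare a := by simpa using latticeReduce_mem ha z
  have hc : ContinuousAt (fun w => w - (z - latticeReduce a z)) z := by fun_prop
  filter_upwards [(squarePair a ha).eventually_notMem_lattice z,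
    mem_nhdsWithin_of_mem_nhds (hc.eventually_mem ((isOpen_openSquare a).mem_nhds hm))]
    with w h₁ h₂
  refine ⟨h₂, fun h => h₁ ?_⟩
  rw [sub_eq_zero.1 h]
  exact latticeReduce_sub_mem ha z

theorem deriv_eq_zero_of_re_eq_const {d : ℂ → ℂ} {d' z : ℂ} {C : ℝ} (hd : HasDerivAt d d' z)
    (h : ∀ᶠ w in 𝓝 z, (d w).re = C) : d' = 0 := by
  have h₁ := Complex.reCLM.hasFDerivAt.comp z (hd.hasFDerivAt.restrictScalars ℝ)
  have h₂ : HasFDerivAt (Complex.reCLM ∘ d) (0 : ℂ →L[ℝ] ℝ) z :=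
    (hasFDerivAt_const C z).congr_of_eventuallyEq h
  have h₃ := h₁.unique h₂
  have e₁ := congrArg (fun T : ℂ →L[ℝ] ℝ => T 1) h₃
  have e₂ := congrArg (fun T : ℂ →L[ℝ] ℝ => T Complex.I) h₃
  simp at e₁ e₂
  exact Complex.ext e₁ e₂

/-- Uniqueness of `H*` up to an additive constant. -/
theorem IsHStar.exists_eq (hG : IsTorusGreen a (Complex.I * a) G)
    (hH : IsHStar a (Complex.I * a) G Hs) :
    ∃ C : ℂ, ∀ z ∈ openSquare a, Hs z = C - (1 / (2 * Real.pi) : ℝ) * logSigma ha z := by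
  set Hs₀ : ℂ → ℂ := fun z => -(1 / (2 * Real.pi) : ℝ) * logSigma ha z - localGreenMean ha with hHs
  have hH₀ := isHStar_logSigma ha
  have hG₀ := isTorusGreen_squareGreen ha
  -- The logarithmic and quadratic terms of the two Green functions cancel, so locally their
  -- difference is the real part of a holomorphic function, and Liouville applies.
  obtain ⟨C, hC⟩ := (squarePair a ha).exists_eq_const_of_hasLogOrder
    (Φ := fun z => G z - squareGreen ha z)
    (fun z l hl => by rw [hG.add_of_mem ha hl, hG₀.add_of_mem ha hl]) (fun z => by
      have hl := latticeReduce_sub_mem ha z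
      have hm := latticeReduce_mem ha z
      have hev := eventually_sub_mem_openSquare ha z
      set l := z - latticeReduce a z with hl'
      have hzl : z - l = latticeReduce a z := by simp [hl']
      have h₁ : AnalyticAt ℂ (fun w => Hs (w - l) - Hs₀ (w - l)) z := by
        refine ((hH.analyticAt ha hm).sub (hH₀.analyticAt ha hm)).comp_of_eq
          (f := fun w => w - l) (by fun_prop) hzl
      refine (HasLogOrder.re h₁).congr ?_
      filter_upwards [hev] with w hw
      rw [← hG.add_of_mem ha (neg_mem hl), ← hG₀.add_of_mem ha (neg_mem hl), ← sub_eq_add_neg,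
        Complex.sub_re, hH.re_eq_square ha hw.1 hw.2, hH₀.re_eq_square ha hw.1 hw.2]
      ring)
  have hd : DifferentiableOn ℂ (fun w => Hs w - Hs₀ w) (openSquare a) :=
    (hH.differentiableOn_openSquare ha).sub (hH₀.differentiableOn_openSquare ha)
  have hne : ∀ z ∈ openSquare a, ∀ᶠ w in 𝓝[≠] z, (Hs w - Hs₀ w).re = C := by
    intro z hz
    filter_upwards [hC z, (squarePair a ha).eventually_notMem_lattice z,
      mem_nhdsWithin_of_mem_nhds ((isOpen_openSquare a).mem_nhds hz)] with w h₁ h₂ h₃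
    have h0 : w ≠ 0 := by rintro rfl; exact h₂ (zero_mem _)
    rw [Complex.sub_re, hH.re_eq_square ha h₃ h0, hH₀.re_eq_square ha h₃ h0]
    linear_combination h₁
  have heq : ∀ z ∈ openSquare a, (Hs z - Hs₀ z).re = C := by
    intro z hz
    have hc := (hd.analyticAt ((isOpen_openSquare a).mem_nhds hz)).continuousAt
    have hc' : ContinuousAt (fun w => (Hs w - Hs₀ w).re) z :=
      Complex.continuous_re.continuousAt.comp hc
    exact tendsto_nhds_unique_of_eventuallyEq (hc'.tendsto.mono_left nhdsWithin_le_nhds)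
      tendsto_const_nhds (l := 𝓝[≠] z) (hne z hz)
  have hconst := (isOpen_openSquare a).eqOn_of_deriv_eq (convex_openSquare a).isPreconnected
    (f := fun w => Hs w - Hs₀ w) (g := fun _ => Hs 0 - Hs₀ 0) hd (by fun_prop) (fun z hz => by
      have h := (hd.differentiableAt ((isOpen_openSquare a).mem_nhds hz)).hasDerivAt
      rw [deriv_eq_zero_of_re_eq_const h (by
        filter_upwards [(isOpen_openSquare a).mem_nhds hz] with w hw using heq w hw)]
      simp) (zero_mem_openSquare ha) rfl
  refine ⟨Hs 0 - Hs₀ 0 - localGreenMean ha, fun z hz => ?_⟩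
  have := hconst hz
  simp only [hHs] at this ⊢
  linear_combination this

/-! ### The Green function and the Weierstrass function -/

theorem norm_sub_sq_eq (w l : ℂ) :
    ‖w - l‖ ^ 2 = ‖w‖ ^ 2 - 2 * (w * conj l).re + ‖l‖ ^ 2 := by
  simp only [Complex.sq_norm, Complex.normSq_apply]; simp; ring

/-- The squares `|w|²` cancel, and what remains is the real part of an affine function of `w`. -/
theorem hasLogOrder_norm_sub_sq (c : ℝ) (l z : ℂ) :
    HasLogOrder (fun w => c * ‖w - l‖ ^ 2 - c * ‖w‖ ^ 2) z 0 := by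
  have : AnalyticAt ℂ (fun w => (c : ℂ) * (-2 * (w * conj l) + (‖l‖ ^ 2 : ℝ))) z := by fun_prop
  refine (HasLogOrder.re this).congr (Eventually.of_forall fun w => ?_)
  rw [norm_sub_sq_eq, Complex.re_ofReal_mul, Complex.add_re, Complex.ofReal_re]
  simp
  ring

open Classical in
-- Subtracting the quadratic term makes `4πG` harmonic off the lattice, at the cost of periodicity.
-- In a difference of two translates this cost is only a harmonic affine function.
theorem hasLogOrder_green (hG : IsTorusGreen a (Complex.I * a) G)
    (hH : IsHStar a (Complex.I * a) G Hs) (z : ℂ) :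
    HasLogOrder (fun w => 4 * Real.pi * G w - Real.pi / a ^ 2 * ‖w‖ ^ 2) z
      (if z ∈ (squarePair a ha).lattice then -2 else 0) := by
  have hl := latticeReduce_sub_mem ha z
  have hm := latticeReduce_mem ha z
  have hev := eventually_sub_mem_openSquare ha z
  set l := z - latticeReduce a z with hl'
  have hzl : z - l = latticeReduce a z := by simp [hl']
  have h₁ : AnalyticAt ℂ (fun w => (4 * Real.pi : ℝ) * Hs (w - l)) z :=
    analyticAt_const.mul ((hH.analyticAt ha hm).comp_of_eq (f := fun w => w - l) (by fun_prop) hzl)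
  have h₂ := hasLogOrder_norm_sub_sq (Real.pi / a ^ 2) l z
  have h₃ : HasLogOrder (fun w => Real.log ‖w - l‖) z
      (if z ∈ (squarePair a ha).lattice then 1 else 0) := by
    split_ifs with h
    · have : latticeReduce a z = 0 := eq_zero_of_mem_lattice ha (by
        have := sub_mem h hl; rwa [hzl] at this) hm
      have : l = z := by simp [hl', this]
      rw [this]
      exact HasLogOrder.log_norm_sub
    · refine HasLogOrder.log_norm (k := fun w => w - l) (by fun_prop) fun h' => h ?_
      rw [sub_eq_zero.1 h']; exact hl
  have := ((HasLogOrder.re h₁).sub (h₃.add h₃)).add h₂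
  have e : (0 - ((if z ∈ (squarePair a ha).lattice then (1 : ℝ) else 0)
      + if z ∈ (squarePair a ha).lattice then 1 else 0) + 0)
      = if z ∈ (squarePair a ha).lattice then -2 else 0 := by split_ifs <;> norm_num
  rw [e] at this
  refine this.congr ?_
  filter_upwards [hev] with w hw
  rw [← hG.add_of_mem ha (neg_mem hl), ← sub_eq_add_neg, Complex.re_ofReal_mul,
    hH.re_eq_square ha hw.1 hw.2]
  have := Real.pi_ne_zero
  have := ha.ne'
  field_simp
  ring

open Classical in
theorem PeriodPair.hasLogOrder_weierstrassP {L : PeriodPair} {ω : ℂ} (h2 : 2 * ω ∈ L.lattice)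
    (hω : ω ∉ L.lattice) (z : ℂ) :
    HasLogOrder (fun w => Real.log ‖℘[L] w - ℘[L] ω‖) z
      ((if z ∈ L.lattice then -2 else 0) - (if z - ω ∈ L.lattice then -2 else 0)) := by
  have two : HasLogOrder (fun w => Real.log ‖w - z‖ + Real.log ‖w - z‖) z (1 + 1) :=
    HasLogOrder.log_norm_sub.add HasLogOrder.log_norm_sub
  by_cases hz : z ∈ L.lattice
  · have hz' : z - ω ∉ L.lattice := fun h => hω (by simpa using sub_mem hz h)
    rw [if_pos hz, if_neg hz']
    have hp : AnalyticAt ℂ (L.weierstrassPExcept z) z := L.analyticAt_weierstrassPExcept z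
    have hk := HasLogOrder.log_norm (z := z)
      (k := fun w => (w - z) ^ 2 * (L.weierstrassPExcept z w - 1 / z ^ 2 - ℘[L] ω) + 1)
      (by fun_prop) (by simp)
    have := hk.sub two
    norm_num at this ⊢
    refine this.congr ?_
    filter_upwards [self_mem_nhdsWithin, L.eventually_notMem_lattice z,
      HasLogOrder.eventually_ne (z := z)
        (k := fun w => (w - z) ^ 2 * (L.weierstrassPExcept z w - 1 / z ^ 2 - ℘[L] ω) + 1)
        (by fun_prop) (by simp)] with w hw hw' hne
    have hwz : w - z ≠ 0 := sub_ne_zero.2 hw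
    have e : ℘[L] w - ℘[L] ω = ((w - z) ^ 2 * (L.weierstrassPExcept z w - 1 / z ^ 2 - ℘[L] ω) + 1)
        / ((w - z) * (w - z)) := by
      rw [L.weierstrassP_eq_add hz]
      field_simp; ring
    rw [e, norm_div, Real.log_div hne (norm_ne_zero_iff.2 (mul_ne_zero hwz hwz)), norm_mul,
      Real.log_mul (norm_ne_zero_iff.2 hwz) (norm_ne_zero_iff.2 hwz)]
    simp
  · rw [if_neg hz]
    by_cases hz' : z - ω ∈ L.lattice
    · rw [if_pos hz']
      obtain ⟨h, hh, h0, he⟩ := exists_weierstrassP_sub_half_ne h2 hω hz'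
      have := (HasLogOrder.log_norm hh h0).add two
      norm_num at this ⊢
      refine this.congr ?_
      filter_upwards [self_mem_nhdsWithin, mem_nhdsWithin_of_mem_nhds he,
        HasLogOrder.eventually_ne hh h0] with w hw hw' hne
      have hwz : ‖w - z‖ ≠ 0 := norm_ne_zero_iff.2 (sub_ne_zero.2 hw)
      rw [hw', norm_mul, norm_pow, Real.log_mul (pow_ne_zero 2 hwz) hne, Real.log_pow]
      push_cast
      ring
    · rw [if_neg hz', sub_zero]
      exact HasLogOrder.log_norm ((L.analyticOnNhd_weierstrassP z hz).sub analyticAt_const)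
        (sub_ne_zero.2 (weierstrassP_ne_half h2 hω hz hz'))

/-- `log |℘ - ℘(ω)| = 4π G - 4π G(· - ω) + C` for a half-period `ω`. -/
theorem exists_log_weierstrassP_eq (hG : IsTorusGreen a (Complex.I * a) G)
    (hH : IsHStar a (Complex.I * a) G Hs) {ω : ℂ} (h2 : 2 * ω ∈ (squarePair a ha).lattice)
    (hω : ω ∉ (squarePair a ha).lattice) :
    ∃ C : ℝ, ∀ z, ∀ᶠ w in 𝓝[≠] z,
      Real.log ‖℘[squarePair a ha] w - ℘[squarePair a ha] ω‖
        = 4 * Real.pi * G w - 4 * Real.pi * G (w - ω) + C := by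
  classical
  obtain ⟨C, hC⟩ := (squarePair a ha).exists_eq_const_of_hasLogOrder
    (Φ := fun w => Real.log ‖℘[squarePair a ha] w - ℘[squarePair a ha] ω‖
      - 4 * Real.pi * G w + 4 * Real.pi * G (w - ω))
    (fun z l hl => by
      rw [weierstrassP_add_of_mem hl, hG.add_of_mem ha hl, add_sub_right_comm, hG.add_of_mem ha hl])
    (fun z => by
      have h₁ := hasLogOrder_weierstrassP h2 hω z
      have h₂ := hasLogOrder_green ha hG hH z
      have h₃ := (hasLogOrder_green ha hG hH (z - ω)).comp_sub
      have h₄ := hasLogOrder_norm_sub_sq (Real.pi / a ^ 2) ω z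
      -- The orders at the points of the lattice and at those congruent to `ω` cancel, leaving order
      -- `0` everywhere.
      have := ((h₁.sub h₂).add h₃).add h₄
      ring_nf at this
      refine this.congr (Eventually.of_forall fun w => ?_)
      ring)
  refine ⟨C, fun z => ?_⟩
  filter_upwards [hC z] with w hw
  linear_combination hw

end

/-! ### The function `𝓗` in terms of `℘` -/

noncomputable section
open PeriodPair ComplexConjugate

variable {a : ℝ} (ha : 0 < a) {G : ℂ → ℝ} {Hs : ℂ → ℂ}

theorem sub_mem_openSquare {z w : ℂ} (hz : z ∈ openSquare (a / 2)) (hw : w ∈ openSquare (a / 2)) :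
    z - w ∈ openSquare a := by
  obtain ⟨h₁, h₂⟩ := hz
  obtain ⟨h₃, h₄⟩ := hw
  refine ⟨?_, ?_⟩
  · rw [Complex.sub_re]; exact (abs_sub _ _).trans_lt (by linarith)
  · rw [Complex.sub_im]; exact (abs_sub _ _).trans_lt (by linarith)

/-- A concentration point `τ` and two vortices `p₁`, `p₃` in the period square which are congruent
to `ω + τ` and `(a + i a) / 2 + τ`, where `ω` is a half-period with `℘(ω) = ε = ± e`. -/
structure IsVortexPair (ω τ p₁ p₃ : ℂ) (ε : ℝ) : Prop where
  two_mul_mem : 2 * ω ∈ (squarePair a ha).lattice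
  notMem : ω ∉ (squarePair a ha).lattice
  weierstrassP_eq : ℘[squarePair a ha] ω = ε
  sq_eq : ε ^ 2 = halfValue ha ^ 2
  τ_mem : τ ∈ openSquare (a / 2)
  p₁_mem : p₁ ∈ openSquare (a / 2)
  p₃_mem : p₃ ∈ openSquare (a / 2)
  p₁_congr : p₁ - (ω + τ) ∈ (squarePair a ha).lattice
  p₃_congr : p₃ - ((a + Complex.I * a) / 2 + τ) ∈ (squarePair a ha).lattice

/-- The function `𝓗` of the configuration with vortices `τ`, `p₁`, `p₃` of multiplicity two. -/
def vortexH (a : ℝ) (τ p₁ p₃ : ℂ) (Hs : ℂ → ℂ) (z : ℂ) : ℂ :=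
  (z - p₁) ^ 2 * (z - p₃) ^ 2 * Complex.exp
    ((8 * Real.pi : ℝ) * Hs (z - τ) - (4 * Real.pi : ℝ) * Hs (z - p₁)
      - (4 * Real.pi : ℝ) * Hs (z - p₃)
      + (Real.pi / a ^ 2 : ℝ) * ((2 * ‖τ‖ ^ 2 - ‖p₁‖ ^ 2 - ‖p₃‖ ^ 2 : ℝ)
        + 2 * (z * conj p₁) + 2 * (z * conj p₃) - 4 * (z * conj τ)))

/-- For `n = 2` the coefficient of `H*(z - τ)` is `12π - 4π = 8π`; the vortex of multiplicity zero
contributes trivial factors. -/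
theorem curlyH_squareConfig {n₁ n₂ : ℕ} (ha : 0 < a) (τ : ℂ) (p : Fin 3 → ℂ) (Hs : ℂ → ℂ)
    (hn : (n₁ = 2 ∧ n₂ = 0) ∨ (n₁ = 0 ∧ n₂ = 2)) :
    (squareConfig a n₁ n₂ τ p).curlyH Hs
      = vortexH a τ (if n₁ = 2 then p 0 else p 1) (p 2) Hs := by
  funext z
  have hA : (squareConfig a n₁ n₂ τ p).area = a ^ 2 := torusArea_square ha
  rw [VortexConfig.curlyH, hA]
  change (∏ j : Fin 3, (z - p j) ^ (![n₁, n₂, 2] : Fin 3 → ℕ) j)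
    * Complex.exp (4 * Real.pi * ((2 : ℕ) + 1) * Hs (z - τ)
        + Real.pi * ((2 : ℕ) + 1) / (a ^ 2 : ℝ) * (‖τ‖ ^ 2 : ℝ)
        - 2 * Real.pi * ((2 : ℕ) + 1) / (a ^ 2 : ℝ) * z * conj τ)
    * Complex.exp (-2 * Real.pi * ((2 : ℕ) * Hs (z - τ)
          + ∑ j : Fin 3, ((![n₁, n₂, 2] : Fin 3 → ℕ) j : ℂ) * Hs (z - p j))
        - Real.pi / (2 * (a ^ 2 : ℝ)) * (((2 : ℕ) * ‖τ‖ ^ 2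
          + ∑ j : Fin 3, ((![n₁, n₂, 2] : Fin 3 → ℕ) j : ℝ) * ‖p j‖ ^ 2 : ℝ) : ℂ)
        + Real.pi / (a ^ 2 : ℝ) * z * conj ((2 : ℕ) * τ
          + ∑ j : Fin 3, ((![n₁, n₂, 2] : Fin 3 → ℕ) j : ℂ) * p j)) = _
  have ha' : (a : ℂ) ≠ 0 := by exact_mod_cast ha.ne'
  rcases hn with ⟨rfl, rfl⟩ | ⟨rfl, rfl⟩
  all_goals
    simp only [Fin.prod_univ_three, Fin.sum_univ_three, vortexH]
    simp [Complex.conj_ofNat]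
    rw [mul_assoc (_ * _), ← Complex.exp_add]
    congr 2
    field_simp
    ring

theorem u₀_squareConfig {n₁ n₂ : ℕ} (τ : ℂ) (p : Fin 3 → ℂ) (G : ℂ → ℝ)
    (hn : (n₁ = 2 ∧ n₂ = 0) ∨ (n₁ = 0 ∧ n₂ = 2)) (z : ℂ) :
    (squareConfig a n₁ n₂ τ p).u₀ G z
      = -8 * Real.pi * (G (z - τ) + G (z - if n₁ = 2 then p 0 else p 1) + G (z - p 2)) := by
  rw [VortexConfig.u₀]
  change -4 * Real.pi * ((2 : ℕ) * G (z - τ)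
    + ∑ j : Fin 3, ((![n₁, n₂, 2] : Fin 3 → ℕ) j : ℝ) * G (z - p j)) = _
  rcases hn with ⟨rfl, rfl⟩ | ⟨rfl, rfl⟩
  all_goals
    simp [Fin.sum_univ_three]
    ring

variable {ha} {ω τ p₁ p₃ : ℂ} {ε : ℝ}

theorem vortexH_ne_zero {z : ℂ} (h₁ : z ≠ p₁) (h₃ : z ≠ p₃) : vortexH a τ p₁ p₃ Hs z ≠ 0 := by
  simp [vortexH, sub_eq_zero, h₁, h₃]

/-- The terms in `|z|²` cancel because `8 - 4 - 4 = 0`, and the explicit exponent removes the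
remaining affine terms. The logarithms at `p₁`, `p₃` cancel against the squared factors. -/
theorem log_norm_vortexH (hH : IsHStar a (Complex.I * a) G Hs)
    (h : IsVortexPair ha ω τ p₁ p₃ ε) {z : ℂ} (hz : z ∈ openSquare (a / 2)) (h0 : z ≠ τ)
    (h₁ : z ≠ p₁) (h₃ : z ≠ p₃) :
    Real.log ‖vortexH a τ p₁ p₃ Hs z‖
      = 8 * Real.pi * G (z - τ) - 4 * Real.pi * G (z - p₁) - 4 * Real.pi * G (z - p₃)
        + 4 * Real.log ‖z - τ‖ := by
  have e₁ : ‖z - p₁‖ ≠ 0 := norm_ne_zero_iff.2 (sub_ne_zero.2 h₁)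
  have e₃ : ‖z - p₃‖ ≠ 0 := norm_ne_zero_iff.2 (sub_ne_zero.2 h₃)
  rw [vortexH, norm_mul, norm_mul, norm_pow, norm_pow, Complex.norm_exp,
    Real.log_mul (by positivity) (Real.exp_ne_zero _), Real.log_mul (by positivity) (by positivity),
    Real.log_pow, Real.log_pow, Real.log_exp]
  simp only [Complex.add_re, Complex.sub_re, Complex.re_ofReal_mul, Complex.ofReal_re]
  rw [hH.re_eq_square ha (sub_mem_openSquare hz h.τ_mem) (sub_ne_zero.2 h0),
    hH.re_eq_square ha (sub_mem_openSquare hz h.p₁_mem) (sub_ne_zero.2 h₁),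
    hH.re_eq_square ha (sub_mem_openSquare hz h.p₃_mem) (sub_ne_zero.2 h₃),
    norm_sub_sq_eq z τ, norm_sub_sq_eq z p₁, norm_sub_sq_eq z p₃]
  have r (x : ℂ) : (2 * x).re = 2 * x.re := by simp
  have r' (x : ℂ) : (4 * x).re = 4 * x.re := by simp
  rw [r, r, r']
  have := Real.pi_ne_zero
  have := ha.ne'
  field_simp
  push_cast
  ring

theorem analyticAt_vortexH (hH : IsHStar a (Complex.I * a) G Hs)
    (h : IsVortexPair ha ω τ p₁ p₃ ε) {z : ℂ} (hz : z ∈ openSquare (a / 2)) :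
    AnalyticAt ℂ (vortexH a τ p₁ p₃ Hs) z := by
  have key : ∀ q ∈ openSquare (a / 2), AnalyticAt ℂ (fun w => Hs (w - q)) z := fun q hq =>
    (hH.analyticAt ha (sub_mem_openSquare hz hq)).comp_of_eq (f := fun w => w - q)
      (by fun_prop) rfl
  have h₀ := key τ h.τ_mem
  have h₁ := key p₁ h.p₁_mem
  have h₃ := key p₃ h.p₃_mem
  refine AnalyticAt.mul (by fun_prop) (AnalyticAt.cexp ?_)
  exact (((analyticAt_const.mul h₀).sub (analyticAt_const.mul h₁)).sub
    (analyticAt_const.mul h₃)).add (by fun_prop)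

/-- `u⁴ (℘(u) - ε) ℘(u)` with the singularity at `0` removed. -/
def vortexModel (ε : ℝ) (u : ℂ) : ℂ :=
  (1 + u ^ 2 * ((squarePair a ha).weierstrassPExcept 0 u - ε))
    * (1 + u ^ 2 * (squarePair a ha).weierstrassPExcept 0 u)

theorem vortexModel_eq {u : ℂ} (h0 : u ≠ 0) :
    vortexModel (ha := ha) ε u
      = u ^ 4 * ((℘[squarePair a ha] u - ε) * ℘[squarePair a ha] u) := by
  rw [vortexModel, (squarePair a ha).weierstrassP_eq_zero_add]
  field_simp
  ring

theorem analyticAt_weierstrassPExcept_of_mem {u : ℂ} (hu : u ∈ openSquare a) :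
    AnalyticAt ℂ ((squarePair a ha).weierstrassPExcept 0) u :=
  (differentiableOn_weierstrassPExcept_openSquare ha).analyticAt
    ((isOpen_openSquare a).mem_nhds hu)

theorem analyticAt_vortexModel {u : ℂ} (hu : u ∈ openSquare a) :
    AnalyticAt ℂ (vortexModel (ha := ha) ε) u := by
  have := analyticAt_weierstrassPExcept_of_mem (ha := ha) hu
  unfold vortexModel
  fun_prop

theorem IsVortexPair.ne (h : IsVortexPair ha ω τ p₁ p₃ ε) : τ ≠ p₁ ∧ τ ≠ p₃ := by
  refine ⟨fun e => h.notMem ?_, fun e => sum_half_notMem ha ?_⟩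
  · have := neg_mem h.p₁_congr
    rw [← e] at this
    convert this using 1; ring
  · have := neg_mem h.p₃_congr
    rw [← e] at this
    convert this using 1; ring

/-- A constant modulus has a local maximum at `z`, so the maximum principle applies. -/
theorem AnalyticAt.eventually_eq_const_of_norm {f : ℂ → ℂ} {z : ℂ} {C : ℝ}
    (hf : AnalyticAt ℂ f z) (h : ∀ᶠ w in 𝓝[≠] z, ‖f w‖ = C) : ∀ᶠ w in 𝓝 z, f w = f z := by
  have hz : ‖f z‖ = C := tendsto_nhds_unique_of_eventuallyEq
    (hf.continuousAt.norm.tendsto.mono_left nhdsWithin_le_nhds) tendsto_const_nhds (l := 𝓝[≠] z) h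
  refine Complex.eventually_eq_of_isLocalMax_norm
    (hf.eventually_analyticAt.mono fun w hw => hw.differentiableAt) ?_
  rw [eventually_nhdsWithin_iff] at h
  filter_upwards [h] with w hw
  by_cases hwz : w = z
  · rw [hwz]
  · simp [hw hwz, hz]

/-- `𝓗` is a constant multiple of `u⁴ (℘(u) - ε) ℘(u)`, `u = z - τ`. -/
theorem exists_vortexH_eq (hG : IsTorusGreen a (Complex.I * a) G)
    (hH : IsHStar a (Complex.I * a) G Hs) (h : IsVortexPair ha ω τ p₁ p₃ ε) :
    ∃ c : ℂ, c ≠ 0 ∧ ∀ z ∈ openSquare (a / 2),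
      vortexH a τ p₁ p₃ Hs z = c * vortexModel (ha := ha) ε (z - τ) := by
  obtain ⟨C₁, h₁⟩ := exists_log_weierstrassP_eq ha hG hH h.two_mul_mem h.notMem
  obtain ⟨C₃, h₃⟩ := exists_log_weierstrassP_eq ha hG hH (two_mul_sum_half_mem ha)
    (sum_half_notMem ha)
  rw [h.weierstrassP_eq] at h₁
  simp only [weierstrassP_sum_half, sub_zero] at h₃
  have hM : ∀ z ∈ openSquare (a / 2),
      AnalyticAt ℂ (fun z => vortexModel (ha := ha) ε (z - τ)) z := fun z hz =>
    (analyticAt_vortexModel (ha := ha) (sub_mem_openSquare hz h.τ_mem)).comp_of_eq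
      (f := fun w => w - τ) (by fun_prop) rfl
  have hMτ : vortexModel (ha := ha) ε (τ - τ) = 1 := by simp [vortexModel]
  have hHτ := vortexH_ne_zero (a := a) (τ := τ) (Hs := Hs) h.ne.1 h.ne.2
  -- The constant must be the value at `τ`, where the model equals `1`.
  set c := vortexH a τ p₁ p₃ Hs τ with hc
  have hsub : Tendsto (fun w => w - τ) (𝓝[≠] τ) (𝓝[≠] 0) := by
    rw [tendsto_nhdsWithin_iff]
    refine ⟨?_, ?_⟩
    · have : ContinuousAt (fun w => w - τ) τ := by fun_prop
      have := this.tendsto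
      rw [sub_self] at this
      exact this.mono_left nhdsWithin_le_nhds
    · filter_upwards [self_mem_nhdsWithin] with w hw using sub_ne_zero.2 hw
  have hquot : AnalyticAt ℂ
      (fun z => vortexH a τ p₁ p₃ Hs z / vortexModel (ha := ha) ε (z - τ)) τ :=
    (analyticAt_vortexH hH h h.τ_mem).div (hM τ h.τ_mem) (by rw [hMτ]; exact one_ne_zero)
  -- The formulas for `log |℘ - ε|` and `log |℘|` in terms of `G` show that the quotient has
  -- constant modulus; the identity theorem then extends the equality to the whole square.
  have hnorm : ∀ᶠ z in 𝓝[≠] τ,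
      ‖vortexH a τ p₁ p₃ Hs z / vortexModel (ha := ha) ε (z - τ)‖ = Real.exp (-C₁ - C₃) := by
    filter_upwards [hsub.eventually (h₁ 0), hsub.eventually (h₃ 0), self_mem_nhdsWithin,
      mem_nhdsWithin_of_mem_nhds ((isOpen_openSquare _).mem_nhds h.τ_mem),
      mem_nhdsWithin_of_mem_nhds (isOpen_ne.mem_nhds h.ne.1),
      mem_nhdsWithin_of_mem_nhds (isOpen_ne.mem_nhds h.ne.2),
      mem_nhdsWithin_of_mem_nhds ((hM τ h.τ_mem).continuousAt.eventually_ne (y := 0)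
        (by rw [hMτ]; exact one_ne_zero))] with z k₁ k₃ k₀ kz kp₁ kp₃ kM
    have kV := vortexH_ne_zero (a := a) (τ := τ) (Hs := Hs) kp₁ kp₃
    have hu : z - τ ≠ 0 := sub_ne_zero.2 k₀
    have kq := div_ne_zero kV kM
    rw [← Real.exp_log (norm_pos_iff.2 kq)]
    congr 1
    rw [norm_div, Real.log_div (norm_ne_zero_iff.2 kV) (norm_ne_zero_iff.2 kM),
      log_norm_vortexH hH h kz k₀ kp₁ kp₃]
    rw [vortexModel_eq hu] at kM ⊢
    have kM' := right_ne_zero_of_mul kM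
    have m₁ := left_ne_zero_of_mul kM'
    have m₃ := right_ne_zero_of_mul kM'
    rw [norm_mul, norm_mul, norm_pow, Real.log_mul (by positivity) (by positivity),
      Real.log_mul (by positivity) (by positivity), Real.log_pow, k₁, k₃]
    have g₁ : G (z - p₁) = G (z - τ - ω) := by
      rw [← hG.add_of_mem ha h.p₁_congr]; congr 1; ring
    have g₃ : G (z - p₃) = G (z - τ - (a + Complex.I * a) / 2) := by
      rw [← hG.add_of_mem ha h.p₃_congr]; congr 1; ring
    rw [g₁, g₃]
    push_cast
    ring
  have hev := hquot.eventually_eq_const_of_norm hnorm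
  rw [hMτ, div_one] at hev
  refine ⟨c, hHτ, ?_⟩
  have hopen := isOpen_openSquare (a / 2)
  refine AnalyticOnNhd.eqOn_of_preconnected_of_eventuallyEq (f := vortexH a τ p₁ p₃ Hs)
    (g := fun z => c * vortexModel (ha := ha) ε (z - τ)) (fun z hz => analyticAt_vortexH hH h hz)
    (fun z hz => analyticAt_const.mul (hM z hz)) (convex_openSquare _).isPreconnected h.τ_mem ?_
  filter_upwards [hev, (hM τ h.τ_mem).continuousAt.eventually_ne (y := 0)
        (by rw [hMτ]; exact one_ne_zero)] with z k₁ k₂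
  rwa [div_eq_iff k₂] at k₁

/-- `𝓗₀` is a constant multiple of `(℘(u) - ε) ℘(u)`. -/
theorem vortexH_div_eq {c : ℂ} {z : ℂ}
    (hc : vortexH a τ p₁ p₃ Hs z = c * vortexModel (ha := ha) ε (z - τ)) (h0 : z ≠ τ) :
    vortexH a τ p₁ p₃ Hs z / (z - τ) ^ 4
      = c * ((℘[squarePair a ha] (z - τ) - ε) * ℘[squarePair a ha] (z - τ)) := by
  have hu : z - τ ≠ 0 := sub_ne_zero.2 h0
  rw [hc, vortexModel_eq hu]
  field_simp

/-- The regular part of `℘` at `0` is even and vanishes there, hence is `O(u²)` and enters only at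
order four. -/
theorem hasTaylorThree_vortexModel :
    HasTaylorThree (vortexModel (ha := ha) ε) 1 0 (-ε) 0 := by
  have hp := analyticAt_weierstrassPExcept_of_mem (ha := ha) (zero_mem_openSquare ha)
  obtain ⟨q, hq, hpq⟩ := hp.exists_eq_add_mul
  rw [weierstrassPExcept_zero] at hpq
  simp only [zero_add] at hpq
  have hq0 : q 0 = 0 := by
    have : ∀ᶠ u in 𝓝[≠] (0 : ℂ), q u = -q (-u) := by
      filter_upwards [self_mem_nhdsWithin] with u hu
      have h₁ := weierstrassPExcept_neg (squarePair a ha) 0 u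
      rw [neg_zero, hpq, hpq] at h₁
      have hu : u ≠ 0 := hu
      apply mul_left_cancel₀ hu
      linear_combination -h₁
    have hcn : ContinuousAt (fun u => -q (-u)) 0 := by
      have h₁ : ContinuousAt q (-0) := by rw [neg_zero]; exact hq.continuousAt
      exact (ContinuousAt.comp (f := fun u : ℂ => -u) h₁ (by fun_prop)).neg
    have := tendsto_nhds_unique_of_eventuallyEq
      (hq.continuousAt.tendsto.mono_left nhdsWithin_le_nhds)
      (hcn.tendsto.mono_left nhdsWithin_le_nhds) (l := 𝓝[≠] (0 : ℂ)) this
    rw [neg_zero] at this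
    exact CharZero.eq_neg_self_iff.1 this
  obtain ⟨s, hs, hqs⟩ := hq.exists_eq_add_mul
  simp only [hq0, zero_add] at hqs
  refine ⟨fun u => 2 * s u + (u ^ 2 * s u - ε) * (u ^ 2 * s u), by fun_prop,
    Eventually.of_forall fun u => ?_⟩
  rw [vortexModel, hpq, hqs]
  ring

/-- The punctured square is the union of four convex pieces, left of, below, right of and above `τ`,
and consecutive pieces overlap. -/
theorem isPreconnected_openSquare_diff_singleton {r : ℝ} {τ : ℂ} (hτ : τ ∈ openSquare r) :
    IsPreconnected (openSquare r \ {τ}) := by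
  have hS := convex_openSquare r
  have hA := (hS.inter (convex_halfSpace_re_lt τ.re)).isPreconnected
  have hB := (hS.inter (convex_halfSpace_im_lt τ.im)).isPreconnected
  have hC := (hS.inter (convex_halfSpace_re_gt τ.re)).isPreconnected
  have hD := (hS.inter (convex_halfSpace_im_gt τ.im)).isPreconnected
  have hτ' := hτ
  obtain ⟨h₁, h₂⟩ := hτ'
  rw [abs_lt] at h₁ h₂
  have hmem (s t : ℝ) (hs : |s| < r) (ht : |t| < r) : (⟨s, t⟩ : ℂ) ∈ openSquare r := ⟨hs, ht⟩
  have l₁ : |(τ.re - r) / 2| < r := by rw [abs_lt]; constructor <;> linarith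
  have u₁ : |(τ.re + r) / 2| < r := by rw [abs_lt]; constructor <;> linarith
  have l₂ : |(τ.im - r) / 2| < r := by rw [abs_lt]; constructor <;> linarith
  have u₂ : |(τ.im + r) / 2| < r := by rw [abs_lt]; constructor <;> linarith
  have hAB := IsPreconnected.union (⟨(τ.re - r) / 2, (τ.im - r) / 2⟩ : ℂ)
    (by exact ⟨hmem _ _ l₁ l₂, by simp only [mem_ofPred_eq]; linarith⟩)
    (by exact ⟨hmem _ _ l₁ l₂, by simp only [mem_ofPred_eq]; linarith⟩) hA hB
  have hABC := IsPreconnected.union (⟨(τ.re + r) / 2, (τ.im - r) / 2⟩ : ℂ)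
    (by exact Or.inr ⟨hmem _ _ u₁ l₂, by simp only [mem_ofPred_eq]; linarith⟩)
    (by exact ⟨hmem _ _ u₁ l₂, by simp only [mem_ofPred_eq]; linarith⟩) hAB hC
  have hABCD := IsPreconnected.union (⟨(τ.re - r) / 2, (τ.im + r) / 2⟩ : ℂ)
    (by exact Or.inl (Or.inl ⟨hmem _ _ l₁ u₂, by simp only [mem_ofPred_eq]; linarith⟩))
    (by exact ⟨hmem _ _ l₁ u₂, by simp only [mem_ofPred_eq]; linarith⟩) hABC hD
  convert hABCD using 1
  ext z
  simp only [Set.mem_sdiff, mem_singleton_iff, mem_union, mem_inter_iff, mem_ofPred_eq, Complex.ext_iff]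
  constructor
  · rintro ⟨hz, h0⟩
    rcases lt_trichotomy z.re τ.re with h | h | h
    · tauto
    · rcases lt_trichotomy z.im τ.im with h' | h' | h' <;> tauto
    · tauto
  · rintro (((⟨hz, h⟩ | ⟨hz, h⟩) | ⟨hz, h⟩) | ⟨hz, h⟩) <;>
      exact ⟨hz, fun h' => by linarith [h'.1, h'.2]⟩

/-- The values of a primitive of `𝓗₀`. -/
theorem exists_primitive_eq {F : ℂ → ℂ} (h : IsVortexPair ha ω τ p₁ p₃ ε) {c : ℂ}
    (hF : ∀ z ∈ openSquare (a / 2), z ≠ τ → HasDerivAt F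
      (c * ((℘[squarePair a ha] (z - τ) - ε) * ℘[squarePair a ha] (z - τ))) z) :
    ∃ K : ℂ, ∀ z ∈ openSquare (a / 2), z ≠ τ → F z = c * sqPrimitive ha ε (z - τ) + K := by
  have hpre := isPreconnected_openSquare_diff_singleton h.τ_mem
  have hd : ∀ z ∈ openSquare (a / 2) \ {τ},
      HasDerivAt (fun z => F z - c * sqPrimitive ha ε (z - τ)) 0 z := by
    rintro z ⟨hz, h0⟩
    refine ((hF z hz h0).sub (((hasDerivAt_sqPrimitive ha h.sq_eq
      (sub_mem_openSquare hz h.τ_mem) (sub_ne_zero.2 h0)).comp_sub_const z τ).const_mul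
        c)).congr_deriv ?_
    rw [sub_self]
  have ho : IsOpen (openSquare (a / 2) \ {τ}) := (isOpen_openSquare _).sdiff isClosed_singleton
  obtain ⟨K, hK⟩ := ho.exists_is_const_of_deriv_eq_zero hpre
    (fun z hz => (hd z hz).differentiableAt.differentiableWithinAt)
    (fun z hz => by rw [(hd z hz).deriv]; rfl)
  exact ⟨K, fun z hz h0 => by linear_combination hK z ⟨hz, h0⟩⟩

end

/-! ### The local coordinate and the Taylor expansion of its inverse -/

noncomputable section
open PeriodPair ComplexConjugate

variable {a : ℝ} (ha : 0 < a)

/-- The functions `q`, `qinv` are the local coordinate and its inverse, `q³ = -1 / F`, belonging to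
`F = c W + K`, where `W` is the primitive of `(℘ - ε) ℘`. -/
structure IsLocalCoordinate (ε : ℝ) (c K τ : ℂ) (F q qinv : ℂ → ℂ) : Prop where
  ne_zero : c ≠ 0
  F_eq : ∀ᶠ z in 𝓝[≠] τ, F z = c * sqPrimitive ha ε (z - τ) + K
  analyticAt_q : AnalyticAt ℂ q τ
  q_pow : ∀ᶠ z in 𝓝[≠] τ, q z ^ 3 = -1 / F z
  analyticAt_qinv : AnalyticAt ℂ qinv 0
  qinv_zero : qinv 0 = τ
  q_qinv : ∀ᶠ w in 𝓝 (0 : ℂ), q (qinv w) = w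

/-- `u³ (c W(u) + K)` with the singularity at `0` removed. -/
def cubedPrimitive (ε : ℝ) (c K u : ℂ) : ℂ :=
  c * (-1 / 3 + ε * u ^ 2 + u ^ 3 * ((squarePair a ha).derivWeierstrassPExcept 0 u / 6
    + ε ^ 2 / 3 * u + ε * zetaReg ha u)) + K * u ^ 3

theorem cubedPrimitive_eq {ε : ℝ} {c K u : ℂ} (h0 : u ≠ 0) :
    cubedPrimitive ha ε c K u = u ^ 3 * (c * sqPrimitive ha ε u + K) := by
  rw [cubedPrimitive, sqPrimitive, (squarePair a ha).derivWeierstrassP_eq_zero_sub, sqZeta]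
  field_simp
  ring

theorem analyticAt_zetaReg {u : ℂ} (hu : u ∈ openSquare a) : AnalyticAt ℂ (zetaReg ha) u := by
  refine DifferentiableOn.analyticAt (s := openSquare a) (fun z hz => ?_)
    ((isOpen_openSquare a).mem_nhds hu)
  exact (hasDerivAt_zetaReg ha hz).differentiableAt.differentiableWithinAt

theorem analyticAt_logSigma {u : ℂ} (hu : u ∈ openSquare a) : AnalyticAt ℂ (logSigma ha) u := by
  refine DifferentiableOn.analyticAt (s := openSquare a) (fun z hz => ?_)
    ((isOpen_openSquare a).mem_nhds hu)
  exact (hasDerivAt_logSigma ha hz).differentiableAt.differentiableWithinAt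

/-- The regular part of `W` vanishes at `0`, so after multiplication by `u³` it affects only order
four; the cubic coefficient is exactly `K`. -/
theorem hasTaylorThree_cubedPrimitive (ε : ℝ) (c K : ℂ) :
    HasTaylorThree (cubedPrimitive ha ε c K) (-c / 3) 0 (c * ε) K := by
  have h₁ := (squarePair a ha).analyticAt_derivWeierstrassPExcept 0
  have h₂ := analyticAt_zetaReg ha (zero_mem_openSquare ha)
  have h : AnalyticAt ℂ (fun u => (squarePair a ha).derivWeierstrassPExcept 0 u / 6
    + ε ^ 2 / 3 * u + ε * zetaReg ha u) 0 := by
    have : AnalyticAt ℂ (fun u : ℂ => (ε : ℂ) ^ 2 / 3 * u) 0 := by fun_prop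
    exact ((h₁.div analyticAt_const (by norm_num)).add this).add (analyticAt_const.mul h₂)
  obtain ⟨s, hs, hhs⟩ := h.exists_eq_add_mul
  refine ⟨fun u => c * s u, by fun_prop, Eventually.of_forall fun u => ?_⟩
  rw [cubedPrimitive, hhs]
  simp only [derivWeierstrassPExcept_zero_zero, zetaReg_zero]
  ring

variable {ha} {ε : ℝ} {c K τ : ℂ} {F q qinv : ℂ → ℂ}

namespace IsLocalCoordinate

theorem q_apply (h : IsLocalCoordinate ha ε c K τ F q qinv) : q τ = 0 := by
  have := h.q_qinv.self_of_nhds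
  rwa [h.qinv_zero] at this

theorem tendsto_qinv (h : IsLocalCoordinate ha ε c K τ F q qinv) :
    Tendsto qinv (𝓝[≠] 0) (𝓝[≠] τ) := by
  rw [tendsto_nhdsWithin_iff]
  refine ⟨?_, ?_⟩
  · have := h.analyticAt_qinv.continuousAt.tendsto
    rw [h.qinv_zero] at this
    exact this.mono_left nhdsWithin_le_nhds
  · filter_upwards [mem_nhdsWithin_of_mem_nhds h.q_qinv, self_mem_nhdsWithin] with w hw h0 e
    have e' : qinv w = τ := e
    rw [e', h.q_apply] at hw
    exact h0 hw.symm

theorem F_qinv (h : IsLocalCoordinate ha ε c K τ F q qinv) :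
    ∀ᶠ w in 𝓝[≠] (0 : ℂ), F (qinv w) = -1 / w ^ 3 := by
  filter_upwards [h.tendsto_qinv.eventually h.q_pow, mem_nhdsWithin_of_mem_nhds h.q_qinv]
    with w h₁ h₂
  rw [h₂] at h₁
  rw [h₁]; simp

theorem cubedPrimitive_eventuallyEq (h : IsLocalCoordinate ha ε c K τ F q qinv) :
    ∀ᶠ z in 𝓝[≠] τ, cubedPrimitive ha ε c K (z - τ) = (z - τ) ^ 3 * F z := by
  filter_upwards [h.F_eq, self_mem_nhdsWithin] with z hz h0
  rw [cubedPrimitive_eq ha (sub_ne_zero.2 h0), hz]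

/-- With `u = w g(w)`, the relation `F(q⁻¹(w)) = -1/w³` reads `g³ = -u³F`, whose right side is `c/3
- cεu² - Ku³ + O(u⁴)`. Comparing coefficients determines `g` up to the choice of the cube root `β`.
-/
theorem exists_taylor (h : IsLocalCoordinate ha ε c K τ F q qinv) :
    ∃ (g : ℂ → ℂ) (β : ℂ), (∀ w, qinv w = τ + w * g w) ∧ β ^ 3 = c / 3 ∧
    HasTaylorThree g β 0 (-(c * ε / 3)) (-(K * β / 3)) := by
  obtain ⟨g, hg, hqg⟩ := h.analyticAt_qinv.exists_eq_add_mul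
  rw [h.qinv_zero] at hqg
  obtain ⟨x, b, d, hT⟩ := HasTaylorThree.of_analyticAt hg
  set β := g 0 with hβ
  have hM := ((hasTaylorThree_cubedPrimitive ha ε c K).comp
    (f := fun w => w * g w) (by simpa using HasTaylorThree.id.mul hT)).const_mul (-1)
  have hG := (hT.mul hT).mul hT
  have hev : ∀ᶠ w in 𝓝[≠] (0 : ℂ), g w * g w * g w = -1 * cubedPrimitive ha ε c K (w * g w) := by
    filter_upwards [h.F_qinv, h.tendsto_qinv.eventually h.cubedPrimitive_eventuallyEq,
      self_mem_nhdsWithin] with w h₁ h₂ h0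
    have hw : w ≠ 0 := h0
    rw [h₁, hqg, add_sub_cancel_left] at h₂
    rw [h₂]
    field_simp
  have hev' : ∀ᶠ w in 𝓝 (0 : ℂ), g w * g w * g w = -1 * cubedPrimitive ha ε c K (w * g w) :=
    (ContinuousAt.eventuallyEq_nhds_iff_eventuallyEq_nhdsNE hG.analyticAt.continuousAt
      hM.analyticAt.continuousAt).1 hev
  obtain ⟨e₀, e₁, e₂, e₃⟩ := hG.unique (hM.congr hev')
  have hβ3 : β ^ 3 = c / 3 := by linear_combination e₀
  have hβ0 : β ≠ 0 := by
    intro h0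
    rw [h0] at hβ3
    have := h.ne_zero
    apply this
    linear_combination -3 * hβ3
  have hx : x = 0 := by
    apply mul_left_cancel₀ (pow_ne_zero 2 hβ0)
    linear_combination e₁ / 3
  rw [hx] at e₂ e₃
  have hb : b = -(c * ε / 3) := by
    apply mul_left_cancel₀ (pow_ne_zero 2 hβ0)
    linear_combination e₂ / 3
  have hd : d = -(K * β / 3) := by
    apply mul_left_cancel₀ (pow_ne_zero 2 hβ0)
    linear_combination e₃ / 3
  rw [hx, hb, hd] at hT
  exact ⟨g, β, hqg, hβ3, hT⟩

theorem _root_.hasDerivAt_of_eq_add_mul {g : ℂ → ℂ} {β b d : ℂ} (hg : ∀ w, qinv w = τ + w * g w)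
    (hT : HasTaylorThree g β 0 b d) : HasDerivAt qinv β 0 := by
  have h₁ := ((hasDerivAt_id (0 : ℂ)).mul hT.analyticAt.differentiableAt.hasDerivAt).const_add τ
  simp only [id, one_mul, zero_mul, add_zero, hT.apply_zero] at h₁
  exact h₁.congr_of_eventuallyEq (Eventually.of_forall fun w => by simp [hg])

theorem deriv_q (h : IsLocalCoordinate ha ε c K τ F q qinv)
    {g : ℂ → ℂ} {β b d : ℂ} (hg : ∀ w, qinv w = τ + w * g w)
    (hT : HasTaylorThree g β 0 b d) : deriv q τ * β = 1 := by
  have h₁ := h.analyticAt_q.differentiableAt.hasDerivAt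
  rw [← h.qinv_zero] at h₁
  have h₂ := h₁.comp 0 (hasDerivAt_of_eq_add_mul hg hT)
  rw [← h.qinv_zero]
  exact h₂.unique ((hasDerivAt_id (0 : ℂ)).congr_of_eventuallyEq h.q_qinv)

end IsLocalCoordinate

end

/-! ### The coefficient `f₃` and the derivatives entering `Γ` and `Υ` -/

noncomputable section
open PeriodPair ComplexConjugate

variable {a : ℝ} {ha : 0 < a} {ε : ℝ} {c K τ : ℂ} {F q qinv : ℂ → ℂ}

theorem eventually_log_div {α : Type*} {l : Filter α} {f g : α → ℂ} (hf : Tendsto f l (𝓝 1))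
    (hg : Tendsto g l (𝓝 1)) :
    ∀ᶠ x in l, Complex.log (f x / g x) = Complex.log (f x) - Complex.log (g x) := by
  have h1 : (1 : ℂ) ∈ Complex.slitPlane := by simp
  have hl : Tendsto (fun x => (Complex.log (f x) - Complex.log (g x)).im) l (𝓝 0) := by
    have := (Complex.continuous_im.tendsto _).comp ((hf.clog h1).sub (hg.clog h1))
    simpa only [Complex.log_one, sub_zero, Complex.zero_im, Function.comp_def] using this
  filter_upwards [hl.eventually (Ioo_mem_nhds (neg_lt_zero.2 Real.pi_pos) Real.pi_pos),
    hf.eventually_ne one_ne_zero, hg.eventually_ne one_ne_zero] with x hx h₁ h₂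
  rw [← Complex.log_exp hx.1 hx.2.le, Complex.exp_sub, Complex.exp_log h₁, Complex.exp_log h₂]

open Classical in
/-- The quotient `(w - q(z)) / (q⁻¹(w) - z)`. -/
def coordQuot (q qinv : ℂ → ℂ) (z w : ℂ) : ℂ :=
  if qinv w = z then deriv q z else (w - q z) / (qinv w - z)

theorem hasTaylorThree_logSigma_sub {u : ℂ} (hu : u ∈ openSquare a) :
    HasTaylorThree (fun x => logSigma ha (u - x)) (logSigma ha u) (-zetaReg ha u)
      (-(squarePair a ha).weierstrassPExcept 0 u / 2)
      ((squarePair a ha).derivWeierstrassPExcept 0 u / 6) := by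
  have hs : ∀ᶠ x in 𝓝 (0 : ℂ), u - x ∈ openSquare a := by
    have : ContinuousAt (fun x => u - x) 0 := by fun_prop
    exact this.eventually_mem ((isOpen_openSquare a).mem_nhds (by simpa using hu))
  have hA : AnalyticAt ℂ (fun x => logSigma ha (u - x)) 0 :=
    (analyticAt_logSigma ha hu).comp_of_eq (f := fun x => u - x) (by fun_prop) (by simp)
  have d₁ : deriv (fun x => logSigma ha (u - x)) =ᶠ[𝓝 0] fun x => -zetaReg ha (u - x) := by
    filter_upwards [hs] with x hx
    exact ((hasDerivAt_logSigma ha hx).comp_const_sub u x).deriv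
  have d₂ : deriv (fun x => -zetaReg ha (u - x)) =ᶠ[𝓝 0]
      fun x => -(squarePair a ha).weierstrassPExcept 0 (u - x) := by
    filter_upwards [hs] with x hx
    rw [((hasDerivAt_zetaReg ha hx).comp_const_sub u x).fun_neg.deriv]
    ring
  have d₃ : deriv (fun x => -(squarePair a ha).weierstrassPExcept 0 (u - x)) 0
      = (squarePair a ha).derivWeierstrassPExcept 0 u := by
    have h₁ := (analyticAt_weierstrassPExcept_of_mem (ha := ha)
      (u := u - 0) (by simpa using hu)).differentiableAt.hasDerivAt
    rw [(h₁.comp_const_sub u 0).fun_neg.deriv]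
    have hmem : u ∈ ((squarePair a ha).lattice \ {0} : Set ℂ)ᶜ := by
      rintro ⟨h₁, h₂⟩
      exact h₂ (eq_zero_of_mem_lattice ha h₁ hu)
    have := (squarePair a ha).eqOn_deriv_weierstrassPExcept_derivWeierstrassPExcept 0 hmem
    rw [sub_zero, this, neg_neg]
  have i₁ : iteratedDeriv 1 (fun x => logSigma ha (u - x)) 0 = -zetaReg ha u := by
    rw [iteratedDeriv_one, d₁.self_of_nhds]
    simp
  have i₂ : iteratedDeriv 2 (fun x => logSigma ha (u - x)) 0
      = -(squarePair a ha).weierstrassPExcept 0 u := by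
    rw [iteratedDeriv_succ', d₁.iteratedDeriv_eq, iteratedDeriv_one, d₂.self_of_nhds]
    simp
  have i₃ : iteratedDeriv 3 (fun x => logSigma ha (u - x)) 0
      = (squarePair a ha).derivWeierstrassPExcept 0 u := by
    rw [iteratedDeriv_succ', d₁.iteratedDeriv_eq, iteratedDeriv_succ', d₂.iteratedDeriv_eq,
      iteratedDeriv_one, d₃]
  have := hA.hasTaylorThree
  rwa [i₁, i₂, i₃, sub_zero] at this

namespace IsLocalCoordinate

theorem eventually_ne (h : IsLocalCoordinate ha ε c K τ F q qinv) : ∀ᶠ z in 𝓝[≠] τ, F z ≠ 0 := by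
  have hM := hasTaylorThree_cubedPrimitive ha ε c K
  have hc : ContinuousAt (fun z => cubedPrimitive ha ε c K (z - τ)) τ :=
    ContinuousAt.comp_of_eq (f := fun z => z - τ) hM.analyticAt.continuousAt (by fun_prop)
      (by simp)
  have h0 : cubedPrimitive ha ε c K (τ - τ) ≠ 0 := by
    have := h.ne_zero
    rw [sub_self, hM.apply_zero]
    simpa
  filter_upwards [h.cubedPrimitive_eventuallyEq,
    mem_nhdsWithin_of_mem_nhds (hc.eventually_ne (y := 0) h0)] with z h₁ h₂ h₃
  rw [h₁, h₃, mul_zero] at h₂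
  exact h₂ rfl

/-- The normalised quotient is `(1 - w/q(z)) / (1 - w g(w)/(z - τ))`; both logarithms are expanded.
-/
theorem coefficient_log_of_ne {g : ℂ → ℂ} {β b d z : ℂ} (hg : ∀ w, qinv w = τ + w * g w)
    (hT : HasTaylorThree g β 0 b d) (hz : z ≠ τ) (hq : q z ≠ 0) : ∃ e₁ e₂,
    HasTaylorThree (fun w => Complex.log (coordQuot q qinv z w / coordQuot q qinv z 0)) 0 e₁ e₂
      (-1 / (3 * q z ^ 3) + b / (z - τ) + β ^ 3 / (3 * (z - τ) ^ 3)) := by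
  have hu : z - τ ≠ 0 := sub_ne_zero.2 hz
  have hwg : HasTaylorThree (fun w => w * g w) 0 β 0 b := by simpa using HasTaylorThree.id.mul hT
  have hA : HasTaylorThree (fun w => -1 / q z * w) 0 (-1 / q z) 0 0 := by
    simpa using HasTaylorThree.id.const_mul (-1 / q z)
  have hB : HasTaylorThree (fun w => -1 / (z - τ) * (w * g w)) 0 (-1 / (z - τ) * β) 0
      (-1 / (z - τ) * b) := by
    simpa using hwg.const_mul (-1 / (z - τ))
  have key := (hasTaylorThree_log_one_add.comp hA).sub (hasTaylorThree_log_one_add.comp hB)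
  have tend {f : ℂ → ℂ} {x y t : ℂ} (hf : HasTaylorThree f 0 x y t) :
      Tendsto (fun w => 1 + f w) (𝓝 0) (𝓝 1) := by
    have := hf.analyticAt.continuousAt.tendsto.const_add 1
    rwa [hf.apply_zero, add_zero] at this
  have hne : ∀ᶠ w in 𝓝 (0 : ℂ), qinv w ≠ z := by
    have h₁ := hwg.analyticAt.continuousAt.eventually_ne (y := z - τ)
      (by simpa using hu.symm)
    filter_upwards [h₁] with w hw e
    rw [hg] at e
    exact hw (by linear_combination e)
  refine ⟨_, _, (key.congr (g := fun w => Complex.log (coordQuot q qinv z w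
    / coordQuot q qinv z 0)) ?_).congr_all (sub_zero 0) rfl rfl ?_⟩
  · filter_upwards [eventually_log_div (tend hA) (tend hB), hne] with w h₁ h₂
    rw [← h₁]
    congr 1
    rw [coordQuot, coordQuot, if_neg h₂, if_neg hne.self_of_nhds, hg, hg]
    rw [hg] at h₂
    have h₃ : τ + w * g w - z ≠ 0 := sub_ne_zero.2 h₂
    have h₄ : τ + 0 * g 0 - z ≠ 0 := by
      rw [zero_mul, add_zero]; exact sub_ne_zero.2 hz.symm
    have h₅ : 1 + -1 / (z - τ) * (w * g w) ≠ 0 := by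
      intro e
      apply h₃
      field_simp at e
      linear_combination -e
    have h₆ : 0 - q z ≠ 0 := by simpa
    rw [div_div_div_eq, div_eq_div_iff (mul_ne_zero h₃ h₆) h₅]
    field_simp
    ring
  · field_simp
    ring

/-- At `z = τ` the quotient is `1/g(w)` with value `1/β` at `0`, so the logarithm is `-log(g/β)`. -/
theorem coefficient_log_self (h : IsLocalCoordinate ha ε c K τ F q qinv)
    {g : ℂ → ℂ} {β b d : ℂ} (hg : ∀ w, qinv w = τ + w * g w)
    (hT : HasTaylorThree g β 0 b d) : ∃ e₁ e₂,
    HasTaylorThree (fun w => Complex.log (coordQuot q qinv τ w / coordQuot q qinv τ 0)) 0 e₁ e₂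
      (-(d / β)) := by
  have hd := h.deriv_q hg hT
  have hβ : β ≠ 0 := right_ne_zero_of_mul_eq_one hd
  have hG : HasTaylorThree (fun w => 1 / β * g w - 1) 0 0 (b / β) (d / β) := by
    refine ((hT.const_mul (1 / β)).sub (HasTaylorThree.const 1)).congr_all ?_ ?_ ?_ ?_ <;>
      field_simp <;> ring
  have key := (HasTaylorThree.const 0).sub (hasTaylorThree_log_one_add.comp hG)
  have tend : Tendsto (fun w => 1 + (1 / β * g w - 1)) (𝓝 0) (𝓝 1) := by
    have := hG.analyticAt.continuousAt.tendsto.const_add 1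
    rwa [hG.apply_zero, add_zero] at this
  refine ⟨_, _, (key.congr (g := fun w => Complex.log (coordQuot q qinv τ w
    / coordQuot q qinv τ 0)) ?_).congr_all (sub_zero 0) rfl rfl ?_⟩
  · filter_upwards [eventually_log_div tendsto_const_nhds tend,
      hT.analyticAt.continuousAt.eventually_ne (y := 0) (by rwa [hT.apply_zero])] with w h₁ h₂
    rw [Complex.log_one] at h₁
    rw [← h₁]
    congr 1
    have e0 : coordQuot q qinv τ 0 = 1 / β := by
      rw [coordQuot, if_pos h.qinv_zero]
      exact eq_one_div_of_mul_eq_one_left hd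
    rw [e0, coordQuot]
    by_cases hw : w = 0
    · rw [if_pos (by rw [hw, h.qinv_zero]), hw, hT.apply_zero,
        eq_one_div_of_mul_eq_one_left hd]
      field_simp
      ring
    · have hq : qinv w ≠ τ := by rw [hg]; simp [hw, h₂]
      rw [if_neg hq, h.q_apply, hg]
      field_simp
      ring_nf
      field_simp
  · ring

/-- `4πH*` is a constant minus `2 log(σ(u)/u)`, expanded here at `u = z - q⁻¹(w)`. -/
theorem coefficient_of_log {Hs : ℂ → ℂ} {C : ℂ}
    (hHs : ∀ z ∈ openSquare a, Hs z = C - (1 / (2 * Real.pi) : ℝ) * logSigma ha z)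
    {g : ℂ → ℂ} {β b d z e₁ e₂ l : ℂ} (hg : ∀ w, qinv w = τ + w * g w)
    (hT : HasTaylorThree g β 0 b d) (hz : z - τ ∈ openSquare a)
    (hl : HasTaylorThree (fun w => Complex.log (coordQuot q qinv z w / coordQuot q qinv z 0))
      0 e₁ e₂ l) :
    1 / 6 * iteratedDeriv 3 (fun w => 2 * Complex.log (coordQuot q qinv z w / coordQuot q qinv z 0)
        + 4 * Real.pi * Hs (z - qinv w)) 0
      = 2 * l + 2 * b * zetaReg ha (z - τ)
        - β ^ 3 / 3 * (squarePair a ha).derivWeierstrassPExcept 0 (z - τ) := by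
  have hwg : HasTaylorThree (fun w => w * g w) 0 β 0 b := by simpa using HasTaylorThree.id.mul hT
  have key := (hl.const_mul 2).add ((HasTaylorThree.const (4 * Real.pi * C)).add
    (((hasTaylorThree_logSigma_sub (ha := ha) hz).comp hwg).const_mul (-2)))
  have hs : ∀ᶠ w in 𝓝 (0 : ℂ), z - τ - w * g w ∈ openSquare a := by
    have : ContinuousAt (fun w => z - τ - w * g w) 0 :=
      continuousAt_const.sub hwg.analyticAt.continuousAt
    exact this.eventually_mem ((isOpen_openSquare a).mem_nhds (by simpa using hz))
  rw [((key.congr ?_).iteratedDeriv_eq).2.2]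
  · ring
  · filter_upwards [hs] with w hw
    have e : z - qinv w = z - τ - w * g w := by rw [hg]; ring
    rw [e, hHs _ hw]
    have := Real.pi_ne_zero
    have : (Real.pi : ℂ) ≠ 0 := by exact_mod_cast this
    push_cast
    field_simp
    ring

/-- The function `f₃` of the expansion: it is affine near `τ`. -/
theorem eventually_coefficient_eq (h : IsLocalCoordinate ha ε c K τ F q qinv)
    {Hs : ℂ → ℂ} {C : ℂ}
    (hHs : ∀ z ∈ openSquare a, Hs z = C - (1 / (2 * Real.pi) : ℝ) * logSigma ha z) :
    ∀ᶠ z in 𝓝 τ, 1 / 6 * iteratedDeriv 3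
      (fun w => 2 * Complex.log (coordQuot q qinv z w / coordQuot q qinv z 0)
        + 4 * Real.pi * Hs (z - qinv w)) 0 = 2 / 3 * (K + c * ε ^ 2 / 3 * (z - τ)) := by
  obtain ⟨g, β, hg, hβ, hT⟩ := h.exists_taylor
  have hs : ∀ᶠ z in 𝓝 τ, z - τ ∈ openSquare a := by
    have : ContinuousAt (fun z => z - τ) τ := by fun_prop
    exact this.eventually_mem ((isOpen_openSquare a).mem_nhds
      (by simpa using zero_mem_openSquare ha))
  filter_upwards [hs, eventually_nhdsWithin_iff.1 h.F_eq, eventually_nhdsWithin_iff.1 h.q_pow,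
    eventually_nhdsWithin_iff.1 h.eventually_ne] with z h₁ h₂ h₃ h₄
  by_cases hz : z = τ
  · obtain ⟨e₁, e₂, hl⟩ := h.coefficient_log_self hg hT
    have hβ0 := right_ne_zero_of_mul_eq_one (h.deriv_q hg hT)
    rw [hz, coefficient_of_log hHs hg hT (by rw [hz] at h₁; exact h₁) hl]
    simp only [sub_self, zetaReg_zero, derivWeierstrassPExcept_zero_zero]
    field_simp
    ring
  · have h₅ := h₃ hz
    have hq : q z ≠ 0 := by
      intro e
      rw [e, zero_pow three_ne_zero, eq_comm] at h₅
      exact div_ne_zero (by norm_num) (h₄ hz) h₅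
    obtain ⟨e₁, e₂, hl⟩ := coefficient_log_of_ne (q := q) hg hT hz hq
    rw [coefficient_of_log hHs hg hT h₁ hl, hβ]
    have hu : z - τ ≠ 0 := sub_ne_zero.2 hz
    have h₆ : -1 / (3 * q z ^ 3) = F z / 3 := by
      have := h₄ hz
      rw [h₅]
      field_simp
    -- The terms `b/u` and `β³/(3u³)` complete the regular parts of `ζ` and `℘'` to the full
    -- functions, which then cancel against those in `F = cW + K`. Only the affine part of `F`
    -- survives.
    rw [h₆, h₂ hz, sqPrimitive, (squarePair a ha).derivWeierstrassP_eq_zero_sub, sqZeta]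
    field_simp
    ring

theorem coefficient_qinv (h : IsLocalCoordinate ha ε c K τ F q qinv) :
    1 / 6 * iteratedDeriv 3 qinv 0 = -(c * ε / 3) := by
  obtain ⟨g, β, hg, hβ, hT⟩ := h.exists_taylor
  have := (HasTaylorThree.const τ).add (HasTaylorThree.id.mul hT)
  rw [((this.congr (Eventually.of_forall hg)).iteratedDeriv_eq).2.2]
  ring

end IsLocalCoordinate

theorem iteratedDeriv_eq_of_shift (n : ℕ) (f : ℂ → ℂ) (τ : ℂ) :
    iteratedDeriv n f τ = iteratedDeriv n (fun u => f (τ + u)) 0 := by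
  rw [iteratedDeriv_comp_const_add]; simp

theorem iteratedDeriv_two_vortexH {H : ℂ → ℂ}
    (hH : ∀ᶠ z in 𝓝 τ, H z = c * vortexModel (ha := ha) ε (z - τ)) :
    iteratedDeriv 2 H τ = -2 * c * ε := by
  have hs : Tendsto (fun u => τ + u) (𝓝 0) (𝓝 τ) := by
    have : ContinuousAt (fun u => τ + u) 0 := by fun_prop
    simpa [ContinuousAt] using this
  rw [iteratedDeriv_eq_of_shift, (((hasTaylorThree_vortexModel (ha := ha) (ε := ε)).const_mul
    c).congr ?_).iteratedDeriv_eq.2.1]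
  · ring
  · filter_upwards [hs.eventually hH] with u hu
    rw [hu, add_sub_cancel_left]

/-- The cubic coefficient of the product comes only from `-cεu²` times the linear term of `f`; `K`
would meet the cubic term of `H`, which is zero. -/
theorem iteratedDeriv_three_vortexH_mul {H f : ℂ → ℂ}
    (hH : ∀ᶠ z in 𝓝 τ, H z = c * vortexModel (ha := ha) ε (z - τ))
    (hf : ∀ᶠ z in 𝓝 τ, f z = 2 / 3 * (K + c * ε ^ 2 / 3 * (z - τ))) :
    1 / 2 * iteratedDeriv 3 (fun z => H z * f z) τ = -(2 / 3) * c ^ 2 * ε ^ 3 := by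
  have hs : Tendsto (fun u => τ + u) (𝓝 0) (𝓝 τ) := by
    have : ContinuousAt (fun u => τ + u) 0 := by fun_prop
    simpa [ContinuousAt] using this
  have hlin : HasTaylorThree (fun u => 2 / 3 * (K + c * ε ^ 2 / 3 * u))
      (2 / 3 * (K + c * ε ^ 2 / 3 * 0)) (2 / 3 * (0 + c * ε ^ 2 / 3 * 1))
      (2 / 3 * (0 + c * ε ^ 2 / 3 * 0)) (2 / 3 * (0 + c * ε ^ 2 / 3 * 0)) :=
    ((HasTaylorThree.const K).add (HasTaylorThree.id.const_mul _)).const_mul _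
  rw [iteratedDeriv_eq_of_shift, ((((hasTaylorThree_vortexModel (ha := ha) (ε := ε)).const_mul
    c).mul hlin).congr ?_).iteratedDeriv_eq.2.2]
  · ring
  · filter_upwards [hs.eventually hH, hs.eventually hf] with u h₁ h₂
    rw [h₁, h₂, add_sub_cancel_left]

end

/-! ### Stokes' theorem with a cutoff at the pole -/

noncomputable section
open ComplexConjugate

theorem integral_closedSquare (g : ℂ → ℂ) (r : ℝ) (hr : 0 ≤ r)
    (hg : IntegrableOn g (Icc (-r) r ×ℂ Icc (-r) r)) :
    ∫ z in Icc (-r) r ×ℂ Icc (-r) r, g z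
      = ∫ x : ℝ in -r..r, ∫ y : ℝ in -r..r, g (x + y * Complex.I) := by
  have he := Complex.volume_preserving_equiv_real_prod.symm
  have hpre : Complex.measurableEquivRealProd.symm ⁻¹' (Icc (-r) r ×ℂ Icc (-r) r)
      = Icc (-r) r ×ˢ Icc (-r) r := by
    ext p
    simp [Complex.mem_reProdIm, Complex.measurableEquivRealProd, Prod.le_def]
    tauto
  have hsymm (p : ℝ × ℝ) : Complex.measurableEquivRealProd.symm p = p.1 + p.2 * Complex.I := by
    simp [Complex.ext_iff, Complex.measurableEquivRealProd]
  have h₁ := he.setIntegral_preimage_emb (MeasurableEquiv.measurableEmbedding _) g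
    (Icc (-r) r ×ℂ Icc (-r) r)
  have h₂ := (he.integrableOn_comp_preimage (MeasurableEquiv.measurableEmbedding _)).2 hg
  rw [hpre] at h₁ h₂
  simp only [hsymm, Function.comp_def] at h₁ h₂
  rw [← h₁, Measure.volume_eq_prod, setIntegral_prod _ h₂, integral_Icc_eq_integral_Ioc,
    intervalIntegral.integral_of_le (by linarith)]
  congr 1
  funext x
  rw [integral_Icc_eq_integral_Ioc, intervalIntegral.integral_of_le (by linarith)]

/-- The real derivative of `ζ ↦ ψ(|ζ|²) ζ̄`. -/
theorem hasFDerivAt_cutoff_conj {ψ : ℝ → ℝ} {ψ' : ℝ} {ζ : ℂ} (hψ : HasDerivAt ψ ψ' (‖ζ‖ ^ 2)) :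
    ∃ L : ℂ →L[ℝ] ℂ, HasFDerivAt (fun ζ : ℂ => (ψ (‖ζ‖ ^ 2) : ℂ) * conj ζ) L ζ ∧
      ∀ v, L v = (ψ' * (2 * (conj ζ * v).re) : ℝ) * conj ζ + ψ (‖ζ‖ ^ 2) * conj v := by
  have h₁ := (hasStrictFDerivAt_norm_sq ζ).hasFDerivAt
  have h₂ := Complex.ofRealCLM.hasFDerivAt.comp ζ (hψ.comp_hasFDerivAt ζ h₁)
  have h₃ := h₂.mul Complex.conjCLE.hasFDerivAt
  refine ⟨_, h₃, fun v => ?_⟩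
  simp [Complex.inner]
  ring

/-- The left side is `2i` times the `∂/∂z̄` derivative. Since `Φ` and `φ` are holomorphic, it only
falls on the dependence on the conjugate of `Φ`. -/
theorem hasFDerivAt_cutoff {ψ : ℝ → ℝ} {ψ' : ℝ} {Φ φ : ℂ → ℂ} {z φ' : ℂ}
    (hΦ : HasDerivAt Φ (φ z) z) (hφ : HasDerivAt φ φ' z) (hψ : HasDerivAt ψ ψ' (‖Φ z‖ ^ 2)) :
    ∃ L : ℂ →L[ℝ] ℂ,
      HasFDerivAt (fun z => (ψ (‖Φ z‖ ^ 2) : ℂ) * conj (Φ z) * φ z) L z ∧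
      Complex.I * L 1 - L Complex.I
        = 2 * Complex.I * ((ψ' * ‖Φ z‖ ^ 2 + ψ (‖Φ z‖ ^ 2)) * ‖φ z‖ ^ 2 : ℝ) := by
  obtain ⟨L, hL, hLv⟩ := hasFDerivAt_cutoff_conj hψ
  have h₁ := hL.comp z (hΦ.hasFDerivAt.restrictScalars ℝ)
  have h₂ := h₁.mul (hφ.hasFDerivAt.restrictScalars ℝ)
  refine ⟨_, h₂, ?_⟩
  simp [hLv]
  have e₁ : (‖Φ z‖ : ℂ) ^ 2 = conj (Φ z) * Φ z := by rw [Complex.conj_mul']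
  have e₂ : (‖φ z‖ : ℂ) ^ 2 = conj (φ z) * φ z := by rw [Complex.conj_mul']
  rw [e₁, e₂]
  simp only [Complex.ext_iff]
  constructor <;> simp <;> ring

theorem volume_closedSquare_diff (r : ℝ) :
    openSquare r =ᵐ[volume] (Icc (-r) r ×ℂ Icc (-r) r : Set ℂ) := by
  have he := Complex.volume_preserving_equiv_real_prod
  have h : (Ioo (-r) r ×ˢ Ioo (-r) r : Set (ℝ × ℝ)) =ᵐ[volume] (Icc (-r) r ×ˢ Icc (-r) r : Set _) :=
    Measure.set_prod_ae_eq Ioo_ae_eq_Icc Ioo_ae_eq_Icc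
  have := he.quasiMeasurePreserving.preimage_ae_eq h
  rw [openSquare_eq_reProdIm]
  exact this

theorem Filter.Tendsto.eventually_cutoff_eq_zero {Φ : ℂ → ℂ} {τ : ℂ}
    (htop : Tendsto (fun z => ‖Φ z‖) (𝓝[≠] τ) atTop) {ψ : ℝ → ℝ} {T : ℝ}
    (hT : ∀ t, T ≤ t → ψ t = 0) :
    ∀ᶠ z in 𝓝[≠] τ, ψ (‖Φ z‖ ^ 2) = 0 ∧ deriv ψ (‖Φ z‖ ^ 2) = 0 := by
  have := (tendsto_pow_atTop two_ne_zero).comp htop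
  filter_upwards [this.eventually_gt_atTop T] with z hz
  refine ⟨hT _ hz.le, ?_⟩
  have : ψ =ᶠ[𝓝 (‖Φ z‖ ^ 2)] fun _ => 0 := by
    filter_upwards [lt_mem_nhds hz] with t ht using hT t (le_of_lt ht)
  rw [this.deriv_eq, deriv_const]

/-- Stokes' theorem for `ψ(|Φ|²) Φ̄ Φ' dz` on a square, where `Φ` has a pole at `τ` and `ψ`
has bounded support. -/
theorem integral_cutoff {r : ℝ} (hr : 0 < r) {τ : ℂ} {Φ φ φ' : ℂ → ℂ}
    (hΦ : ∀ z ∈ Icc (-r) r ×ℂ Icc (-r) r, z ≠ τ → HasDerivAt Φ (φ z) z)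
    (hφ : ∀ z ∈ Icc (-r) r ×ℂ Icc (-r) r, z ≠ τ → HasDerivAt φ (φ' z) z)
    (htop : Tendsto (fun z => ‖Φ z‖) (𝓝[≠] τ) atTop) {ψ : ℝ → ℝ} (hψ : ContDiff ℝ 1 ψ)
    {T : ℝ} (hT : ∀ t, T ≤ t → ψ t = 0) (hτ : τ ∈ openSquare r) {f : ℂ → ℂ}
    (hf : ∀ z, f z = (ψ (‖Φ z‖ ^ 2) : ℂ) * conj (Φ z) * φ z) :
    IntegrableOn (fun z => (deriv ψ (‖Φ z‖ ^ 2) * ‖Φ z‖ ^ 2 + ψ (‖Φ z‖ ^ 2)) * ‖φ z‖ ^ 2)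
      (openSquare r) ∧
    (∫ x : ℝ in -r..r, f (x + (-r : ℝ) * Complex.I)) - (∫ x : ℝ in -r..r, f (x + r * Complex.I))
      + Complex.I * (∫ y : ℝ in -r..r, f (r + y * Complex.I))
      - Complex.I * (∫ y : ℝ in -r..r, f ((-r : ℝ) + y * Complex.I))
      = 2 * Complex.I * (∫ z in openSquare r,
        (deriv ψ (‖Φ z‖ ^ 2) * ‖Φ z‖ ^ 2 + ψ (‖Φ z‖ ^ 2)) * ‖φ z‖ ^ 2 : ℝ) := by
  classical
  have hψd : ∀ t, HasDerivAt ψ (deriv ψ t) t := fun t =>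
    (hψ.differentiable one_ne_zero t).hasDerivAt
  have hψc : Continuous (deriv ψ) := hψ.continuous_deriv le_rfl
  set S : Set ℂ := Icc (-r) r ×ℂ Icc (-r) r with hS
  set D : ℂ → ℝ := fun z => (deriv ψ (‖Φ z‖ ^ 2) * ‖Φ z‖ ^ 2 + ψ (‖Φ z‖ ^ 2)) * ‖φ z‖ ^ 2 with hD
  -- Near `τ` the cutoff vanishes because `|Φ|` is large, so with the value `0` at `τ` both
  -- functions are continuous on the closed square.
  set D₀ : ℂ → ℝ := fun z => if z = τ then 0 else D z with hD₀
  set f₀ : ℂ → ℂ := fun z => if z = τ then 0 else f z with hf₀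
  have hev := htop.eventually_cutoff_eq_zero hT
  rw [eventually_nhdsWithin_iff] at hev
  have hΦc : ∀ z ∈ S, z ≠ τ → ContinuousAt Φ z := fun z hz h0 => (hΦ z hz h0).continuousAt
  have hφc : ∀ z ∈ S, z ≠ τ → ContinuousAt φ z := fun z hz h0 => (hφ z hz h0).continuousAt
  have hψ0 := hψ.continuous
  have hf₀c : ContinuousOn f₀ S := by
    intro z hz
    refine ContinuousAt.continuousWithinAt ?_
    by_cases h0 : z = τ
    · have : f₀ =ᶠ[𝓝 z] fun _ => 0 := by
        rw [h0]
        filter_upwards [hev] with w hw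
        by_cases hwτ : w = τ
        · simp [hf₀, hwτ]
        · simp [hf₀, hf, (hw hwτ).1]
      exact continuousAt_const.congr this.symm
    · have : f₀ =ᶠ[𝓝 z] fun z => (ψ (‖Φ z‖ ^ 2) : ℂ) * conj (Φ z) * φ z := by
        filter_upwards [isOpen_ne.mem_nhds h0] with w hw
        have hw : w ≠ τ := hw
        simp [hf₀, hf, hw]
      refine ContinuousAt.congr ?_ this.symm
      have h₁ := hΦc z hz h0
      have h₂ := hφc z hz h0
      have h₃ : ContinuousAt (fun z => ψ (‖Φ z‖ ^ 2)) z :=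
        hψ0.continuousAt.comp (f := fun z => ‖Φ z‖ ^ 2) (by fun_prop)
      exact (((Complex.continuous_ofReal.continuousAt.comp (f := fun z => ψ (‖Φ z‖ ^ 2)) h₃).mul
        (Complex.continuous_conj.continuousAt.comp h₁)).mul h₂)
  have hD₀c : ContinuousOn D₀ S := by
    intro z hz
    refine ContinuousAt.continuousWithinAt ?_
    by_cases h0 : z = τ
    · have : D₀ =ᶠ[𝓝 z] fun _ => 0 := by
        rw [h0]
        filter_upwards [hev] with w hw
        by_cases hwτ : w = τ
        · simp [hD₀, hwτ]
        · simp [hD₀, hD, (hw hwτ).1, (hw hwτ).2]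
      exact continuousAt_const.congr this.symm
    · have : D₀ =ᶠ[𝓝 z] D := by
        filter_upwards [isOpen_ne.mem_nhds h0] with w hw
        have hw : w ≠ τ := hw
        simp [hD₀, hw]
      refine ContinuousAt.congr ?_ this.symm
      have h₁ := hΦc z hz h0
      have h₂ := hφc z hz h0
      have h₃ : ContinuousAt (fun z => ψ (‖Φ z‖ ^ 2)) z :=
        hψ0.continuousAt.comp (f := fun z => ‖Φ z‖ ^ 2) (by fun_prop)
      have h₄ : ContinuousAt (fun z => deriv ψ (‖Φ z‖ ^ 2)) z :=
        hψc.continuousAt.comp (f := fun z => ‖Φ z‖ ^ 2) (by fun_prop)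
      exact (((h₄.mul (by fun_prop)).add h₃).mul (by fun_prop))
  have hcS := isCompact_closedSquare r
  have hDi : IntegrableOn D₀ S := hD₀c.integrableOn_compact hcS
  have hae : ∀ᵐ z : ℂ, D₀ z = D z := by
    filter_upwards [compl_mem_ae_iff.2 (measure_singleton (μ := volume) τ)] with z hz
    have hz : z ≠ τ := hz
    simp [hD₀, hz]
  have hL : ∀ z, ∃ L : ℂ →L[ℝ] ℂ, z ∈ S → (z ≠ τ → HasFDerivAt f₀ L z) ∧
      (Complex.I * L 1 - L Complex.I = 2 * Complex.I * (D₀ z : ℂ)) := by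
    intro z
    by_cases h0 : z = τ
    · exact ⟨0, fun _ => ⟨fun h => (h h0).elim, by simp [hD₀, h0]⟩⟩
    by_cases hz : z ∈ S
    · obtain ⟨L, h₁, h₂⟩ := hasFDerivAt_cutoff (hΦ z hz h0) (hφ z hz h0) (hψd _)
      refine ⟨L, fun _ => ⟨fun _ => h₁.congr_of_eventuallyEq ?_, ?_⟩⟩
      · filter_upwards [isOpen_ne.mem_nhds h0] with w hw
        have hw : w ≠ τ := hw
        simp [hf₀, hf, hw]
      · rw [h₂]; simp only [hD₀, h0, if_false, hD]
    · exact ⟨0, fun h => (hz h).elim⟩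
  choose L hL using hL
  have hrr : -r ≤ r := by linarith
  have hSm : MeasurableSet S := hcS.isClosed.measurableSet
  have hDi' : IntegrableOn (fun z => 2 * Complex.I * (D₀ z : ℂ)) S := hDi.ofReal.const_mul _
  have hLi : IntegrableOn (fun z => Complex.I • L z 1 - L z Complex.I) S := by
    refine hDi'.congr_fun (fun z hz => ?_) hSm
    rw [smul_eq_mul, (hL z hz).2]
  have hSu : (uIcc (-r) r ×ℂ uIcc (-r) r) = S := by rw [uIcc_of_le hrr]
  have key := Complex.integral_boundary_rect_of_hasFDerivAt_real_off_countable f₀ L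
    ⟨-r, -r⟩ ⟨r, r⟩ {τ} (countable_singleton τ) (by rw [hSu]; exact hf₀c)
    (by
      rintro z ⟨hz, h0⟩
      simp only [min_eq_left hrr, max_eq_right hrr] at hz
      exact (hL z ⟨Ioo_subset_Icc_self hz.1, Ioo_subset_Icc_self hz.2⟩).1 h0)
    (by rw [hSu]; exact hLi)
  have hfb {x y : ℝ} (h : |x| = r ∨ |y| = r) :
      f₀ (x + y * Complex.I) = f (x + y * Complex.I) := by
    have : (x : ℂ) + y * Complex.I ≠ τ := by
      rintro rfl
      obtain ⟨h₁, h₂⟩ := hτ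
      simp only [Complex.add_re, Complex.ofReal_re, Complex.mul_re, Complex.I_re, mul_zero,
        Complex.ofReal_im, Complex.I_im, mul_one, sub_self, add_zero, Complex.add_im,
        Complex.mul_im, zero_add] at h₁ h₂
      rcases h with h | h <;> linarith
    simp [hf₀, this]
  have hright : ∫ x : ℝ in -r..r, ∫ y : ℝ in -r..r,
      (Complex.I • L (x + y * Complex.I) 1 - L (x + y * Complex.I) Complex.I)
      = 2 * Complex.I * (∫ z in openSquare r, D z : ℝ) := by
    rw [← integral_closedSquare (fun z => Complex.I • L z 1 - L z Complex.I) r hr.le hLi,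
      setIntegral_congr_fun hSm (g := fun z => 2 * Complex.I * (D₀ z : ℂ))
        (fun z hz => by simp only [smul_eq_mul]; exact (hL z hz).2),
      integral_const_mul, integral_complex_ofReal]
    congr 2
    rw [← setIntegral_congr_set (volume_closedSquare_diff r)]
    exact integral_congr_ae (ae_restrict_of_ae hae)
  refine ⟨?_, ?_⟩
  · exact (hDi.mono_set (openSquare_subset_closedSquare r)).congr (ae_restrict_of_ae hae)
  · rw [← hright, ← key]
    have hr1 : |(-r)| = r := by rw [abs_neg, abs_of_pos hr]
    have hr2 : |r| = r := abs_of_pos hr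
    have b₁ (x : ℝ) := hfb (x := x) (Or.inr hr1)
    have b₂ (x : ℝ) := hfb (x := x) (Or.inr hr2)
    have b₃ (y : ℝ) := hfb (y := y) (Or.inl hr1)
    have b₄ (y : ℝ) := hfb (y := y) (Or.inl hr2)
    simp only [smul_eq_mul, b₁, b₂, b₃, b₄]

end

/-! ### Bilinear relations and radial integrals -/

noncomputable section
open ComplexConjugate

theorem integral_segment {Φ φ : ℂ → ℂ} {l r : ℝ} (hlr : l ≤ r) {p v : ℂ}
    (hΦ : ∀ t ∈ Icc l r, HasDerivAt Φ (φ (p + t * v)) (p + t * v))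
    (hφ : ∀ t ∈ Icc l r, ContinuousAt φ (p + t * v)) :
    v * ∫ t in l..r, φ (p + t * v) = Φ (p + r * v) - Φ (p + l * v) := by
  rw [← intervalIntegral.integral_const_mul]
  refine intervalIntegral.integral_eq_sub_of_hasDerivAt
    (f := fun t : ℝ => Φ (p + t * v)) (fun t ht => ?_) ?_
  · rw [uIcc_of_le hlr] at ht
    have h₁ : HasDerivAt (fun t : ℝ => p + t * v) v t := by
      simpa using ((Complex.ofRealCLM.hasDerivAt (x := t)).mul_const v).const_add p
    exact ((hΦ t ht).scomp t h₁).congr_deriv (by simp)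
  · refine ContinuousOn.intervalIntegrable fun t ht => ContinuousAt.continuousWithinAt ?_
    rw [uIcc_of_le hlr] at ht
    exact continuousAt_const.mul
      ((hφ t ht).comp (f := fun t : ℝ => p + t * v) (by fun_prop))

/-- The integral of `|Φ'|²`, suitably cut off near a pole of `Φ`, is given by the periods of `Φ`
(bilinear relations). -/
theorem integral_cutoff_eq_periods {r : ℝ} (hr : 0 < r) {τ : ℂ} {Φ φ φ' : ℂ → ℂ}
    (hΦ : ∀ z ∈ Icc (-r) r ×ℂ Icc (-r) r, z ≠ τ → HasDerivAt Φ (φ z) z)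
    (hφ : ∀ z ∈ Icc (-r) r ×ℂ Icc (-r) r, z ≠ τ → HasDerivAt φ (φ' z) z)
    (htop : Tendsto (fun z => ‖Φ z‖) (𝓝[≠] τ) atTop) {ψ : ℝ → ℝ} (hψ : ContDiff ℝ 1 ψ)
    {T : ℝ} (hT : ∀ t, T ≤ t → ψ t = 0) (hτ : τ ∈ openSquare r)
    (hbd : ∀ z ∈ Icc (-r) r ×ℂ Icc (-r) r, z ∉ openSquare r → ψ (‖Φ z‖ ^ 2) = 1) {P₁ P₂ : ℂ}
    (hP₁ : ∀ y ∈ Icc (-r) r, Φ (r + y * Complex.I) = Φ ((-r : ℝ) + y * Complex.I) + P₁)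
    (hP₂ : ∀ x ∈ Icc (-r) r, Φ (x + r * Complex.I) = Φ (x + (-r : ℝ) * Complex.I) + P₂)
    (hφ₁ : ∀ y ∈ Icc (-r) r, φ (r + y * Complex.I) = φ ((-r : ℝ) + y * Complex.I))
    (hφ₂ : ∀ x ∈ Icc (-r) r, φ (x + r * Complex.I) = φ (x + (-r : ℝ) * Complex.I)) :
    IntegrableOn (fun z => (deriv ψ (‖Φ z‖ ^ 2) * ‖Φ z‖ ^ 2 + ψ (‖Φ z‖ ^ 2)) * ‖φ z‖ ^ 2)
      (openSquare r) ∧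
    2 * Complex.I * (∫ z in openSquare r,
        (deriv ψ (‖Φ z‖ ^ 2) * ‖Φ z‖ ^ 2 + ψ (‖Φ z‖ ^ 2)) * ‖φ z‖ ^ 2 : ℝ)
      = conj P₁ * P₂ - conj P₂ * P₁ := by
  have hrr : -r ≤ r := by linarith
  obtain ⟨hi, key⟩ := integral_cutoff hr hΦ hφ htop hψ hT hτ (f := fun z =>
    (ψ (‖Φ z‖ ^ 2) : ℂ) * conj (Φ z) * φ z) fun _ => rfl
  refine ⟨hi, ?_⟩
  rw [← key]
  have hr1 : -r ∈ Icc (-r) r := ⟨le_rfl, hrr⟩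
  have hr2 : r ∈ Icc (-r) r := ⟨hrr, le_rfl⟩
  have hmem {x y : ℝ} (hx : x ∈ Icc (-r) r) (hy : y ∈ Icc (-r) r) :
      (x : ℂ) + y * Complex.I ∈ Icc (-r) r ×ℂ Icc (-r) r := by
    constructor <;> simpa using by assumption
  have hnot {x y : ℝ} (h : |x| = r ∨ |y| = r) : (x : ℂ) + y * Complex.I ∉ openSquare r := by
    rintro ⟨h₁, h₂⟩
    simp only [Complex.add_re, Complex.ofReal_re, Complex.mul_re, Complex.I_re, mul_zero,
      Complex.ofReal_im, Complex.I_im, mul_one, sub_self, add_zero, Complex.add_im,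
      Complex.mul_im, zero_add] at h₁ h₂
    rcases h with h | h <;> linarith
  have hne {x y : ℝ} (h : |x| = r ∨ |y| = r) : (x : ℂ) + y * Complex.I ≠ τ :=
    fun e => hnot h (e ▸ hτ)
  have ar1 : |(-r)| = r := by rw [abs_neg, abs_of_pos hr]
  have ar2 : |r| = r := abs_of_pos hr
  have i₁ : ∫ t in -r..r, φ (t + (-r : ℝ) * Complex.I) = P₁ := by
    have := integral_segment (Φ := Φ) (φ := φ) hrr (p := (-r : ℝ) * Complex.I) (v := 1)
      (fun t ht => by
        rw [add_comm, mul_one]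
        exact hΦ _ (hmem ht hr1) (hne (Or.inr ar1)))
      (fun t ht => by
        rw [add_comm, mul_one]
        exact (hφ _ (hmem ht hr1) (hne (Or.inr ar1))).continuousAt)
    simp only [one_mul, mul_one] at this
    simp only [add_comm ((-r : ℝ) * Complex.I)] at this
    rw [this, hP₁ _ hr1]
    ring
  have i₂ : Complex.I * ∫ t in -r..r, φ ((-r : ℝ) + t * Complex.I) = P₂ := by
    rw [integral_segment (Φ := Φ) (φ := φ) hrr
      (fun t ht => hΦ _ (hmem hr1 ht) (hne (Or.inl ar1)))
      (fun t ht => (hφ _ (hmem hr1 ht) (hne (Or.inl ar1))).continuousAt), hP₂ _ hr1]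
    ring
  have hc : ∀ z ∈ Icc (-r) r ×ℂ Icc (-r) r, z ≠ τ →
      ContinuousAt (fun z => conj (Φ z) * φ z) z := fun z hz h0 =>
    (Complex.continuous_conj.continuousAt.comp (hΦ z hz h0).continuousAt).mul
      (hφ z hz h0).continuousAt
  -- On the boundary `ψ = 1`, and on opposite edges the integrands differ by the conjugate of a
  -- period times `φ`; the integral of `φ` along an edge is the other period.
  have j₁ : (∫ x : ℝ in -r..r, (ψ (‖Φ (x + (-r : ℝ) * Complex.I)‖ ^ 2) : ℂ)
        * conj (Φ (x + (-r : ℝ) * Complex.I)) * φ (x + (-r : ℝ) * Complex.I))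
      - (∫ x : ℝ in -r..r, (ψ (‖Φ (x + r * Complex.I)‖ ^ 2) : ℂ)
        * conj (Φ (x + r * Complex.I)) * φ (x + r * Complex.I))
      = -(conj P₂ * P₁) := by
    have c₁ : ContinuousOn (fun x : ℝ => conj (Φ (x + (-r : ℝ) * Complex.I))
        * φ (x + (-r : ℝ) * Complex.I)) (uIcc (-r) r) := by
      intro x hx
      rw [uIcc_of_le hrr] at hx
      exact ((hc _ (hmem hx hr1) (hne (Or.inr ar1))).comp
        (f := fun x : ℝ => (x : ℂ) + (-r : ℝ) * Complex.I) (by fun_prop)).continuousWithinAt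
    have c₂ : ContinuousOn (fun x : ℝ => conj P₂ * φ (x + (-r : ℝ) * Complex.I))
        (uIcc (-r) r) := by
      intro x hx
      rw [uIcc_of_le hrr] at hx
      exact (continuousAt_const.mul (((hφ _ (hmem hx hr1) (hne (Or.inr ar1))).continuousAt).comp
        (f := fun x : ℝ => (x : ℂ) + (-r : ℝ) * Complex.I) (by fun_prop))).continuousWithinAt
    have e₁ : ∫ x : ℝ in -r..r, (ψ (‖Φ (x + (-r : ℝ) * Complex.I)‖ ^ 2) : ℂ)
          * conj (Φ (x + (-r : ℝ) * Complex.I)) * φ (x + (-r : ℝ) * Complex.I)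
        = ∫ x : ℝ in -r..r, conj (Φ (x + (-r : ℝ) * Complex.I)) * φ (x + (-r : ℝ) * Complex.I) := by
      refine intervalIntegral.integral_congr fun x hx => ?_
      rw [uIcc_of_le hrr] at hx
      rw [hbd _ (hmem hx hr1) (hnot (Or.inr ar1)), Complex.ofReal_one, one_mul]
    have e₂ : ∫ x : ℝ in -r..r, (ψ (‖Φ (x + r * Complex.I)‖ ^ 2) : ℂ)
          * conj (Φ (x + r * Complex.I)) * φ (x + r * Complex.I)
        = ∫ x : ℝ in -r..r, (conj (Φ (x + (-r : ℝ) * Complex.I)) * φ (x + (-r : ℝ) * Complex.I)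
          + conj P₂ * φ (x + (-r : ℝ) * Complex.I)) := by
      refine intervalIntegral.integral_congr fun x hx => ?_
      rw [uIcc_of_le hrr] at hx
      rw [hbd _ (hmem hx hr2) (hnot (Or.inr ar2)), Complex.ofReal_one, one_mul, hP₂ x hx, hφ₂ x hx,
        map_add, add_mul]
    rw [e₁, e₂, intervalIntegral.integral_add c₁.intervalIntegrable c₂.intervalIntegrable,
      intervalIntegral.integral_const_mul, i₁]
    ring
  have j₂ : Complex.I * (∫ y : ℝ in -r..r, (ψ (‖Φ (r + y * Complex.I)‖ ^ 2) : ℂ)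
        * conj (Φ (r + y * Complex.I)) * φ (r + y * Complex.I))
      - Complex.I * (∫ y : ℝ in -r..r, (ψ (‖Φ ((-r : ℝ) + y * Complex.I)‖ ^ 2) : ℂ)
        * conj (Φ ((-r : ℝ) + y * Complex.I)) * φ ((-r : ℝ) + y * Complex.I))
      = conj P₁ * P₂ := by
    have c₁ : ContinuousOn (fun y : ℝ => conj (Φ ((-r : ℝ) + y * Complex.I))
        * φ ((-r : ℝ) + y * Complex.I)) (uIcc (-r) r) := by
      intro y hy
      rw [uIcc_of_le hrr] at hy
      exact ((hc _ (hmem hr1 hy) (hne (Or.inl ar1))).comp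
        (f := fun y : ℝ => ((-r : ℝ) : ℂ) + y * Complex.I) (by fun_prop)).continuousWithinAt
    have c₂ : ContinuousOn (fun y : ℝ => conj P₁ * φ ((-r : ℝ) + y * Complex.I))
        (uIcc (-r) r) := by
      intro y hy
      rw [uIcc_of_le hrr] at hy
      exact (continuousAt_const.mul (((hφ _ (hmem hr1 hy) (hne (Or.inl ar1))).continuousAt).comp
        (f := fun y : ℝ => ((-r : ℝ) : ℂ) + y * Complex.I) (by fun_prop))).continuousWithinAt
    have e₁ : ∫ y : ℝ in -r..r, (ψ (‖Φ ((-r : ℝ) + y * Complex.I)‖ ^ 2) : ℂ)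
          * conj (Φ ((-r : ℝ) + y * Complex.I)) * φ ((-r : ℝ) + y * Complex.I)
        = ∫ y : ℝ in -r..r, conj (Φ ((-r : ℝ) + y * Complex.I)) * φ ((-r : ℝ) + y * Complex.I) := by
      refine intervalIntegral.integral_congr fun y hy => ?_
      rw [uIcc_of_le hrr] at hy
      rw [hbd _ (hmem hr1 hy) (hnot (Or.inl ar1)), Complex.ofReal_one, one_mul]
    have e₂ : ∫ y : ℝ in -r..r, (ψ (‖Φ (r + y * Complex.I)‖ ^ 2) : ℂ)
          * conj (Φ (r + y * Complex.I)) * φ (r + y * Complex.I)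
        = ∫ y : ℝ in -r..r, (conj (Φ ((-r : ℝ) + y * Complex.I)) * φ ((-r : ℝ) + y * Complex.I)
          + conj P₁ * φ ((-r : ℝ) + y * Complex.I)) := by
      refine intervalIntegral.integral_congr fun y hy => ?_
      rw [uIcc_of_le hrr] at hy
      rw [hbd _ (hmem hr2 hy) (hnot (Or.inl ar2)), Complex.ofReal_one, one_mul, hP₁ y hy, hφ₁ y hy,
        map_add, add_mul]
    rw [e₁, e₂, intervalIntegral.integral_add c₁.intervalIntegrable c₂.intervalIntegrable,
      intervalIntegral.integral_const_mul, ← i₂]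
    ring
  linear_combination j₁ + j₂

theorem integral_image_of_hasDerivAt {s : Set ℂ} (hs : MeasurableSet s) {g g' : ℂ → ℂ}
    (hg : ∀ w ∈ s, HasDerivAt g (g' w) w) (hinj : InjOn g s) (D : ℂ → ℝ) :
    ∫ z in g '' s, D z = ∫ w in s, ‖g' w‖ ^ 2 * D (g w) := by
  rw [integral_image_eq_integral_abs_det_fderiv_smul volume hs
    (fun w hw => ((hg w hw).hasFDerivAt.restrictScalars ℝ).hasFDerivWithinAt) hinj]
  refine setIntegral_congr_fun hs fun w _ => ?_
  simp [ContinuousLinearMap.det, LinearMap.det_restrictScalars, Algebra.norm_complex_eq,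
    Complex.normSq_eq_norm_sq]

theorem setIntegral_punctured_ball (h : ℝ → ℝ) (δ : ℝ) :
    ∫ w in Metric.ball (0 : ℂ) δ \ {0}, h ‖w‖ = 2 * Real.pi * ∫ y in Ioo 0 δ, y * h y := by
  have hm : MeasurableSet (Metric.ball (0 : ℂ) δ \ {0}) :=
    measurableSet_ball.diff (measurableSet_singleton _)
  have := integral_fun_norm_addHaar (volume : Measure ℂ) ((Ioo 0 δ).indicator h)
  rw [← integral_indicator hm]
  have e : (Metric.ball (0 : ℂ) δ \ {0}).indicator (fun w => h ‖w‖)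
      = fun w => (Ioo 0 δ).indicator h ‖w‖ := by
    funext w
    simp only [indicator, Set.mem_sdiff, mem_ball_zero_iff, mem_singleton_iff, mem_Ioo, norm_pos_iff]
    congr 1
    simp [and_comm]
  rw [e, this]
  simp only [Complex.finrank_real_complex, Measure.real, Complex.volume_ball]
  have e' : (fun y : ℝ => y ^ (2 - 1) • (Ioo 0 δ).indicator h y)
      = (Ioo 0 δ).indicator fun y => y * h y := by
    funext y
    by_cases hy : y ∈ Ioo 0 δ <;> simp [hy]
  rw [e', setIntegral_indicator measurableSet_Ioo, inter_eq_right.2 Ioo_subset_Ioi_self]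
  simp
  ring

theorem integral_norm_inv_pow_four {ρ : ℝ} (hρ : 0 < ρ) :
    IntegrableOn (fun y : ℂ => (3 : ℝ) / ‖y‖ ^ 4) {y | ρ ≤ ‖y‖} ∧
    ∫ y in {y : ℂ | ρ ≤ ‖y‖}, (3 : ℝ) / ‖y‖ ^ 4 = 3 * Real.pi / ρ ^ 2 := by
  have hm : MeasurableSet {y : ℂ | ρ ≤ ‖y‖} := measurableSet_le measurable_const measurable_norm
  have e : {y : ℂ | ρ ≤ ‖y‖}.indicator (fun y => (3 : ℝ) / ‖y‖ ^ 4)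
      = fun y => (Ici ρ).indicator (fun t => 3 / t ^ 4) ‖y‖ := by
    funext y
    simp [indicator]
  have e' : (fun y : ℝ => y ^ (2 - 1) • (Ici ρ).indicator (fun t => 3 / t ^ 4) y)
      = (Ici ρ).indicator fun y => 3 * y ^ (-3 : ℝ) := by
    funext y
    by_cases hy : y ∈ Ici ρ
    · have hy0 : 0 < y := hρ.trans_le hy
      have : y ^ (-3 : ℝ) = (y ^ 3)⁻¹ := by
        rw [Real.rpow_neg hy0.le]; norm_cast
      simp only [hy, indicator_of_mem, smul_eq_mul, this]
      field_simp
      norm_num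
    · simp [hy]
  have hIci : Ioi (0 : ℝ) ∩ Ici ρ = Ici ρ := inter_eq_right.2 fun y hy => hρ.trans_le hy
  rw [← integrable_indicator_iff hm, ← integral_indicator hm, e, integral_fun_norm_addHaar,
    integrable_fun_norm_addHaar]
  simp only [Complex.finrank_real_complex, Measure.real, Complex.volume_ball]
  rw [e', setIntegral_indicator measurableSet_Ici, hIci, integral_Ici_eq_integral_Ioi,
    integral_const_mul, integral_Ioi_rpow_of_lt (by norm_num) hρ]
  constructor
  · rw [integrableOn_indicator_iff measurableSet_Ici, inter_comm, hIci,
      integrableOn_Ici_iff_integrableOn_Ioi]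
    exact (integrableOn_Ioi_rpow_of_lt (by norm_num) hρ).const_mul 3
  · have : ρ ^ (-3 + 1 : ℝ) = (ρ ^ 2)⁻¹ := by
      norm_num
    rw [this]
    simp
    field_simp
    norm_num

/-- With `t = y⁻⁶` the integrand is the derivative of `-(3/2) t ψ(t)`, which vanishes near `y = 0`.
It is the cut-off density in the coordinate `w`, where `|F| = |w|⁻³`. -/
theorem integral_radial_cutoff {ψ : ℝ → ℝ} (hψ : ContDiff ℝ 1 ψ)
    {T : ℝ} (hT : ∀ t, T ≤ t → ψ t = 0) {δ : ℝ} (hδ : 0 < δ) :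
    ∫ y in Ioo 0 δ, y * ((deriv ψ ((y ^ 6)⁻¹) * (y ^ 6)⁻¹ + ψ ((y ^ 6)⁻¹)) * (9 * (y ^ 8)⁻¹))
      = -(3 / 2) * ((δ ^ 6)⁻¹ * ψ ((δ ^ 6)⁻¹)) := by
  set Θ : ℝ → ℝ := fun y => -(3 / 2) * ((y ^ 6)⁻¹ * ψ ((y ^ 6)⁻¹)) with hΘ
  set θ : ℝ → ℝ := fun y =>
    y * ((deriv ψ ((y ^ 6)⁻¹) * (y ^ 6)⁻¹ + ψ ((y ^ 6)⁻¹)) * (9 * (y ^ 8)⁻¹)) with hθ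
  have hψc : Continuous (deriv ψ) := hψ.continuous_deriv le_rfl
  have hψ0 := hψ.continuous
  have hsmall : ∀ᶠ y in 𝓝 (0 : ℝ), Θ y = 0 ∧ θ y = 0 := by
    have : Tendsto (fun y : ℝ => (y ^ 6)⁻¹) (𝓝[≠] 0) atTop := by
      refine Tendsto.inv_tendsto_nhdsGT_zero ?_
      rw [tendsto_nhdsWithin_iff]
      refine ⟨?_, ?_⟩
      · have : ContinuousAt (fun y : ℝ => y ^ 6) 0 := by fun_prop
        have := this.tendsto
        simp only [ne_eq, OfNat.ofNat_ne_zero, not_false_eq_true, zero_pow] at this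
        exact this.mono_left nhdsWithin_le_nhds
      · filter_upwards [self_mem_nhdsWithin] with y hy
        have hy : y ≠ 0 := hy
        exact (by positivity : 0 < y ^ 6)
    have := this.eventually_gt_atTop T
    rw [eventually_nhdsWithin_iff] at this
    filter_upwards [this] with y hy
    by_cases h0 : y = 0
    · simp [hΘ, hθ, h0]
    · have h₁ := hy h0
      have h₂ : ψ =ᶠ[𝓝 ((y ^ 6)⁻¹)] fun _ => 0 := by
        filter_upwards [lt_mem_nhds h₁] with t ht using hT t (le_of_lt ht)
      simp [hΘ, hθ, h₂.deriv_eq, h₂.self_of_nhds]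
  have hd : ∀ y, HasDerivAt Θ (θ y) y := by
    intro y
    by_cases h0 : y = 0
    · rw [h0, hsmall.self_of_nhds.2]
      exact (hasDerivAt_const (0 : ℝ) (0 : ℝ)).congr_of_eventuallyEq (hsmall.mono fun _ h => h.1)
    · have h₁ := (hasDerivAt_pow 6 y).inv (pow_ne_zero 6 h0)
      have h₂ := ((hψ.differentiable one_ne_zero _).hasDerivAt).comp y h₁
      refine ((h₁.mul h₂).const_mul (-(3 / 2))).congr_deriv ?_
      simp only [hθ, Function.comp, Pi.inv_apply]
      push_cast
      field_simp
      ring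
  have hc : Continuous θ := by
    refine continuous_iff_continuousAt.2 fun y => ?_
    by_cases h0 : y = 0
    · rw [h0]
      exact (continuousAt_const (y := (0 : ℝ))).congr (hsmall.mono fun _ h => h.2.symm)
    · have h₆ : ContinuousAt (fun y : ℝ => (y ^ 6)⁻¹) y :=
        ContinuousAt.inv₀ (by fun_prop) (pow_ne_zero 6 h0)
      have h₈ : ContinuousAt (fun y : ℝ => (y ^ 8)⁻¹) y :=
        ContinuousAt.inv₀ (by fun_prop) (pow_ne_zero 8 h0)
      have h₁ : ContinuousAt (fun y : ℝ => ψ ((y ^ 6)⁻¹)) y :=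
        hψ0.continuousAt.comp (f := fun y : ℝ => (y ^ 6)⁻¹) h₆
      have h₂ : ContinuousAt (fun y : ℝ => deriv ψ ((y ^ 6)⁻¹)) y :=
        hψc.continuousAt.comp (f := fun y : ℝ => (y ^ 6)⁻¹) h₆
      exact continuousAt_id.mul (((h₂.mul h₆).add h₁).mul (continuousAt_const.mul h₈))
  rw [← integral_Ioc_eq_integral_Ioo, ← intervalIntegral.integral_of_le hδ.le,
    intervalIntegral.integral_eq_sub_of_hasDerivAt (fun y _ => hd y) (hc.intervalIntegrable _ _),
    hsmall.self_of_nhds.1, sub_zero]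

end

/-! ### Periods of the primitive and the region where it is large -/

noncomputable section
open PeriodPair ComplexConjugate

variable {a : ℝ} {ha : 0 < a} {ε : ℝ} {c K τ : ℂ} {F q qinv : ℂ → ℂ}

theorem sub_mem_openSquare_of_closedSquare {z τ : ℂ}
    (hz : z ∈ Icc (-(a / 2)) (a / 2) ×ℂ Icc (-(a / 2)) (a / 2)) (hτ : τ ∈ openSquare (a / 2)) :
    z - τ ∈ openSquare a := by
  obtain ⟨⟨h₁, h₂⟩, h₃, h₄⟩ := hz
  obtain ⟨h₅, h₆⟩ := hτ
  rw [abs_lt] at h₅ h₆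
  constructor
  · rw [Complex.sub_re, abs_lt]; constructor <;> linarith
  · rw [Complex.sub_im, abs_lt]; constructor <;> linarith

theorem sqPrimitive_add_period {z : ℂ} (hz : z ∈ openSquare a) (hz' : z + a ∈ openSquare a) :
    sqPrimitive ha ε (z + a) = sqPrimitive ha ε z + (ε ^ 2 * a / 3 + ε * Real.pi / a : ℝ) := by
  rw [sqPrimitive, sqPrimitive, sqZeta_add_period ha hz hz', two_mul_sqZeta_half,
    derivWeierstrassP_add_of_mem (ofReal_mem_lattice ha)]
  push_cast
  ring

theorem sqPrimitive_add_I_period {z : ℂ} (hz : z ∈ openSquare a)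
    (hz' : z + Complex.I * a ∈ openSquare a) :
    sqPrimitive ha ε (z + Complex.I * a)
      = sqPrimitive ha ε z + Complex.I * (ε ^ 2 * a / 3 - ε * Real.pi / a : ℝ) := by
  rw [sqPrimitive, sqPrimitive, sqZeta_add_I_period ha hz hz', two_mul_sqZeta_half,
    derivWeierstrassP_add_of_mem (I_mul_ofReal_mem_lattice ha)]
  push_cast
  ring

/-- A smooth cutoff function, equal to `1` on `(-∞, T]` and to `0` on `[2T, ∞)`. -/
theorem exists_cutoff {T : ℝ} (hT : 0 < T) : ∃ ψ : ℝ → ℝ, ContDiff ℝ 1 ψ ∧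
    (∀ t, t ≤ T → ψ t = 1) ∧ ∀ t, 2 * T ≤ t → ψ t = 0 := by
  refine ⟨fun t => Real.smoothTransition (2 - t / T), ?_, fun t ht => ?_, fun t ht => ?_⟩
  · exact Real.smoothTransition.contDiff.comp (by fun_prop)
  · refine Real.smoothTransition.one_of_one_le ?_
    have : t / T ≤ 1 := (div_le_one hT).2 ht
    linarith
  · refine Real.smoothTransition.zero_of_nonpos ?_
    have : 2 ≤ t / T := (le_div_iff₀ hT).2 ht
    linarith

namespace IsLocalCoordinate

/-- As `q'(τ) ≠ 0`, `q` has a two-sided local inverse, and the given right inverse must coincide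
with it. -/
theorem qinv_q (h : IsLocalCoordinate ha ε c K τ F q qinv) : ∀ᶠ z in 𝓝 τ, qinv (q z) = z := by
  obtain ⟨g, β, hg, hβ, hT⟩ := h.exists_taylor
  have hd : deriv q τ ≠ 0 := left_ne_zero_of_mul_eq_one (h.deriv_q hg hT)
  have hs := h.analyticAt_q.hasStrictDerivAt
  have hl := hs.eventually_left_inverse hd
  have htq : Tendsto q (𝓝 τ) (𝓝 0) := by
    have := h.analyticAt_q.continuousAt.tendsto
    rwa [h.q_apply] at this
  have htqi : Tendsto qinv (𝓝 0) (𝓝 τ) := by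
    have := h.analyticAt_qinv.continuousAt.tendsto
    rwa [h.qinv_zero] at this
  have heq : ∀ᶠ w in 𝓝 0, hs.localInverse q (deriv q τ) τ hd w = qinv w := by
    filter_upwards [htqi.eventually hl, h.q_qinv] with w h₁ h₂
    rwa [h₂] at h₁
  filter_upwards [hl, htq.eventually heq] with z h₁ h₂
  rw [← h₂, h₁]

theorem tendsto_norm_atTop (h : IsLocalCoordinate ha ε c K τ F q qinv) :
    Tendsto (fun z => ‖c * sqPrimitive ha ε (z - τ) + K‖) (𝓝[≠] τ) atTop := by
  have hM := hasTaylorThree_cubedPrimitive ha ε c K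
  have h₁ : Tendsto (fun z => ‖cubedPrimitive ha ε c K (z - τ)‖) (𝓝[≠] τ) (𝓝 ‖-c / 3‖) := by
    have : ContinuousAt (fun z => ‖cubedPrimitive ha ε c K (z - τ)‖) τ :=
      (ContinuousAt.comp_of_eq (f := fun z => z - τ) hM.analyticAt.continuousAt (by fun_prop)
        (by simp)).norm
    have := this.tendsto
    rw [sub_self, hM.apply_zero] at this
    exact this.mono_left nhdsWithin_le_nhds
  have h₂ : Tendsto (fun z => ‖z - τ‖ ^ 3) (𝓝[≠] τ) (𝓝[>] 0) := by
    rw [tendsto_nhdsWithin_iff]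
    refine ⟨?_, ?_⟩
    · have : ContinuousAt (fun z => ‖z - τ‖ ^ 3) τ := by fun_prop
      have := this.tendsto
      simp only [sub_self, norm_zero, ne_eq, OfNat.ofNat_ne_zero, not_false_eq_true, zero_pow]
        at this
      exact this.mono_left nhdsWithin_le_nhds
    · filter_upwards [self_mem_nhdsWithin] with z hz
      have : 0 < ‖z - τ‖ := norm_pos_iff.2 (sub_ne_zero.2 hz)
      exact pow_pos this 3
  have hc : 0 < ‖-c / 3‖ := by
    have := h.ne_zero
    rw [norm_pos_iff]
    simpa
  refine (h₁.pos_mul_atTop hc (tendsto_inv_nhdsGT_zero.comp h₂)).congr' ?_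
  filter_upwards [self_mem_nhdsWithin] with z hz
  have hu : z - τ ≠ 0 := sub_ne_zero.2 hz
  rw [cubedPrimitive_eq ha hu, norm_mul, norm_pow, Function.comp]
  have : ‖z - τ‖ ≠ 0 := norm_ne_zero_iff.2 hu
  field_simp

/-- For small `δ`, the set `|F| > δ⁻³` is the image of a punctured disc under `q⁻¹`. -/
theorem eventually_image (h : IsLocalCoordinate ha ε c K τ F q qinv)
    (hτ : τ ∈ openSquare (a / 2))
    (hF : ∀ z ∈ openSquare (a / 2), z ≠ τ → F z = c * sqPrimitive ha ε (z - τ) + K)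
    (hΦ : ContinuousOn (fun z => c * sqPrimitive ha ε (z - τ) + K)
      ((Icc (-(a / 2)) (a / 2) ×ℂ Icc (-(a / 2)) (a / 2)) \ {τ})) :
    ∀ᶠ δ in 𝓝[>] (0 : ℝ),
      (∀ w ∈ Metric.ball (0 : ℂ) δ \ {0}, AnalyticAt ℂ qinv w ∧ q (qinv w) = w ∧
        qinv w ∈ openSquare (a / 2) \ {τ} ∧ F (qinv w) = -1 / w ^ 3) ∧
      (∀ z ∈ Icc (-(a / 2)) (a / 2) ×ℂ Icc (-(a / 2)) (a / 2), z ∉ openSquare (a / 2) →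
        ‖c * sqPrimitive ha ε (z - τ) + K‖ ≤ 1 / δ ^ 3) ∧
      {z | z ∈ openSquare (a / 2) ∧ z ≠ τ ∧ 1 / δ ^ 3 < ‖F z‖}
        = qinv '' (Metric.ball (0 : ℂ) δ \ {0}) := by
  have hopen := isOpen_openSquare (a / 2)
  have h₁ : ∀ᶠ w in 𝓝[≠] (0 : ℂ), AnalyticAt ℂ qinv w ∧ q (qinv w) = w ∧
        qinv w ∈ openSquare (a / 2) \ {τ} ∧ F (qinv w) = -1 / w ^ 3 := by
    filter_upwards [mem_nhdsWithin_of_mem_nhds h.analyticAt_qinv.eventually_analyticAt,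
      mem_nhdsWithin_of_mem_nhds h.q_qinv, h.F_qinv, h.tendsto_qinv.eventually
        (sdiff_mem_nhdsWithin_compl (hopen.mem_nhds hτ) {τ})] with w h₁ h₂ h₃ h₄
    exact ⟨h₁, h₂, h₄, h₃⟩
  rw [eventually_nhdsWithin_iff, Metric.eventually_nhds_iff_ball] at h₁
  obtain ⟨δ₁, hδ₁, h₁⟩ := h₁
  have h₂ := h.qinv_q.and ((eventually_nhdsWithin_iff.1 h.q_pow).and (hopen.mem_nhds hτ))
  obtain ⟨V, hV, hVo, hτV⟩ := eventually_nhds_iff.1 h₂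
  have hcomp : IsCompact ((Icc (-(a / 2)) (a / 2) ×ℂ Icc (-(a / 2)) (a / 2)) \ V) :=
    (isCompact_closedSquare (a / 2)).diff hVo
  -- Away from `τ` the primitive is bounded by compactness, up to the boundary of the square; so for
  -- small `δ` the region `|F| > δ⁻³` lies where `q⁻¹ ∘ q` is the identity.
  obtain ⟨B, hB⟩ := hcomp.exists_bound_of_continuousOn (hΦ.mono (by
    rintro z ⟨hz, hzV⟩
    exact ⟨hz, fun e => hzV (by rw [mem_singleton_iff.1 e]; exact hτV)⟩))
  have hlarge : ∀ᶠ δ in 𝓝[>] (0 : ℝ), B < 1 / δ ^ 3 := by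
    have : Tendsto (fun δ : ℝ => (δ ^ 3)⁻¹) (𝓝[>] 0) atTop := by
      have h₁ : Tendsto (fun δ : ℝ => δ ^ 3) (𝓝[>] 0) (𝓝[>] 0) := by
        rw [tendsto_nhdsWithin_iff]
        refine ⟨?_, ?_⟩
        · have : ContinuousAt (fun δ : ℝ => δ ^ 3) 0 := by fun_prop
          have := this.tendsto
          simp only [ne_eq, OfNat.ofNat_ne_zero, not_false_eq_true, zero_pow] at this
          exact this.mono_left nhdsWithin_le_nhds
        · filter_upwards [self_mem_nhdsWithin] with δ hδ using pow_pos (mem_Ioi.1 hδ) 3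
      exact tendsto_inv_nhdsGT_zero.comp h₁
    filter_upwards [this.eventually_gt_atTop B] with δ hδ
    rwa [one_div]
  filter_upwards [hlarge, Ioo_mem_nhdsGT hδ₁] with δ hδB hδ
  have hδ0 : 0 < δ := hδ.1
  have hw : ∀ w ∈ Metric.ball (0 : ℂ) δ \ {0}, AnalyticAt ℂ qinv w ∧ q (qinv w) = w ∧
        qinv w ∈ openSquare (a / 2) \ {τ} ∧ F (qinv w) = -1 / w ^ 3 := fun w hw =>
    h₁ w (Metric.ball_subset_ball hδ.2.le hw.1) hw.2
  refine ⟨hw, fun z hz hz' => ?_, ?_⟩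
  · exact (hB z ⟨hz, fun hzV => hz' (hV z hzV).2.2⟩).trans hδB.le
  · ext z
    constructor
    · rintro ⟨hz, h0, hzF⟩
      have hzV : z ∈ V := by
        by_contra hzV
        have := hB z ⟨openSquare_subset_closedSquare _ hz, hzV⟩
        rw [← hF z hz h0] at this
        linarith
      obtain ⟨k₁, k₂, -⟩ := hV z hzV
      have k₃ := k₂ h0
      have hpos : 0 < ‖F z‖ := lt_trans (by positivity) hzF
      have hq : ‖q z‖ ^ 3 = 1 / ‖F z‖ := by
        rw [← norm_pow, k₃, norm_div, norm_neg, norm_one]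
      refine ⟨q z, ⟨?_, ?_⟩, k₁⟩
      · rw [mem_ball_zero_iff]
        refine lt_of_pow_lt_pow_left₀ 3 hδ0.le ?_
        rw [hq]
        rwa [one_div_lt hpos (by positivity)]
      · intro e
        have e : q z = 0 := e
        rw [e, norm_zero, zero_pow three_ne_zero] at hq
        have : 0 < 1 / ‖F z‖ := by positivity
        linarith
    · rintro ⟨w, hwm, rfl⟩
      obtain ⟨-, -, k₃, k₄⟩ := hw w hwm
      refine ⟨k₃.1, k₃.2, ?_⟩
      have hw0 : 0 < ‖w‖ := norm_pos_iff.2 hwm.2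
      rw [k₄, norm_div, norm_neg, norm_one, norm_pow]
      have := mem_ball_zero_iff.1 hwm.1
      gcongr

end IsLocalCoordinate

end

/-! ### The regularized integral -/

noncomputable section
open PeriodPair ComplexConjugate

variable {a : ℝ} {ha : 0 < a} {ε : ℝ} {c K τ : ℂ} {F q qinv : ℂ → ℂ}

theorem add_mul_I_add_real_mem {x y s : ℝ} (hx : x ∈ Icc (-s) s) (hy : y ∈ Icc (-s) s) :
    (x : ℂ) + y * Complex.I ∈ Icc (-s) s ×ℂ Icc (-s) s := by
  constructor <;> simpa using by assumption

namespace IsLocalCoordinate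

/-- The regularized integral of `|F'|²` over the period square. -/
theorem eventually_integral_eq (h : IsLocalCoordinate ha ε c K τ F q qinv)
    (hτ : τ ∈ openSquare (a / 2)) (hε : ε ^ 2 = halfValue ha ^ 2)
    (hF : ∀ z ∈ openSquare (a / 2), z ≠ τ → F z = c * sqPrimitive ha ε (z - τ) + K)
    {φ : ℂ → ℂ} (hφ : ∀ z, φ z
      = c * ((℘[squarePair a ha] (z - τ) - ε) * ℘[squarePair a ha] (z - τ))) :
    ∀ᶠ δ in 𝓝[>] (0 : ℝ),
      IntegrableOn (fun z => ‖φ z‖ ^ 2)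
        (openSquare (a / 2) \ {z | z = τ ∨ 1 / δ ^ 3 < ‖F z‖}) ∧
      ∫ z in openSquare (a / 2) \ {z | z = τ ∨ 1 / δ ^ 3 < ‖F z‖}, ‖φ z‖ ^ 2
        = ‖c‖ ^ 2 * (ε ^ 4 * a ^ 2 / 9 - ε ^ 2 * Real.pi ^ 2 / a ^ 2) + 3 * Real.pi / δ ^ 6 := by
  set S : Set ℂ := Icc (-(a / 2)) (a / 2) ×ℂ Icc (-(a / 2)) (a / 2) with hS
  set Φ : ℂ → ℂ := fun z => c * sqPrimitive ha ε (z - τ) + K with hΦdef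
  have hr : 0 < a / 2 := half_pos ha
  have hΦ : ∀ z ∈ S, z ≠ τ → HasDerivAt Φ (φ z) z := fun z hz h0 => by
    rw [hφ]
    exact (((hasDerivAt_sqPrimitive ha hε (sub_mem_openSquare_of_closedSquare hz hτ)
      (sub_ne_zero.2 h0)).comp_sub_const z τ).const_mul c).add_const K
  have hφd : ∀ z ∈ S, z ≠ τ → HasDerivAt φ (deriv φ z) z := fun z hz h0 => by
    have hn := notMem_lattice_of_mem_openSquare ha (sub_mem_openSquare_of_closedSquare hz hτ)
      (sub_ne_zero.2 h0)
    have h₁ := ((squarePair a ha).hasDerivAt_weierstrassP hn).comp_sub_const z τ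
    have h₂ := ((h₁.sub_const (ε : ℂ)).mul h₁).const_mul c
    have : φ = fun z => c * ((℘[squarePair a ha] (z - τ) - ε) * ℘[squarePair a ha] (z - τ)) :=
      funext hφ
    rw [this]
    exact h₂.differentiableAt.hasDerivAt
  have htop : Tendsto (fun z => ‖Φ z‖) (𝓝[≠] τ) atTop := h.tendsto_norm_atTop
  have hr1 : -(a / 2) ∈ Icc (-(a / 2)) (a / 2) := ⟨le_rfl, by linarith⟩
  have hr2 : a / 2 ∈ Icc (-(a / 2)) (a / 2) := ⟨by linarith, le_rfl⟩
  have hmem {x y : ℝ} (hx : x ∈ Icc (-(a / 2)) (a / 2)) (hy : y ∈ Icc (-(a / 2)) (a / 2)) :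
      (x : ℂ) + y * Complex.I - τ ∈ openSquare a :=
    sub_mem_openSquare_of_closedSquare (add_mul_I_add_real_mem hx hy) hτ
  have e₁ (y : ℝ) : ((a / 2 : ℝ) : ℂ) + y * Complex.I - τ
      = ((-(a / 2) : ℝ) : ℂ) + y * Complex.I - τ + a := by push_cast; ring
  have e₂ (x : ℝ) : (x : ℂ) + (a / 2 : ℝ) * Complex.I - τ
      = x + (-(a / 2) : ℝ) * Complex.I - τ + Complex.I * a := by push_cast; ring
  have hP₁ : ∀ y ∈ Icc (-(a / 2)) (a / 2), Φ ((a / 2 : ℝ) + y * Complex.I)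
      = Φ ((-(a / 2) : ℝ) + y * Complex.I) + c * (ε ^ 2 * a / 3 + ε * Real.pi / a : ℝ) := by
    intro y hy
    simp only [hΦdef]
    rw [e₁, sqPrimitive_add_period (hmem hr1 hy) (by rw [← e₁]; exact hmem hr2 hy)]
    ring
  have hP₂ : ∀ x ∈ Icc (-(a / 2)) (a / 2), Φ (x + (a / 2 : ℝ) * Complex.I)
      = Φ (x + (-(a / 2) : ℝ) * Complex.I)
        + c * (Complex.I * (ε ^ 2 * a / 3 - ε * Real.pi / a : ℝ)) := by
    intro x hx
    simp only [hΦdef]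
    rw [e₂, sqPrimitive_add_I_period (hmem hx hr1) (by rw [← e₂]; exact hmem hx hr2)]
    ring
  have hφ₁ : ∀ y ∈ Icc (-(a / 2)) (a / 2), φ ((a / 2 : ℝ) + y * Complex.I)
      = φ ((-(a / 2) : ℝ) + y * Complex.I) := by
    intro y _
    rw [hφ, hφ, e₁, weierstrassP_add_of_mem (ofReal_mem_lattice ha)]
  have hφ₂ : ∀ x ∈ Icc (-(a / 2)) (a / 2), φ (x + (a / 2 : ℝ) * Complex.I)
      = φ (x + (-(a / 2) : ℝ) * Complex.I) := by
    intro x _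
    rw [hφ, hφ, e₂, weierstrassP_add_of_mem (I_mul_ofReal_mem_lattice ha)]
  have hΦc : ContinuousOn Φ (S \ {τ}) := fun z hz =>
    (hΦ z hz.1 hz.2).continuousAt.continuousWithinAt
  filter_upwards [h.eventually_image hτ hF hΦc, self_mem_nhdsWithin] with δ hδ hδ0
  have hδ0 : 0 < δ := hδ0
  obtain ⟨hw, hbd, himg⟩ := hδ
  set E : Set ℂ := {z | z ∈ openSquare (a / 2) ∧ z ≠ τ ∧ 1 / δ ^ 3 < ‖F z‖} with hE
  -- The threshold lies strictly above `δ⁻⁶`, so `ψ` is locally constant `1` wherever `|Φ| ≤ δ⁻³`,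
  -- and there the cut-off density is `|φ|²`.
  have hT : 0 < 2 * (δ ^ 6)⁻¹ := by positivity
  obtain ⟨ψ, hψ, hψ1, hψ0⟩ := exists_cutoff hT
  have hsq {z : ℂ} (hz : ‖Φ z‖ ≤ 1 / δ ^ 3) : ‖Φ z‖ ^ 2 ≤ (δ ^ 6)⁻¹ := by
    calc ‖Φ z‖ ^ 2 ≤ (1 / δ ^ 3) ^ 2 := by gcongr
      _ = (δ ^ 6)⁻¹ := by field_simp
  have hlt : (δ ^ 6)⁻¹ < 2 * (δ ^ 6)⁻¹ := by
    have : 0 < (δ ^ 6)⁻¹ := by positivity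
    linarith
  set D : ℂ → ℝ := fun z => (deriv ψ (‖Φ z‖ ^ 2) * ‖Φ z‖ ^ 2 + ψ (‖Φ z‖ ^ 2)) * ‖φ z‖ ^ 2
    with hD
  obtain ⟨hDi, hDI⟩ := integral_cutoff_eq_periods hr hΦ hφd htop hψ hψ0 hτ
    (fun z hz hz' => hψ1 _ ((hsq (hbd z hz hz')).trans hlt.le)) hP₁ hP₂ hφ₁ hφ₂
  have hDI' : ∫ z in openSquare (a / 2), D z
      = ‖c‖ ^ 2 * (ε ^ 4 * a ^ 2 / 9 - ε ^ 2 * Real.pi ^ 2 / a ^ 2) := by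
    have h2I : (2 * Complex.I : ℂ) ≠ 0 := by simp
    have hcc : (‖c‖ : ℂ) ^ 2 = conj c * c := by rw [Complex.conj_mul']
    have ha' : (a : ℂ) ≠ 0 := by exact_mod_cast ha.ne'
    rw [← Complex.ofReal_inj]
    apply mul_left_cancel₀ h2I
    rw [hDI]
    push_cast
    rw [hcc]
    simp only [map_mul, map_add, map_sub, map_div₀, map_pow, Complex.conj_ofReal, Complex.conj_I,
      map_ofNat]
    field_simp
    ring
  have hbo : IsOpen (Metric.ball (0 : ℂ) δ \ {0}) := Metric.isOpen_ball.sdiff isClosed_singleton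
  have hΦw : ∀ w ∈ Metric.ball (0 : ℂ) δ \ {0}, Φ (qinv w) = -1 / w ^ 3 := fun w hwm => by
    obtain ⟨-, -, k₃, k₄⟩ := hw w hwm
    rw [← k₄, hF _ k₃.1 k₃.2]
  have hφw : ∀ w ∈ Metric.ball (0 : ℂ) δ \ {0}, φ (qinv w) * deriv qinv w = 3 / w ^ 4 := by
    intro w hwm
    obtain ⟨k₁, -, k₃, -⟩ := hw w hwm
    have hw0 : w ≠ 0 := hwm.2
    have d₁ := (hΦ _ (openSquare_subset_closedSquare _ k₃.1) k₃.2).comp w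
      k₁.differentiableAt.hasDerivAt
    have d₂ : HasDerivAt (fun w : ℂ => -1 / w ^ 3) (3 / w ^ 4) w := by
      refine ((hasDerivAt_const w (-1 : ℂ)).div (hasDerivAt_pow 3 w)
        (pow_ne_zero 3 hw0)).congr_deriv ?_
      field_simp
      ring
    refine d₁.unique (d₂.congr_of_eventuallyEq ?_)
    filter_upwards [hbo.mem_nhds hwm] with v hv using hΦw v hv
  -- In the coordinate `w` the density is radial on the punctured disc. Removing `E` therefore adds
  -- `3π/δ⁶` to the contribution of the periods.
  have hE_D : ∫ z in E, D z = -(3 * Real.pi / δ ^ 6) := by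
    set η : ℝ → ℝ := fun y =>
      (deriv ψ ((y ^ 6)⁻¹) * (y ^ 6)⁻¹ + ψ ((y ^ 6)⁻¹)) * (9 * (y ^ 8)⁻¹) with hη
    rw [himg, integral_image_of_hasDerivAt hbo.measurableSet (g' := deriv qinv)
      (fun w hwm => (hw w hwm).1.differentiableAt.hasDerivAt)
      (fun v hv w hwm e => by rw [← (hw v hv).2.1, e, (hw w hwm).2.1]),
      setIntegral_congr_fun hbo.measurableSet (g := fun w => η ‖w‖),
      setIntegral_punctured_ball η, integral_radial_cutoff hψ hψ0 hδ0, hψ1 _ hlt.le]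
    · field_simp
    · intro w hwm
      have hw0 : ‖w‖ ≠ 0 := norm_ne_zero_iff.2 hwm.2
      have n₁ : ‖Φ (qinv w)‖ ^ 2 = (‖w‖ ^ 6)⁻¹ := by
        rw [hΦw w hwm, norm_div, norm_neg, norm_one, norm_pow]
        field_simp
      have n₂ : ‖deriv qinv w‖ ^ 2 * ‖φ (qinv w)‖ ^ 2 = 9 * (‖w‖ ^ 8)⁻¹ := by
        rw [← mul_pow, mul_comm, ← norm_mul, hφw w hwm, norm_div, norm_pow,
          show ‖(3 : ℂ)‖ = 3 by norm_num, div_pow, ← pow_mul, div_eq_mul_inv]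
        norm_num
      simp only [hD, hη]
      rw [n₁, ← n₂]
      ring
  have hEo : IsOpen E := by
    have ho : IsOpen (openSquare (a / 2) \ {τ}) := (isOpen_openSquare _).sdiff isClosed_singleton
    have hc : ContinuousOn (fun z => ‖Φ z‖) (openSquare (a / 2) \ {τ}) :=
      (hΦc.mono (sdiff_subset_sdiff_left (openSquare_subset_closedSquare _))).norm
    convert hc.isOpen_inter_preimage ho (isOpen_Ioi (a := 1 / δ ^ 3)) using 1
    ext z
    simp only [hE, mem_ofPred_eq, mem_inter_iff, Set.mem_sdiff, mem_singleton_iff, mem_preimage, mem_Ioi]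
    constructor
    · rintro ⟨hz, h0, hlt⟩
      exact ⟨⟨hz, h0⟩, by rwa [hF z hz h0] at hlt⟩
    · rintro ⟨⟨hz, h0⟩, hlt⟩
      exact ⟨hz, h0, by rwa [hF z hz h0]⟩
  have hEm := hEo.measurableSet
  have hset : openSquare (a / 2) \ {z | z = τ ∨ 1 / δ ^ 3 < ‖F z‖}
      = (openSquare (a / 2) \ E) \ {τ} := by
    ext z
    simp only [Set.mem_sdiff, mem_ofPred_eq, mem_singleton_iff, hE]
    tauto
  have hae : ((openSquare (a / 2) \ E) \ {τ} : Set ℂ) =ᵐ[volume] (openSquare (a / 2) \ E : Set ℂ) :=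
    sdiff_null_ae_eq_self (measure_singleton τ)
  have hm : MeasurableSet ((openSquare (a / 2) \ E) \ {τ}) :=
    ((isOpen_openSquare _).measurableSet.diff hEm).diff (measurableSet_singleton τ)
  have heq : EqOn D (fun z => ‖φ z‖ ^ 2) ((openSquare (a / 2) \ E) \ {τ}) := by
    rintro z ⟨⟨hz, hzE⟩, h0⟩
    have hz' : ‖Φ z‖ ≤ 1 / δ ^ 3 := by
      by_contra hlt
      rw [not_le] at hlt
      exact hzE ⟨hz, h0, by rw [hF z hz h0]; exact hlt⟩
    have ht := (hsq hz').trans_lt hlt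
    have hd : ψ =ᶠ[𝓝 (‖Φ z‖ ^ 2)] fun _ => 1 := by
      filter_upwards [gt_mem_nhds ht] with t ht using hψ1 t (le_of_lt ht)
    simp only [hD, hd.deriv_eq, deriv_const, hd.self_of_nhds]
    ring
  rw [hset]
  refine ⟨(hDi.mono_set fun z hz => hz.1.1).congr_fun heq hm, ?_⟩
  rw [← setIntegral_congr_fun hm heq, setIntegral_congr_set hae,
    setIntegral_sdiff hEm hDi (fun z hz => hz.1), hDI', hE_D]
  ring

end IsLocalCoordinate

end

/-! ### Existence of the functions in a profile -/

noncomputable section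
open PeriodPair ComplexConjugate

variable {a : ℝ} {ha : 0 < a} {ε : ℝ} {ω τ p₁ p₃ : ℂ}

/-- `-1/F` is `(z - τ)³` times a nonvanishing analytic function, which has an analytic cube root
near `τ`; the resulting `q` has nonzero derivative and so a local inverse. -/
theorem exists_isLocalCoordinate (ha : 0 < a) (ε : ℝ) {c : ℂ} (hc : c ≠ 0) (τ : ℂ) :
    ∃ q qinv, IsLocalCoordinate ha ε c 0 τ (fun z => c * sqPrimitive ha ε (z - τ)) q qinv := by
  have hM := hasTaylorThree_cubedPrimitive ha ε c 0
  have hM0 : cubedPrimitive ha ε c 0 0 ≠ 0 := by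
    rw [hM.apply_zero]
    simpa
  set m : ℂ → ℂ := fun u => -1 / cubedPrimitive ha ε c 0 u with hm
  have hmA : AnalyticAt ℂ m 0 := analyticAt_const.div hM.analyticAt hM0
  have hm0 : m 0 ≠ 0 := div_ne_zero (by norm_num) hM0
  obtain ⟨β, hβ⟩ := IsAlgClosed.exists_pow_nat_eq (m 0) (n := 3) (by norm_num)
  set n : ℂ → ℂ := fun u => β * Complex.exp (1 / 3 * Complex.log (m u / m 0)) with hn
  have hnA : AnalyticAt ℂ n 0 := by
    refine analyticAt_const.mul (AnalyticAt.cexp (analyticAt_const.mul (AnalyticAt.clog ?_ ?_)))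
    · exact hmA.div analyticAt_const hm0
    · simp [div_self hm0]
  have hn3 : ∀ᶠ u in 𝓝 0, n u ^ 3 = m u := by
    filter_upwards [hmA.continuousAt.eventually_ne hm0] with u hu
    simp only [hn]
    rw [mul_pow, hβ, ← Complex.exp_nat_mul]
    rw [show ((3 : ℕ) : ℂ) * (1 / 3 * Complex.log (m u / m 0)) = Complex.log (m u / m 0) by
      push_cast; ring, Complex.exp_log (div_ne_zero hu hm0)]
    field_simp
  have hn0 : n 0 ≠ 0 := fun h => hm0 (by
    rw [← hn3.self_of_nhds, h]; simp)
  have hsub : Tendsto (fun z => z - τ) (𝓝 τ) (𝓝 0) := by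
    have : ContinuousAt (fun z => z - τ) τ := by fun_prop
    simpa [ContinuousAt] using this
  have hnA' : AnalyticAt ℂ (fun z => n (z - τ)) τ :=
    hnA.comp_of_eq (f := fun z => z - τ) (by fun_prop) (sub_self τ)
  set q : ℂ → ℂ := fun z => (z - τ) * n (z - τ) with hq
  have hqA : AnalyticAt ℂ q τ := AnalyticAt.mul (by fun_prop) hnA'
  have hq0 : q τ = 0 := by simp [hq]
  have hqd : deriv q τ ≠ 0 := by
    have := ((hasDerivAt_id τ).sub_const τ).mul hnA'.differentiableAt.hasDerivAt
    have e : deriv q τ = n 0 := (HasDerivAt.deriv (f := q) this).trans (by simp)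
    rwa [e]
  have hqi := hqA.analyticAt_localInverse hqd
  have hri := hqA.hasStrictDerivAt.eventually_right_inverse hqd
  rw [hq0] at hqi hri
  refine ⟨q, _, hc, Eventually.of_forall fun z => (add_zero _).symm, hqA, ?_, hqi, ?_, hri⟩
  · filter_upwards [self_mem_nhdsWithin, mem_nhdsWithin_of_mem_nhds (hsub.eventually hn3)]
      with z h0 h₃
    have hu : z - τ ≠ 0 := sub_ne_zero.2 h0
    have h₃ : n (z - τ) ^ 3 = m (z - τ) := h₃
    simp only [hq]
    rw [mul_pow, h₃]
    simp only [hm]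
    rw [cubedPrimitive_eq ha hu, add_zero, mul_div_assoc']
    rw [mul_comm ((z - τ) ^ 3) (-1), mul_comm ((z - τ) ^ 3), mul_div_mul_right _ _ (pow_ne_zero 3 hu)]
  · have := HasStrictFDerivAt.localInverse_apply_image
      (hqA.hasStrictDerivAt.hasStrictFDerivAt_equiv hqd)
    rw [hq0] at this
    exact this

variable {n₁ n₂ : ℕ} {p : Fin 3 → ℂ}

theorem Ω_squareConfig (ha : 0 < a) : (squareConfig a n₁ n₂ τ p).Ω = openSquare (a / 2) :=
  periodDomain_eq_openSquare ha

theorem area_squareConfig (ha : 0 < a) : (squareConfig a n₁ n₂ τ p).area = a ^ 2 :=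
  torusArea_square ha

theorem curlyH₀_squareConfig (ha : 0 < a) (hn : (n₁ = 2 ∧ n₂ = 0) ∨ (n₁ = 0 ∧ n₂ = 2))
    (hp₁ : (if n₁ = 2 then p 0 else p 1) = p₁) (Hs : ℂ → ℂ) (z : ℂ) :
    (squareConfig a n₁ n₂ τ p).curlyH₀ Hs z = vortexH a τ p₁ (p 2) Hs z / (z - τ) ^ 4 := by
  rw [VortexConfig.curlyH₀, curlyH_squareConfig ha τ p Hs hn, hp₁]
  rfl

theorem exists_isVortexPair (ha : 0 < a) (hn : (n₁ = 2 ∧ n₂ = 0) ∨ (n₁ = 0 ∧ n₂ = 2))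
    (hτ : τ ∈ periodDomain a (Complex.I * a))
    (hp : ∀ j, (![n₁, n₂, 2] : Fin 3 → ℕ) j ≠ 0 →
      p j ∈ periodDomain a (Complex.I * a) ∧
      p j - (squareHalfPeriod a j + τ) ∈ periodLattice a (Complex.I * a)) :
    ∃ (ω : ℂ) (ε : ℝ), IsVortexPair ha ω τ (if n₁ = 2 then p 0 else p 1) (p 2) ε := by
  rw [periodDomain_eq_openSquare ha] at hτ hp
  obtain ⟨h₂, h₂'⟩ := hp 2 (by simp)
  rw [mem_periodLattice_iff ha] at h₂'
  rcases hn with ⟨rfl, rfl⟩ | ⟨rfl, rfl⟩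
  · obtain ⟨h₁, h₁'⟩ := hp 0 (by simp)
    rw [mem_periodLattice_iff ha] at h₁'
    exact ⟨a / 2, halfValue ha, two_mul_half_mem ha, half_notMem ha, weierstrassP_half ha, rfl,
      hτ, h₁, h₂, h₁', h₂'⟩
  · obtain ⟨h₁, h₁'⟩ := hp 1 (by simp)
    rw [mem_periodLattice_iff ha] at h₁'
    exact ⟨Complex.I * a / 2, -halfValue ha, two_mul_I_half_mem ha, I_half_notMem ha,
      by rw [weierstrassP_I_half]; push_cast; rfl, by ring, hτ, h₁, h₂, h₁', h₂'⟩

theorem nonempty_profile (hn : (n₁ = 2 ∧ n₂ = 0) ∨ (n₁ = 0 ∧ n₂ = 2))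
    (h : IsVortexPair ha ω τ (if n₁ = 2 then p 0 else p 1) (p 2) ε) :
    Nonempty (squareConfig a n₁ n₂ τ p).Profile := by
  have hG := isTorusGreen_squareGreen ha
  have hH := isHStar_logSigma ha
  obtain ⟨c, hc, hHc⟩ := exists_vortexH_eq hG hH h
  obtain ⟨q, qinv, hq⟩ := exists_isLocalCoordinate ha ε hc τ
  refine ⟨⟨squareGreen ha, _, _, q, qinv, hG, hH, fun z hz h0 => ?_, hq.analyticAt_q, hq.q_pow,
    hq.analyticAt_qinv, hq.qinv_zero, hq.q_qinv⟩⟩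
  rw [Ω_squareConfig ha] at hz
  have h0 : z ≠ τ := h0
  rw [curlyH₀_squareConfig ha hn rfl, vortexH_div_eq (hHc z hz) h0]
  exact ((hasDerivAt_sqPrimitive ha h.sq_eq (sub_mem_openSquare hz h.τ_mem)
    (sub_ne_zero.2 h0)).comp_sub_const z τ).const_mul c

end

/-! ### The values of `D₀`, `Γ`, `Υ` and the final inequality -/

noncomputable section
open PeriodPair ComplexConjugate

variable {a : ℝ} {ha : 0 < a} {ε : ℝ} {ω τ : ℂ} {n₁ n₂ : ℕ} {p : Fin 3 → ℂ}

/-- In the coordinates of the square torus, the weight is `|𝓗₀|²`. -/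
theorem weight_squareConfig (hn : (n₁ = 2 ∧ n₂ = 0) ∨ (n₁ = 0 ∧ n₂ = 2))
    (h : IsVortexPair ha ω τ (if n₁ = 2 then p 0 else p 1) (p 2) ε)
    (P : (squareConfig a n₁ n₂ τ p).Profile) {z : ℂ} (hz : z ∈ openSquare (a / 2)) (h0 : z ≠ τ)
    (h₁ : z ≠ if n₁ = 2 then p 0 else p 1) (h₃ : z ≠ p 2) :
    P.weight z = ‖(squareConfig a n₁ n₂ τ p).curlyH₀ P.Hs z‖ ^ 2 := by
  have hu : ‖z - τ‖ ≠ 0 := norm_ne_zero_iff.2 (sub_ne_zero.2 h0)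
  have hV := norm_ne_zero_iff.2 (vortexH_ne_zero (a := a) (τ := τ) (Hs := P.Hs) h₁ h₃)
  have hlog := log_norm_vortexH P.isHStar h hz h0 h₁ h₃
  rw [curlyH₀_squareConfig ha hn rfl, norm_div, norm_pow, VortexConfig.Profile.weight,
    u₀_squareConfig τ p P.G hn]
  set v := ‖vortexH a τ (if n₁ = 2 then p 0 else p 1) (p 2) P.Hs z‖ with hv
  have hpos : 0 < v / ‖z - τ‖ ^ 4 := by positivity
  rw [← Real.exp_log (pow_pos hpos 2), Real.log_pow, Real.log_div hV (by positivity), Real.log_pow,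
    hlog]
  congr 1
  change _ + 8 * Real.pi * (((2 : ℕ) : ℝ) + 1) * P.G (z - τ) = _
  push_cast
  ring

/-- The data of a profile, in the coordinates of the square torus. -/
theorem exists_isLocalCoordinate_profile (hn : (n₁ = 2 ∧ n₂ = 0) ∨ (n₁ = 0 ∧ n₂ = 2))
    (h : IsVortexPair ha ω τ (if n₁ = 2 then p 0 else p 1) (p 2) ε)
    (P : (squareConfig a n₁ n₂ τ p).Profile) : ∃ c K : ℂ,
      IsLocalCoordinate ha ε c K τ P.F P.q P.qinv ∧
      (∀ z ∈ openSquare (a / 2), z ≠ τ → P.F z = c * sqPrimitive ha ε (z - τ) + K) ∧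
      (∀ z ∈ openSquare (a / 2), (squareConfig a n₁ n₂ τ p).curlyH P.Hs z
        = c * vortexModel (ha := ha) ε (z - τ)) ∧
      (∀ z ∈ openSquare (a / 2), z ≠ τ → (squareConfig a n₁ n₂ τ p).curlyH₀ P.Hs z
        = c * ((℘[squarePair a ha] (z - τ) - ε) * ℘[squarePair a ha] (z - τ))) := by
  obtain ⟨c, hc, hH⟩ := exists_vortexH_eq P.isGreen P.isHStar h
  have hH₀ : ∀ z ∈ openSquare (a / 2), z ≠ τ → (squareConfig a n₁ n₂ τ p).curlyH₀ P.Hs z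
      = c * ((℘[squarePair a ha] (z - τ) - ε) * ℘[squarePair a ha] (z - τ)) := fun z hz h0 => by
    rw [curlyH₀_squareConfig ha hn rfl, vortexH_div_eq (hH z hz) h0]
  obtain ⟨K, hK⟩ := exists_primitive_eq (F := P.F) h (c := c) fun z hz h0 => by
    rw [← hH₀ z hz h0]
    exact P.hasDerivAt_F z (by rwa [Ω_squareConfig ha]) h0
  refine ⟨c, K, ⟨hc, ?_, P.analyticAt_q, P.q_pow, P.analyticAt_qinv, P.qinv_zero, P.q_qinv⟩, hK,
    fun z hz => ?_, hH₀⟩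
  · filter_upwards [mem_nhdsWithin_of_mem_nhds ((isOpen_openSquare _).mem_nhds h.τ_mem),
      self_mem_nhdsWithin] with z hz h0 using hK z hz h0
  · rw [curlyH_squareConfig ha τ p P.Hs hn, hH z hz]

theorem isD₀_squareConfig (hn : (n₁ = 2 ∧ n₂ = 0) ∨ (n₁ = 0 ∧ n₂ = 2))
    (h : IsVortexPair ha ω τ (if n₁ = 2 then p 0 else p 1) (p 2) ε)
    (P : (squareConfig a n₁ n₂ τ p).Profile) {c K : ℂ}
    (hloc : IsLocalCoordinate ha ε c K τ P.F P.q P.qinv)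
    (hF : ∀ z ∈ openSquare (a / 2), z ≠ τ → P.F z = c * sqPrimitive ha ε (z - τ) + K)
    (hH₀ : ∀ z ∈ openSquare (a / 2), z ≠ τ → (squareConfig a n₁ n₂ τ p).curlyH₀ P.Hs z
        = c * ((℘[squarePair a ha] (z - τ) - ε) * ℘[squarePair a ha] (z - τ))) :
    P.IsD₀ (1 / Real.pi * (‖c‖ ^ 2 * (ε ^ 4 * a ^ 2 / 9 - ε ^ 2 * Real.pi ^ 2 / a ^ 2))) := by
  set φ : ℂ → ℂ := fun z =>
    c * ((℘[squarePair a ha] (z - τ) - ε) * ℘[squarePair a ha] (z - τ)) with hφ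
  have key := hloc.eventually_integral_eq h.τ_mem h.sq_eq hF (φ := φ) fun _ => rfl
  -- The radius in the coordinate `q₀` is `δ = ρ^(1/3)`, since `σ₀ = q₀³`. The term `3π/δ⁶ = 3π/ρ²`
  -- is then exactly the subtracted integral of `3/|y|⁴`.
  have hroot : Tendsto (fun ρ : ℝ => ρ ^ (1 / 3 : ℝ)) (𝓝[>] 0) (𝓝[>] 0) := by
    rw [tendsto_nhdsWithin_iff]
    refine ⟨?_, ?_⟩
    · have : ContinuousAt (fun ρ : ℝ => ρ ^ (1 / 3 : ℝ)) 0 :=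
        Real.continuousAt_rpow_const _ _ (Or.inr (by norm_num))
      have := this.tendsto
      rw [Real.zero_rpow (by norm_num)] at this
      exact this.mono_left nhdsWithin_le_nhds
    · filter_upwards [self_mem_nhdsWithin] with ρ hρ using Real.rpow_pos_of_pos hρ _
  have hae : ∀ᵐ z : ℂ, z ∈ openSquare (a / 2) → ‖φ z‖ ^ 2 = P.weight z := by
    filter_upwards [compl_mem_ae_iff.2 (measure_singleton (μ := volume) τ),
      compl_mem_ae_iff.2 (measure_singleton (μ := volume) (if n₁ = 2 then p 0 else p 1)),
      compl_mem_ae_iff.2 (measure_singleton (μ := volume) (p 2))] with z h0 h₁ h₃ hz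
    rw [weight_squareConfig hn h P hz h0 h₁ h₃, hH₀ z hz h0]
  unfold VortexConfig.Profile.IsD₀
  filter_upwards [hroot.eventually key, self_mem_nhdsWithin] with ρ hρ hρ0
  have hρ0 : 0 < ρ := hρ0
  have e₃ : (ρ ^ (1 / 3 : ℝ)) ^ 3 = ρ := by
    rw [← Real.rpow_natCast, ← Real.rpow_mul hρ0.le]
    norm_num
  have e₆ : (ρ ^ (1 / 3 : ℝ)) ^ 6 = ρ ^ 2 := by
    rw [show 6 = 3 * 2 by norm_num, pow_mul, e₃]
  rw [e₃, e₆] at hρ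
  obtain ⟨hi, hI⟩ := hρ
  obtain ⟨hi', hI'⟩ := integral_norm_inv_pow_four hρ0
  have hc : ∀ y : ℂ, (((squareConfig a n₁ n₂ τ p).n : ℝ) + 1) / ‖y‖ ^ 4 = 3 / ‖y‖ ^ 4 := fun y => by
    change (((2 : ℕ) : ℝ) + 1) / ‖y‖ ^ 4 = 3 / ‖y‖ ^ 4
    norm_num
  have hS : (squareConfig a n₁ n₂ τ p).Ω \ P.sigmaBall ρ
      = openSquare (a / 2) \ {z | z = τ ∨ 1 / ρ < ‖P.F z‖} := by
    rw [Ω_squareConfig ha]; rfl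
  have hm : ∀ᵐ z ∂volume.restrict (openSquare (a / 2) \ {z | z = τ ∨ 1 / ρ < ‖P.F z‖}),
      ‖φ z‖ ^ 2 = P.weight z :=
    ae_restrict_of_ae_restrict_of_subset sdiff_subset
      ((ae_restrict_iff' (isOpen_openSquare _).measurableSet).2 hae)
  simp only [hc, hS]
  refine ⟨hi.congr hm, hi', ?_⟩
  rw [← integral_congr_ae hm, hI, hI']
  ring

theorem Γ_squareConfig
    (P : (squareConfig a n₁ n₂ τ p).Profile) {c K : ℂ}
    (hloc : IsLocalCoordinate ha ε c K τ P.F P.q P.qinv)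
    (hH : ∀ᶠ z in 𝓝 τ, (squareConfig a n₁ n₂ τ p).curlyH P.Hs z
        = c * vortexModel (ha := ha) ε (z - τ)) :
    P.Γ = -(2 / 3) * c ^ 2 * ε ^ 3 := by
  obtain ⟨C, hC⟩ := P.isHStar.exists_eq ha P.isGreen
  have hf : ∀ᶠ z in 𝓝 τ, P.f z = 2 / 3 * (K + c * ε ^ 2 / 3 * (z - τ)) := by
    filter_upwards [hloc.eventually_coefficient_eq hC] with z hz
    rw [← hz]
    change 1 / ((Nat.factorial 3 : ℕ) : ℂ) * _ = _
    congr 1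
  rw [← iteratedDeriv_three_vortexH_mul hH hf]
  change 1 / ((Nat.factorial 2 : ℕ) : ℂ) * _ = _
  congr 1

theorem Υ_squareConfig (ha : 0 < a)
    (P : (squareConfig a n₁ n₂ τ p).Profile) {c K : ℂ}
    (hloc : IsLocalCoordinate ha ε c K τ P.F P.q P.qinv)
    (hH : ∀ᶠ z in 𝓝 τ, (squareConfig a n₁ n₂ τ p).curlyH P.Hs z
        = c * vortexModel (ha := ha) ε (z - τ)) :
    P.Υ = (-(2 * Real.pi * ε ^ 2 * ‖c‖ ^ 2 / a ^ 2) : ℝ) := by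
  have hb : P.b = -(c * ε / 3) := by
    rw [← hloc.coefficient_qinv]
    change 1 / ((Nat.factorial 3 : ℕ) : ℂ) * _ = _
    congr 1
  have h₂ : iteratedDeriv (squareConfig a n₁ n₂ τ p).n
      ((squareConfig a n₁ n₂ τ p).curlyH P.Hs) (squareConfig a n₁ n₂ τ p).p = -2 * c * ε :=
    iteratedDeriv_two_vortexH hH
  have hcc : (‖c‖ : ℂ) ^ 2 = conj c * c := by rw [Complex.conj_mul']
  have ha' : (a : ℂ) ≠ 0 := by exact_mod_cast ha.ne'
  rw [VortexConfig.Profile.Υ, h₂, hb, area_squareConfig ha]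
  change -(2 * Real.pi * (((2 : ℕ) : ℂ) + 1) / ((a ^ 2 : ℝ) * ((Nat.factorial 2 : ℕ) : ℂ))) * _ * _ = _
  push_cast
  rw [hcc]
  simp only [map_neg, map_mul, map_div₀, Complex.conj_ofReal, map_ofNat, Nat.factorial]
  push_cast
  field_simp
  ring

/-- Both terms on the right are nonpositive, the second because `ea² < 3π`. The first alone already
exceeds the left side in modulus, again by `ea² < 3π`. -/
theorem nondegeneracy_inequality (ha : 0 < a) (hε : ε ^ 2 = halfValue ha ^ 2) {r : ℝ} (hr : 0 < r) :
    2 / 3 * r ^ 2 * |ε| ^ 3 < |-(2 * Real.pi * ε ^ 2 * r ^ 2 / a ^ 2)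
      + 14 / 3 * (1 / Real.pi * (r ^ 2 * (ε ^ 4 * a ^ 2 / 9 - ε ^ 2 * Real.pi ^ 2 / a ^ 2)))| := by
  obtain ⟨h₁, h₂⟩ := halfValue_bound ha
  have hπ := Real.pi_pos
  set e := halfValue ha with he
  have hε' : |ε| = e := by rw [← abs_of_pos h₁]; exact (sq_eq_sq_iff_abs_eq_abs _ _).1 hε
  have h4 : ε ^ 4 = e ^ 4 := by
    rw [show ε ^ 4 = (ε ^ 2) ^ 2 by ring, hε]; ring
  rw [hε', hε, h4]
  have hneg : e ^ 4 * a ^ 2 / 9 - e ^ 2 * Real.pi ^ 2 / a ^ 2 ≤ 0 := by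
    have : e ^ 4 * a ^ 2 / 9 - e ^ 2 * Real.pi ^ 2 / a ^ 2
        = e ^ 2 / (9 * a ^ 2) * ((e * a ^ 2) ^ 2 - (3 * Real.pi) ^ 2) := by
      field_simp
      ring
    rw [this]
    refine mul_nonpos_of_nonneg_of_nonpos (by positivity) ?_
    have : (e * a ^ 2) ^ 2 ≤ (3 * Real.pi) ^ 2 := by gcongr
    linarith
  have hD : 14 / 3 * (1 / Real.pi * (r ^ 2 * (e ^ 4 * a ^ 2 / 9 - e ^ 2 * Real.pi ^ 2 / a ^ 2))) ≤ 0 := by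
    refine mul_nonpos_of_nonneg_of_nonpos (by norm_num)
      (mul_nonpos_of_nonneg_of_nonpos (by positivity)
        (mul_nonpos_of_nonneg_of_nonpos (by positivity) hneg))
  have hmain : 2 / 3 * r ^ 2 * e ^ 3 < 2 * Real.pi * e ^ 2 * r ^ 2 / a ^ 2 := by
    rw [lt_div_iff₀ (by positivity)]
    have : 0 < r ^ 2 * e ^ 2 := by positivity
    nlinarith [mul_lt_mul_of_pos_left h₂ this]
  refine lt_of_lt_of_le hmain ?_
  rw [abs_of_nonpos]
  · linarith
  · have : 0 < 2 * Real.pi * e ^ 2 * r ^ 2 / a ^ 2 := by positivity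
    linarith

end

theorem mainTheorem5 (a : ℝ) (ha : 0 < a) (n₁ n₂ : ℕ)
    (hn : (n₁ = 2 ∧ n₂ = 0) ∨ (n₁ = 0 ∧ n₂ = 2))
    (τ : ℂ) (hτ : τ ∈ periodDomain a (Complex.I * a))
    (p : Fin 3 → ℂ)
    (hp : ∀ j, (![n₁, n₂, 2] : Fin 3 → ℕ) j ≠ 0 →
      p j ∈ periodDomain a (Complex.I * a) ∧
      p j - (squareHalfPeriod a j + τ) ∈ periodLattice a (Complex.I * a)) :
    (squareConfig a n₁ n₂ τ p).NondegeneracyCondition := by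
  obtain ⟨ω, ε, h⟩ := exists_isVortexPair ha hn hτ hp
  refine ⟨nonempty_profile hn h, fun P => ?_⟩
  obtain ⟨c, K, hloc, hF, hH, hH₀⟩ := exists_isLocalCoordinate_profile hn h P
  have hHτ := Filter.mem_of_superset ((isOpen_openSquare _).mem_nhds h.τ_mem) hH
  refine ⟨_, isD₀_squareConfig hn h P hloc hF hH₀, ?_⟩
  rw [Γ_squareConfig P hloc hHτ, Υ_squareConfig ha P hloc hHτ, ← Complex.ofReal_add,
    Complex.norm_real, Real.norm_eq_abs]
  have hlt := nondegeneracy_inequality ha h.sq_eq (norm_pos_iff.2 hloc.ne_zero)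
  have e₁ : ‖-(2 / 3 : ℂ) * c ^ 2 * ε ^ 3‖ = 2 / 3 * ‖c‖ ^ 2 * |ε| ^ 3 := by
    rw [norm_mul, norm_mul, norm_neg, norm_pow, norm_pow, Complex.norm_real, Real.norm_eq_abs]
    norm_num
  have e₂ : ((squareConfig a n₁ n₂ τ p).n : ℝ) * (2 * (squareConfig a n₁ n₂ τ p).n + 3)
      / ((squareConfig a n₁ n₂ τ p).n + 1) = 14 / 3 := by
    change ((2 : ℕ) : ℝ) * (2 * ((2 : ℕ) : ℝ) + 3) / (((2 : ℕ) : ℝ) + 1) = 14 / 3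
    norm_num
  rw [e₁, e₂]
  exact hlt.ne
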